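/- **Theorem 3.3.** Let $K$ be a field, let $G$ be a simple graph on the vertex set $[n]=\{1,\dots,n\}$, let $S=K[x_1,\dots,x_n,y_1,\dots,y_n]$, and let $$J_G=\bigl(x_iy_j-x_jy_i \,:\, 1\le i<j\le n,\ \{i,j\}\in E(G)\bigr)\subset S$$ be the binomial edge ideal of $G$. Let $\Delta(G)$ be the clique complex of $G$; its facets are the maximal cliques of $G$. For integers $a\le b$ write $[a,b]=\{a,a+1,\dots,b\}$. Assume that $G$ is *closed* with respect to the given labelling, that is: if $\{i,j\},\{i,k\}\in E(G)$ with $i<j$, $i<k$, $j\ne k$, then $\{j,k\}\in E(G)$; and if $\{i,k\},\{j,k\}\in E(G)$ with $i<k$, $j<k$, $i\neq j$, then $\{i,j\}\in E(G)$. Assume also that $G$ is *indecomposable*, that is, $G$ is connected and there are no two subgraphs $G_1,G_2$ of $G$, each with at least two vertices, such that $G=G_1\cup G_2$ and $V(G_1)\cap V(G_2)=\{v\}$ for a vertex $v$ which belongs to exactly one maximal clique of $G_1$ and to exactly one maximal clique of $G_2$. Let $\dim$ denote Krull dimension, and let $\operatorname{depth} S/J_G$ be the maximal length of an $S/J_G$-regular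 sequence in the ideal $(x_1,\dots,x_n,y_1,\dots,y_n)$. Suppose that $J_G$ is not Cohen–Macaulay, i.e. $\operatorname{depth} S/J_G\neq\dim S/J_G$. Then $J_G$ is almost Cohen–Macaulay, i.e. $\operatorname{depth} S/J_G\ge \dim S/J_G-1$, if and only if one of the following conditions holds: (a) $\Delta(G)$ has exactly two facets, and they intersect in exactly two vertices; (b) $\Delta(G)$ has exactly three facets, namely $[1,b]$, $[b-1,b+1]$, $[b,n]$ for some integer $b$ with $3\le b\le n-2$; (c) $\Delta(G)$ has exactly four facets, namely $[1,b]$, $[b-1,b+1]$, $[b,b+2]$, $[b+1,n]$ for some integer $b$ with $3\le b\le n-3$. -/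

import Mathlib

noncomputable section

open MvPolynomial

/-! ### Depth, Cohen-Macaulay and almost Cohen-Macaulay graded modules -/

/-- The depth of a finitely generated graded module `M` over a polynomial ring: the supremum of
the lengths of the `M`-regular sequences contained in the ideal generated by all the variables, the homogeneous
maximal ideal. -/
def gradedDepth (σ K : Type*) [Field K] (M : Type*) [AddCommGroup M]
    [Module (MvPolynomial σ K) M] : ℕ∞ :=
  ⨆ rs : {rs : List (MvPolynomial σ K) //
      (∀ r ∈ rs, r ∈ idealOfVars σ K) ∧ RingTheory.Sequence.IsRegular M rs},
    (rs.1.length : ℕ∞)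

/-- A (nonzero finitely generated graded) module is Cohen-Macaulay if its depth is equal to its
Krull dimension. -/
def IsGradedCohenMacaulay (σ K : Type*) [Field K] (M : Type*) [AddCommGroup M]
    [Module (MvPolynomial σ K) M] : Prop :=
  (gradedDepth σ K M : WithBot ℕ∞) = Module.supportDim (MvPolynomial σ K) M

/-- A (nonzero finitely generated graded) module is almost Cohen-Macaulay if its depth is at
least its Krull dimension minus one. -/
def IsGradedAlmostCohenMacaulay (σ K : Type*) [Field K] (M : Type*) [AddCommGroup M]
    [Module (MvPolynomial σ K) M] : Prop :=
  Module.supportDim (MvPolynomial σ K) M ≤ (gradedDepth σ K M : WithBot ℕ∞) + 1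

/-! ### Binomial edge ideals

The polynomial ring in the `2n` variables `x₁, …, xₙ, y₁, …, yₙ` is
`MvPolynomial (Fin n ⊕ Fin n) K`, with `xᵢ = X (Sum.inl i)` and `yᵢ = X (Sum.inr i)`. -/

/-- The binomial edge ideal of `G`, generated by the binomials `xᵢ yⱼ - xⱼ yᵢ` where `i < j` and
`{i, j}` is an edge of `G`. -/
def binomialEdgeIdeal (K : Type*) [Field K] {n : ℕ} (G : SimpleGraph (Fin n)) :
    Ideal (MvPolynomial (Fin n ⊕ Fin n) K) :=
  Ideal.span {f | ∃ i j : Fin n, i < j ∧ G.Adj i j ∧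
    f = X (Sum.inl i) * X (Sum.inr j) - X (Sum.inl j) * X (Sum.inr i)}

/-! ### Clique complexes, closed graphs, indecomposable graphs -/

/-- The facets of the clique complex of `G`, that is, the maximal cliques of `G`. -/
def cliqueComplexFacets {V : Type*} (G : SimpleGraph V) : Set (Set V) :=
  {F | Maximal G.IsClique F}

/-- `G` is closed (with respect to the given labelling of its vertices by `Fin n`): if `{i, j}`
and `{i, k}` are edges with `i < j`, `i < k` and `j ≠ k`, then `{j, k}` is an edge, and if
`{i, k}` and `{j, k}` are edges with `i < k`, `j < k` and `i ≠ j`, then `{i, j}` is an edge. -/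
def IsClosedGraph {n : ℕ} (G : SimpleGraph (Fin n)) : Prop :=
  (∀ i j k : Fin n, i < j → i < k → j ≠ k → G.Adj i j → G.Adj i k → G.Adj j k) ∧
  (∀ i j k : Fin n, i < k → j < k → i ≠ j → G.Adj i k → G.Adj j k → G.Adj i j)

/-- A free vertex: a vertex that belongs to exactly one maximal clique. -/
def IsFreeVertex {V : Type*} (G : SimpleGraph V) (v : V) : Prop :=
  ∃! F : Set V, F ∈ cliqueComplexFacets G ∧ v ∈ F

/-- `G` is decomposable if it is the union of two subgraphs `G₁`, `G₂` that have exactly one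
vertex `v` in common, where `v` is a free vertex of both. Neither of the two subgraphs may
consist of the vertex `v` alone (otherwise every graph with a free vertex would decompose
trivially). -/
def IsDecomposable {V : Type*} (G : SimpleGraph V) : Prop :=
  ∃ (G₁ G₂ : G.Subgraph) (v : V) (h₁ : v ∈ G₁.verts) (h₂ : v ∈ G₂.verts),
    G₁ ⊔ G₂ = ⊤ ∧ G₁.verts ∩ G₂.verts = {v} ∧ G₁.verts ≠ {v} ∧ G₂.verts ≠ {v} ∧
      IsFreeVertex G₁.coe ⟨v, h₁⟩ ∧ IsFreeVertex G₂.coe ⟨v, h₂⟩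

/-- An indecomposable graph: a connected graph that is not decomposable. -/
def IsIndecomposable {V : Type*} (G : SimpleGraph V) : Prop :=
  G.Connected ∧ ¬ IsDecomposable G

/-- The interval `[a, b]` of vertices, in the usual numbering of the vertices by `1, …, n`: the
element `v` of `Fin n` is the vertex with the number `v + 1`. -/
def vertexInterval (n a b : ℕ) : Set (Fin n) :=
  {v | a ≤ (v : ℕ) + 1 ∧ (v : ℕ) + 1 ≤ b}

end

/-! A connected closed graph contains the path 1, 2, …, n. Consecutive columns are then proportional
modulo any prime over `J_G`, so `dim S/J_G ≤ n + 1`. The complete graph gives the reverse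
inequality. Hence almost Cohen–Macaulay means depth at least `n`, and the failure of
Cohen–Macaulayness serves only to exclude the complete graph.

Lower bounds. At a vertex `v`, `J_G` is the intersection of the ideal of `G` with the neighbourhood
of `v` completed and the ideal of `G - v` plus the two variables of `v`
(`edgeIdeal_completeAt_inf`). The sum of the two is again of the second kind, so the depth lemma
reduces everything to disjoint cliques. These have depth at least the number of vertices plus the
number of cliques (`depthGE_edgeIdeal_of_equivalence`). Two cliques with `k` common vertices get
depth at least `n + 2 - k`, and the interval families (b) and (c) reduce to this in one further
step.

Upper bounds. The depth is at most `dim S/𝔞` whenever `𝔞` kills a nonzero class of `S/J_G`. If a set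
of `k` vertices separates `l` from `r` and all its members are adjacent to both, its variables kill
the minor of `l` and `r`, and the depth is at most `n - k + 2` (`depthGE_le_of_isBreak`). Two such
sets far enough apart are handled with a product of minors. A connectedness argument for two
components (`DepthGE.le_ringKrullDim_add_one`) treats one remaining configuration.

Combinatorics. A connected closed graph is encoded by the monotone function `c`, where `c i` is the
last vertex adjacent or equal to `i`. Each jump `c l < c (l + 1)` gives a separating set with `c l -
l` elements. Depth at least `n` and indecomposability force `c l = l + 2` at every jump, and all
jumps lie among three consecutive vertices starting with the first jump. Of the four jump patterns,
the one with jumps exactly at `l` and `l + 2` is excluded by `depthGE_le_of_three_cliques`. The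
other three are (a), (b) and (c). -/

section

/-! ### Depth through the vanishing of Ext -/

open CategoryTheory Abelian RingTheory.Sequence Pointwise

universe u

/-- The vanishing of the `Ext` modules `Extⁱ(R/𝔪, M)` for `i < d`, which says that the depth of
`M` with respect to `𝔪` is at least `d`. -/
def DepthGE {R : Type u} [CommRing R] (𝔪 : Ideal R) (M : Type u) [AddCommGroup M] [Module R M]
    (d : ℕ) : Prop :=
  ∀ i < d, Subsingleton (Ext (ModuleCat.of R (R ⧸ 𝔪)) (ModuleCat.of R M) i)

namespace DepthGE

variable {R : Type u} [CommRing R] {𝔪 : Ideal R}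

lemma mono {M : Type u} [AddCommGroup M] [Module R M] {d e : ℕ} (h : DepthGE 𝔪 M d)
    (hed : e ≤ d) : DepthGE 𝔪 M e :=
  fun i hi ↦ h i (hi.trans_le hed)

lemma exists_isRegular [IsNoetherianRing R] {M : Type u} [AddCommGroup M] [Module R M]
    [Module.Finite R M] (hM : 𝔪 • (⊤ : Submodule R M) < ⊤) {d : ℕ} (h : DepthGE 𝔪 M d) :
    ∃ rs : List R, rs.length = d ∧ (∀ r ∈ rs, r ∈ 𝔪) ∧ IsRegular M rs :=
  ModuleCat.exists_isRegular_of_exists_subsingleton_ext 𝔪 d (ModuleCat.of R M) hM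
    (ModuleCat.of R (R ⧸ 𝔪))
    (by rw [Module.support_eq_zeroLocus, Ideal.annihilator_quotient]) h

lemma of_isRegular [IsNoetherianRing R] {M : Type u} [AddCommGroup M] [Module R M]
    [Module.Finite R M] (hM : 𝔪 • (⊤ : Submodule R M) < ⊤) {rs : List R}
    (hmem : ∀ r ∈ rs, r ∈ 𝔪) (hreg : IsRegular M rs) : DepthGE 𝔪 M rs.length :=
  ModuleCat.subsingleton_ext_of_exists_isRegular 𝔪 (ModuleCat.of R (R ⧸ 𝔪))
    (by rw [Module.support_eq_zeroLocus, Ideal.annihilator_quotient]) (ModuleCat.of R M) hM rs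
    hmem hreg

/-- The long exact sequence places `Ext` of `X₁` in degree `i + 1` between `Ext` of `X₃` in degree
`i` and `Ext` of `X₂` in degree `i + 1`, so `X₃` may have depth one less. In degree 0 left exactness
of `Hom` suffices. -/
lemma of_shortExact {S : ShortComplex (ModuleCat.{u} R)} (hS : S.ShortExact) {d : ℕ}
    (h₂ : DepthGE 𝔪 S.X₂ d) (h₃ : DepthGE 𝔪 S.X₃ (d - 1)) : DepthGE 𝔪 S.X₁ d := by
  rintro (_ | i) hi
  · have hsub := h₂ 0 hi
    have : Mono S.f := hS.mono_f
    refine ⟨fun a b ↦ Ext.addEquiv₀.injective ?_⟩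
    have key : ∀ f g : ModuleCat.of R (R ⧸ 𝔪) ⟶ S.X₁, f = g := fun f g ↦ by
      rw [← cancel_mono S.f]
      exact Ext.addEquiv₀.symm.injective (hsub.elim _ _)
    exact key _ _
  · have z3 := AddCommGrpCat.isZero_of_iff_subsingleton.mpr (h₃ i (by omega))
    have z2 := AddCommGrpCat.isZero_of_iff_subsingleton.mpr (h₂ (i + 1) hi)
    exact AddCommGrpCat.subsingleton_of_isZero <| ShortComplex.Exact.isZero_of_both_zeros
      ((Ext.covariant_sequence_exact₁' (ModuleCat.of R (R ⧸ 𝔪)) hS) i (i + 1) rfl)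
      (z3.eq_zero_of_src _) (z2.eq_zero_of_tgt _)

lemma middle_of_shortExact {S : ShortComplex (ModuleCat.{u} R)} (hS : S.ShortExact) {d : ℕ}
    (h₁ : DepthGE 𝔪 S.X₁ d) (h₃ : DepthGE 𝔪 S.X₃ d) : DepthGE 𝔪 S.X₂ d := by
  intro i hi
  have z1 := AddCommGrpCat.isZero_of_iff_subsingleton.mpr (h₁ i hi)
  have z3 := AddCommGrpCat.isZero_of_iff_subsingleton.mpr (h₃ i hi)
  exact AddCommGrpCat.subsingleton_of_isZero <| ShortComplex.Exact.isZero_of_both_zeros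
      ((Ext.covariant_sequence_exact₂' (ModuleCat.of R (R ⧸ 𝔪)) hS) i)
      (z1.eq_zero_of_src _) (z3.eq_zero_of_tgt _)

lemma quotSMulTop {M : Type u} [AddCommGroup M] [Module R M] {x : R} (hx : IsSMulRegular M x)
    {d : ℕ} (h : DepthGE 𝔪 M (d + 1)) : DepthGE 𝔪 (QuotSMulTop x M) d := by
  intro i hi
  have zero1 := AddCommGrpCat.isZero_of_iff_subsingleton.mpr (h i (by omega))
  have zero2 := AddCommGrpCat.isZero_of_iff_subsingleton.mpr (h (i + 1) (by omega))
  have hx' : IsSMulRegular (ModuleCat.of R M) x := hx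
  exact AddCommGrpCat.subsingleton_of_isZero <| ShortComplex.Exact.isZero_of_both_zeros
    ((Ext.covariant_sequence_exact₃' (ModuleCat.of R (R ⧸ 𝔪))
      hx'.smulShortComplex_shortExact) i (i + 1) rfl)
    (zero1.eq_zero_of_src _) (zero2.eq_zero_of_tgt _)

variable {M N P : Type u} [AddCommGroup M] [Module R M] [AddCommGroup N] [Module R N]
  [AddCommGroup P] [Module R P]

lemma of_exact (f : M →ₗ[R] N) (g : N →ₗ[R] P) (hf : Function.Injective f)
    (hg : Function.Surjective g) (hfg : Function.Exact f g) {d : ℕ}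
    (h₂ : DepthGE 𝔪 N d) (h₃ : DepthGE 𝔪 P (d - 1)) : DepthGE 𝔪 M d :=
  of_shortExact (S := .mk (ModuleCat.ofHom f) (ModuleCat.ofHom g)
    (by ext x; exact hfg.apply_apply_eq_zero x))
    { exact := (ShortComplex.ShortExact.moduleCat_exact_iff_function_exact _).mpr hfg
      mono_f := (ModuleCat.mono_iff_injective _).mpr hf
      epi_g := (ModuleCat.epi_iff_surjective _).mpr hg } h₂ h₃

lemma middle_of_exact (f : M →ₗ[R] N) (g : N →ₗ[R] P) (hf : Function.Injective f)
    (hg : Function.Surjective g) (hfg : Function.Exact f g) {d : ℕ}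
    (h₁ : DepthGE 𝔪 M d) (h₃ : DepthGE 𝔪 P d) : DepthGE 𝔪 N d :=
  middle_of_shortExact (S := .mk (ModuleCat.ofHom f) (ModuleCat.ofHom g)
    (by ext x; exact hfg.apply_apply_eq_zero x))
    { exact := (ShortComplex.ShortExact.moduleCat_exact_iff_function_exact _).mpr hfg
      mono_f := (ModuleCat.mono_iff_injective _).mpr hf
      epi_g := (ModuleCat.epi_iff_surjective _).mpr hg } h₁ h₃

lemma of_linearEquiv (e : M ≃ₗ[R] N) {d : ℕ} (h : DepthGE 𝔪 N d) : DepthGE 𝔪 M d :=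
  of_exact e.toLinearMap (0 : N →ₗ[R] PUnit.{u + 1}) e.injective (fun _ ↦ ⟨0, rfl⟩)
    (fun y ↦ ⟨fun _ ↦ e.surjective y, fun _ ↦ rfl⟩) h fun i _ ↦ by
      refine ⟨fun a b ↦ ?_⟩
      have hz : Limits.IsZero (ModuleCat.of R PUnit.{u + 1}) :=
        ModuleCat.isZero_of_subsingleton _
      rw [← Ext.comp_mk₀_id a, ← Ext.comp_mk₀_id b, hz.eq_of_src (𝟙 _) 0]
      simp

lemma prod {d : ℕ} (h₁ : DepthGE 𝔪 M d) (h₂ : DepthGE 𝔪 N d) : DepthGE 𝔪 (M × N) d :=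
  middle_of_exact (LinearMap.inl R M N) (LinearMap.snd R M N) LinearMap.inl_injective
    LinearMap.snd_surjective .inl_snd h₁ h₂

/-- The depth lemma for `0 → R/(A ∩ B) → R/A × R/B → R/(A + B) → 0`. All lower bounds obtained by
decomposing an ideal rest on it. -/
lemma quotient_inf {A B : Ideal R} {d : ℕ} (hA : DepthGE 𝔪 (R ⧸ A) d) (hB : DepthGE 𝔪 (R ⧸ B) d)
    (hAB : DepthGE 𝔪 (R ⧸ (A ⊔ B)) (d - 1)) : DepthGE 𝔪 (R ⧸ (A ⊓ B)) d := by
  refine of_exact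
    ((Submodule.factor (inf_le_left : A ⊓ B ≤ A)).prod (Submodule.factor inf_le_right))
    ((Submodule.factor (le_sup_left : A ≤ A ⊔ B)).comp (LinearMap.fst R _ _) -
      (Submodule.factor le_sup_right).comp (LinearMap.snd R _ _)) ?_ ?_ ?_ (hA.prod hB) hAB
  · rw [← LinearMap.ker_eq_bot, LinearMap.ker_eq_bot']
    intro m hm
    obtain ⟨r, rfl⟩ := Submodule.mkQ_surjective _ m
    have h₁ : (Submodule.Quotient.mk r : R ⧸ A) = 0 := congrArg Prod.fst hm
    have h₂ : (Submodule.Quotient.mk r : R ⧸ B) = 0 := congrArg Prod.snd hm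
    rw [Submodule.Quotient.mk_eq_zero] at h₁ h₂
    exact (Submodule.Quotient.mk_eq_zero _).mpr ⟨h₁, h₂⟩
  · intro z
    obtain ⟨r, rfl⟩ := Submodule.mkQ_surjective _ z
    refine ⟨(Submodule.Quotient.mk r, 0), ?_⟩
    rw [LinearMap.sub_apply, LinearMap.comp_apply, LinearMap.comp_apply, LinearMap.snd_apply,
      map_zero, sub_zero]
    rfl
  · rintro ⟨a, b⟩
    obtain ⟨a, rfl⟩ := Submodule.mkQ_surjective _ a
    obtain ⟨b, rfl⟩ := Submodule.mkQ_surjective _ b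
    constructor
    · intro h
      have h' : (Submodule.Quotient.mk a : R ⧸ (A ⊔ B)) = Submodule.Quotient.mk b :=
        sub_eq_zero.mp h
      rw [Submodule.Quotient.eq] at h'
      obtain ⟨u, hu, v, hv, huv⟩ := Submodule.mem_sup.mp h'
      refine ⟨Submodule.Quotient.mk (a - u), Prod.ext ?_ ?_⟩
      · refine (Submodule.Quotient.eq _).mpr ?_
        change a - u - a ∈ A
        rwa [sub_sub_cancel_left, neg_mem_iff]
      · refine (Submodule.Quotient.eq _).mpr ?_
        change a - u - b ∈ B
        rwa [show a - u - b = v by rw [sub_right_comm, ← huv, add_sub_cancel_left]]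
    · rintro ⟨m, hm⟩
      obtain ⟨r, rfl⟩ := Submodule.mkQ_surjective _ m
      rw [← hm]
      exact sub_self (Submodule.Quotient.mk r : R ⧸ (A ⊔ B))

/-- The quotient of `R/I` by `x` is `R/(I + (x))`. -/
noncomputable def _root_.quotSMulTopQuotientEquiv (I : Ideal R) (x : R) :
    QuotSMulTop x (R ⧸ I) ≃ₗ[R] R ⧸ (I ⊔ Ideal.span {x}) :=
  (Submodule.quotEquivOfEq _ _ (by
    rw [← Submodule.ideal_span_singleton_smul, ← Submodule.range_mkQ I, ← Submodule.map_top,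
      ← Submodule.map_smul'', Ideal.smul_eq_mul, Ideal.mul_top])).trans
    (Submodule.quotientQuotientEquivQuotientSup I (Ideal.span {x}))

lemma _root_.isSMulRegular_quotient_of_forall {I : Ideal R} {x : R}
    (hx : ∀ f, x * f ∈ I → f ∈ I) : IsSMulRegular (R ⧸ I) x :=
  (isSMulRegular_quotient_iff_mem_of_smul_mem I x).mpr hx

lemma _root_.smul_top_quotient_lt_top {I : Ideal R} (hI : I ≤ 𝔪) (h𝔪 : 𝔪 ≠ ⊤) :
    𝔪 • (⊤ : Submodule R (R ⧸ I)) < ⊤ := by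
  rw [← Submodule.range_mkQ I, ← Submodule.map_top, ← Submodule.map_smul'', Ideal.smul_eq_mul,
    Ideal.mul_top]
  refine lt_of_le_of_ne (Submodule.map_mono le_top) fun h ↦ ?_
  apply h𝔪
  have := congrArg (Submodule.comap I.mkQ) h
  rwa [Submodule.comap_map_mkQ, Submodule.comap_map_mkQ, sup_eq_right.mpr hI,
    sup_top_eq] at this

/-- The bound is lifted by way of regular sequences: one of length `d` on `M/xM` becomes one of
length `d + 1` on `M` when `x` is prepended. -/
lemma of_quotSMulTop [IsNoetherianRing R] [Module.Finite R M]
    (hM : 𝔪 • (⊤ : Submodule R M) < ⊤) {x : R}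
    (hM' : 𝔪 • (⊤ : Submodule R (QuotSMulTop x M)) < ⊤) (hx𝔪 : x ∈ 𝔪) (hx : IsSMulRegular M x)
    {d : ℕ} (h : DepthGE 𝔪 (QuotSMulTop x M) d) : DepthGE 𝔪 M (d + 1) := by
  obtain ⟨rs, rfl, hmem, hreg⟩ := h.exists_isRegular hM'
  exact of_isRegular hM (List.forall_mem_cons.mpr ⟨hx𝔪, hmem⟩) (hreg.cons hx)

lemma _root_.LinearEquiv.smul_top_lt_top (e : M ≃ₗ[R] N)
    (h : 𝔪 • (⊤ : Submodule R M) < ⊤) : 𝔪 • (⊤ : Submodule R N) < ⊤ := by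
  refine lt_top_iff_ne_top.mpr fun h' ↦ h.ne ?_
  have := congrArg (Submodule.map e.symm.toLinearMap) h'
  rwa [Submodule.map_smul'', Submodule.map_top, LinearEquiv.range] at this

lemma of_quotient_sup_span [IsNoetherianRing R] (h𝔪 : 𝔪 ≠ ⊤) {I : Ideal R} (hI : I ≤ 𝔪) {x : R}
    (hx𝔪 : x ∈ 𝔪) (hx : ∀ f, x * f ∈ I → f ∈ I) {d : ℕ}
    (h : DepthGE 𝔪 (R ⧸ (I ⊔ Ideal.span {x})) d) : DepthGE 𝔪 (R ⧸ I) (d + 1) := by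
  have hle : I ⊔ Ideal.span {x} ≤ 𝔪 :=
    sup_le hI ((Ideal.span_singleton_le_iff_mem _).mpr hx𝔪)
  have h₁ := smul_top_quotient_lt_top hI h𝔪
  have h₂ := (quotSMulTopQuotientEquiv I x).symm.smul_top_lt_top
    (smul_top_quotient_lt_top hle h𝔪)
  have h₃ := isSMulRegular_quotient_of_forall hx
  have h₄ : DepthGE 𝔪 (QuotSMulTop x (R ⧸ I)) d := of_linearEquiv (quotSMulTopQuotientEquiv I x) h
  exact of_quotSMulTop h₁ h₂ hx𝔪 h₃ h₄

lemma quotient_sup_span {I : Ideal R} {x : R} (hx : ∀ f, x * f ∈ I → f ∈ I) {d : ℕ}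
    (h : DepthGE 𝔪 (R ⧸ I) (d + 1)) : DepthGE 𝔪 (R ⧸ (I ⊔ Ideal.span {x})) d :=
  of_linearEquiv (quotSMulTopQuotientEquiv I x).symm
    (h.quotSMulTop (isSMulRegular_quotient_of_forall hx))

end DepthGE

end

/-! ### Upper bounds for the depth -/

section

open RingTheory.Sequence Pointwise

universe u

/-- Induction on the sequence. Some associated prime `Q` of `M/xM` contains both `P` and `x`, while
`x ∉ P`, so passing from `R/P` to `R/Q` costs at least one dimension. -/
lemma length_le_ringKrullDim_of_isAssociatedPrime {R : Type*} [CommRing R] [IsLocalRing R]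
    [IsNoetherianRing R] {M : Type*} [AddCommGroup M] [Module R M] [Module.Finite R M]
    {P : Ideal R} (hP : IsAssociatedPrime P M) {rs : List R}
    (hmem : ∀ r ∈ rs, r ∈ IsLocalRing.maximalIdeal R) (hreg : IsWeaklyRegular M rs) :
    (rs.length : WithBot ℕ∞) ≤ ringKrullDim (R ⧸ P) := by
  induction rs generalizing M P with
  | nil =>
    have := hP.isPrime
    simpa using ringKrullDim_nonneg_of_nontrivial
  | cons x rs ih =>
    have hPp := hP.isPrime
    obtain ⟨-, h, rfl⟩ := isAssociatedPrime_iff.mp hP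
    set P := (⊥ : Submodule R M).colon {h}
    obtain ⟨hx, hrs⟩ := (isWeaklyRegular_cons_iff M x rs).mp hreg
    have hxm := hmem x (by simp)
    have hPh : ∀ a, a ∈ P ↔ a • h = 0 := fun a ↦ by
      rw [Submodule.mem_colon_singleton, Submodule.mem_bot]
    have hh : h ≠ 0 := fun h0 ↦ hPp.ne_top
      ((Ideal.eq_top_iff_one _).mpr ((hPh 1).mpr (by rw [h0, smul_zero])))
    -- the submodule of the elements killed by `P` is not contained in `x M`
    let H : Submodule R M :=
      { carrier := {u | ∀ a ∈ P, a • u = 0}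
        add_mem' := fun hu hv a ha ↦ by rw [smul_add, hu a ha, hv a ha, add_zero]
        zero_mem' := fun a _ ↦ smul_zero a
        smul_mem' := fun c u hu a ha ↦ by rw [smul_comm, hu a ha, smul_zero] }
    have hH : ∃ u ∈ H, u ∉ x • (⊤ : Submodule R M) := by
      by_contra! hcon
      -- If `x v` is killed by `P` then so is `v`, because `x` is regular. Thus `H ⊆ xM` would give
      -- `H = xH`, and Nakayama would give `H = 0`.
      have hle : H ≤ Ideal.span {x} • H := by
        intro u hu
        obtain ⟨v, -, hv⟩ := (Submodule.mem_smul_pointwise_iff_exists _ _ _).mp (hcon u hu)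
        have hvH : v ∈ H := fun a ha ↦ hx (by
          change x • a • v = x • 0
          rw [smul_comm, hv, smul_zero, hu a ha])
        rw [← hv]
        exact Submodule.smul_mem_smul (Ideal.mem_span_singleton_self x) hvH
      have hbot := Submodule.eq_bot_of_le_smul_of_le_jacobson_bot (Ideal.span {x}) H
        (IsNoetherian.noetherian H) hle
        ((Ideal.span_singleton_le_iff_mem _).mpr
          (IsLocalRing.maximalIdeal_le_jacobson ⊥ hxm))
      exact hh ((Submodule.eq_bot_iff H).mp hbot h fun a ha ↦ (hPh a).mp ha)
    obtain ⟨u, huH, hux⟩ := hH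
    obtain ⟨Q, hQ, hle⟩ := exists_le_isAssociatedPrime_of_isNoetherianRing R
      (Submodule.Quotient.mk u : QuotSMulTop x M)
      (fun h0 ↦ hux ((Submodule.Quotient.mk_eq_zero _).mp h0))
    have hPQ : P ≤ Q := fun a ha ↦ hle (by
      rw [Submodule.mem_colon_singleton, Submodule.mem_bot, ← Submodule.Quotient.mk_smul,
        huH a ha, Submodule.Quotient.mk_zero])
    have hxQ : x ∈ Q := hle (by
      rw [Submodule.mem_colon_singleton, Submodule.mem_bot, ← Submodule.Quotient.mk_smul,
        Submodule.Quotient.mk_eq_zero]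
      exact Submodule.smul_mem_pointwise_smul _ _ _ trivial)
    have hxP : x ∉ P := fun hxP ↦ hh (hx (by
      change x • h = x • 0
      rw [(hPh x).mp hxP, smul_zero]))
    have h₁ := ih hQ (fun r hr ↦ hmem r (by simp [hr])) hrs
    have h₂ := ringKrullDim_succ_le_of_surjective (Ideal.Quotient.factor hPQ)
      (Ideal.Quotient.factor_surjective hPQ) (r := Ideal.Quotient.mk P x)
      (mem_nonZeroDivisors_of_ne_zero (fun h0 ↦ hxP (Ideal.Quotient.eq_zero_iff_mem.mp h0)))
      (by rw [Ideal.Quotient.factor_mk]; exact Ideal.Quotient.eq_zero_iff_mem.mpr hxQ)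
    refine le_trans ?_ h₂
    rw [List.length_cons, Nat.cast_add, Nat.cast_one]
    gcongr

/-- A regular sequence in a prime ideal `p` on a module `M` cannot be longer than the dimension
of `R/𝔞` if `𝔞` kills an element of `M` whose annihilator is contained in `p`. -/
lemma length_le_ringKrullDim_of_smul_eq_zero {R : Type*} [CommRing R] [IsNoetherianRing R]
    {M : Type*} [AddCommGroup M] [Module R M] [Module.Finite R M] {p : Ideal R} [p.IsPrime]
    {𝔞 : Ideal R} {h : M} (h𝔞 : ∀ a ∈ 𝔞, a • h = 0) (hp : ∀ a, a • h = 0 → a ∈ p)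
    {rs : List R} (hmem : ∀ r ∈ rs, r ∈ p) (hreg : IsWeaklyRegular M rs) :
    (rs.length : WithBot ℕ∞) ≤ ringKrullDim (R ⧸ 𝔞) := by
  let Rp := Localization.AtPrime p
  let Mp := LocalizedModule p.primeCompl M
  have hne : LocalizedModule.mkLinearMap p.primeCompl M h ≠ 0 := fun h0 ↦ by
    obtain ⟨s, hs⟩ := (IsLocalizedModule.eq_zero_iff p.primeCompl
      (LocalizedModule.mkLinearMap p.primeCompl M)).mp h0
    exact s.2 (hp _ hs)
  obtain ⟨Q, hQ, hle⟩ := exists_le_isAssociatedPrime_of_isNoetherianRing Rp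
    (LocalizedModule.mkLinearMap p.primeCompl M h) hne
  have hreg' : IsWeaklyRegular Mp (rs.map (algebraMap R Rp)) :=
    hreg.of_isLocalizedModule Rp p.primeCompl (LocalizedModule.mkLinearMap p.primeCompl M)
  have h₁ := length_le_ringKrullDim_of_isAssociatedPrime hQ (by
    intro r hr
    obtain ⟨r, hr', rfl⟩ := List.mem_map.mp hr
    exact (IsLocalization.AtPrime.to_map_mem_maximal_iff Rp p r).mpr (hmem r hr')) hreg'
  rw [List.length_map] at h₁
  refine h₁.trans ?_
  rw [ringKrullDim_quotient, ringKrullDim_quotient]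
  -- Primes of the localization over `Q` contract injectively to primes of `R`, and these contain
  -- `𝔞` because `𝔞` kills `h`.
  refine Order.krullDim_le_of_strictMono
    (fun q ↦ ⟨PrimeSpectrum.comap (algebraMap R Rp) q.1, fun a ha ↦ ?_⟩) ?_
  · refine q.2 (hle ?_)
    rw [Submodule.mem_colon_singleton, Submodule.mem_bot, algebraMap_smul, ← map_smul, h𝔞 a ha,
      map_zero]
  · refine Monotone.strictMono_of_injective (fun q q' h ↦ ?_) fun q q' h ↦ ?_
    · exact Ideal.comap_mono h
    · exact Subtype.ext (PrimeSpectrum.localization_comap_injective Rp p.primeCompl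
        (congrArg Subtype.val h))

variable {R : Type u} [CommRing R] [IsNoetherianRing R] {𝔪 : Ideal R}

lemma DepthGE.le_ringKrullDim_of_smul_eq_zero [𝔪.IsPrime] {M : Type u} [AddCommGroup M]
    [Module R M] [Module.Finite R M] (hM : 𝔪 • (⊤ : Submodule R M) < ⊤) {𝔞 : Ideal R} {h : M}
    (h𝔞 : ∀ a ∈ 𝔞, a • h = 0) (hp : ∀ a, a • h = 0 → a ∈ 𝔪) {d : ℕ} (hd : DepthGE 𝔪 M d) :
    (d : WithBot ℕ∞) ≤ ringKrullDim (R ⧸ 𝔞) := by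
  obtain ⟨rs, rfl, hmem, hreg⟩ := hd.exists_isRegular hM
  exact length_le_ringKrullDim_of_smul_eq_zero h𝔞 hp hmem hreg.toIsWeaklyRegular

/-- If `𝔞 w ⊆ J` and the elements that multiply `w` into `J` lie in `𝔪`, then the depth of
`R/J` is at most the dimension of `R/𝔞`. -/
lemma DepthGE.le_ringKrullDim [𝔪.IsPrime] {J 𝔞 : Ideal R} (hJ : J ≤ 𝔪) {w : R}
    (hw : ∀ a ∈ 𝔞, a * w ∈ J) (hw𝔪 : ∀ a, a * w ∈ J → a ∈ 𝔪) {d : ℕ}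
    (hd : DepthGE 𝔪 (R ⧸ J) d) : (d : WithBot ℕ∞) ≤ ringKrullDim (R ⧸ 𝔞) := by
  have hM := smul_top_quotient_lt_top hJ (Ideal.IsPrime.ne_top ‹𝔪.IsPrime›)
  have h₁ : ∀ a ∈ 𝔞, a • (Submodule.Quotient.mk w : R ⧸ J) = 0 := fun a ha ↦ by
    rw [← Submodule.Quotient.mk_smul, Submodule.Quotient.mk_eq_zero]
    exact hw a ha
  have h₂ : ∀ a : R, a • (Submodule.Quotient.mk w : R ⧸ J) = 0 → a ∈ 𝔪 := fun a ha ↦ by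
    rw [← Submodule.Quotient.mk_smul, Submodule.Quotient.mk_eq_zero] at ha
    exact hw𝔪 a ha
  exact le_ringKrullDim_of_smul_eq_zero hM h₁ h₂ hd

/-- Two components of the zero locus of `J` that meet, locally at `P = A + B`, only in the zero
locus of `P` bound the depth of `R/J` by `dim R/P + 1`. -/
lemma DepthGE.le_ringKrullDim_add_one [𝔪.IsPrime] {J A B : Ideal R} [A.IsPrime] [B.IsPrime]
    (hP : (A ⊔ B).IsPrime) (hP𝔪 : A ⊔ B ≤ 𝔪) (hJA : J ≤ A) (hJB : J ≤ B) {s wA wB : R}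
    (hs : s ∉ A ⊔ B) (hsAB : ∀ a ∈ A, ∀ b ∈ B, s * (a * b) ∈ J)
    (hwA : wA ∉ J) (hwA' : ∀ a ∈ A, a * wA ∈ J) (hwB : wB ∉ J) (hwB' : ∀ b ∈ B, b * wB ∈ J)
    (hJ𝔪 : ∀ a ∉ 𝔪, ∀ w, a * w ∈ J → w ∈ J)
    {d : ℕ} (hd : DepthGE 𝔪 (R ⧸ J) (d + 1)) : (d : WithBot ℕ∞) ≤ ringKrullDim (R ⧸ (A ⊔ B)) := by
  have hJ : J ≤ 𝔪 := hJA.trans (le_sup_left.trans hP𝔪)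
  by_cases hf : ∃ f ∈ A ⊔ B, ∀ g, f * g ∈ J → g ∈ J
  · obtain ⟨f, hfP, hf⟩ := hf
    obtain ⟨α, hα, β, hβ, hαβ⟩ := Submodule.mem_sup.mp hfP
    -- With `β ∈ A` the whole of `f` would lie in `A` and kill `wA` modulo `J`, against its
    -- regularity. The argument for `α` and `B` is the same.
    have hβA : β ∉ A := fun h ↦ hwA (hf _ (by
      rw [← hαβ]
      exact hwA' _ (add_mem hα h)))
    have hαB : α ∉ B := fun h ↦ hwB (hf _ (by
      rw [← hαβ]
      exact hwB' _ (add_mem h hβ)))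
    have hfm : f ∈ J ⊔ Ideal.span {f} := Ideal.mem_sup_right (Ideal.mem_span_singleton_self f)
    -- Modulo `f = α + β` the elements `s α` and `-s β` agree. `B` kills the first and `A` the
    -- second, so `A + B` kills their common class. Its annihilator stays inside `A + B` because `s
    -- ∉ A + B`.
    refine (hd.quotient_sup_span hf).le_ringKrullDim (w := s * α)
      (sup_le hJ ((Ideal.span_singleton_le_iff_mem _).mpr (hP𝔪 hfP))) (fun a ha ↦ ?_)
      (fun a ha ↦ hP𝔪 ?_)
    · obtain ⟨a₁, ha₁, a₂, ha₂, rfl⟩ := Submodule.mem_sup.mp ha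
      have h₁ := hsAB α hα a₂ ha₂
      have h₂ := hsAB a₁ ha₁ β hβ
      have : (a₁ + a₂) * (s * α) = s * (α * a₂) + (a₁ * s) * f - s * (a₁ * β) := by
        rw [← hαβ]; ring
      rw [this]
      exact sub_mem (add_mem (Ideal.mem_sup_left h₁) (Ideal.mul_mem_left _ _ hfm))
        (Ideal.mem_sup_left h₂)
    · obtain ⟨j, hj, z, hz, hjz⟩ := Submodule.mem_sup.mp ha
      obtain ⟨g, rfl⟩ := Ideal.mem_span_singleton'.mp hz
      have hgA : g ∈ A := by
        refine (Ideal.IsPrime.mem_or_mem ‹A.IsPrime› (x := g) (y := β) ?_).resolve_right hβA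
        have : g * β = (a * s - g) * α - j := by
          linear_combination hjz + g * hαβ
        rw [this]
        exact sub_mem (Ideal.mul_mem_left _ _ hα) (hJA hj)
      have hgB : a * s - g ∈ B := by
        refine (Ideal.IsPrime.mem_or_mem ‹B.IsPrime› (y := α) ?_).resolve_right hαB
        have : (a * s - g) * α = j + g * β := by
          linear_combination (-1 : R) * hjz - g * hαβ
        rw [this]
        exact add_mem (hJB hj) (Ideal.mul_mem_left _ _ hβ)
      refine (hP.mem_or_mem (x := a) (y := s) ?_).resolve_right hs
      rw [← sub_add_cancel (a * s) g]
      exact add_mem (Ideal.mem_sup_right hgB) (Ideal.mem_sup_left hgA)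
  · -- all elements of `P` are zero divisors, so that `P` lies in an associated prime of `R/J`
    push Not at hf
    have hsub : ((A ⊔ B : Ideal R) : Set R) ⊆ ⋃ q ∈ associatedPrimes R (R ⧸ J), (q : Set R) := by
      rw [biUnion_associatedPrimes_eq_compl_regular]
      intro f hfP hreg
      obtain ⟨g, hg, hgJ⟩ := hf f hfP
      exact hgJ (mem_of_isSMulRegular_quotient_of_smul_mem hreg hg)
    obtain ⟨q, hq, hle⟩ := (Ideal.subset_union_prime_finite (associatedPrimes.finite R (R ⧸ J))
      ⊥ ⊥ fun q hq _ _ ↦ IsAssociatedPrime.isPrime hq).mp hsub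
    obtain ⟨hqp, w, rfl⟩ := isAssociatedPrime_iff.mp hq
    obtain ⟨w, rfl⟩ := Submodule.mkQ_surjective _ w
    have hmem : ∀ a, a ∈ (⊥ : Submodule R (R ⧸ J)).colon {J.mkQ w} ↔ a * w ∈ J := fun a ↦ by
      rw [Submodule.mem_colon_singleton, Submodule.mem_bot, Submodule.mkQ_apply,
        ← Submodule.Quotient.mk_smul, Submodule.Quotient.mk_eq_zero, smul_eq_mul]
    refine (hd.mono (Nat.le_succ d)).le_ringKrullDim hJ (w := w) (fun a ha ↦ (hmem a).mp (hle ha))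
      fun a ha ↦ ?_
    by_contra ham
    refine hqp.ne_top ((Ideal.eq_top_iff_one _).mpr ((hmem 1).mpr ?_))
    rw [one_mul]
    exact hJ𝔪 a ham w ha

end

section

open MvPolynomial

/-! ### Ideals of variables and minors; decomposition at a vertex -/

section EdgeIdeals

variable (K : Type*) [Field K] {V : Type*}

/-- The `2 × 2` minor `xᵢ yⱼ - xⱼ yᵢ`. -/
noncomputable def minor (i j : V) : MvPolynomial (V ⊕ V) K :=
  X (Sum.inl i) * X (Sum.inr j) - X (Sum.inl j) * X (Sum.inr i)

/-- The ideal generated by the variables in `Z` and by the minors of the pairs related by `r`. -/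
noncomputable def edgeIdeal (Z : Set (V ⊕ V)) (r : V → V → Prop) : Ideal (MvPolynomial (V ⊕ V) K) :=
  Ideal.span (X '' Z) ⊔ Ideal.span {f | ∃ i j, r i j ∧ f = minor K i j}

variable {K}

@[simp] lemma minor_self (i : V) : minor K i i = 0 := sub_self _

lemma minor_swap (i j : V) : minor K j i = -minor K i j := by
  unfold minor; ring

variable {Z Z' : Set (V ⊕ V)} {r r' : V → V → Prop}

lemma edgeIdeal_le_iff {I : Ideal (MvPolynomial (V ⊕ V) K)} :
    edgeIdeal K Z r ≤ I ↔ (∀ u ∈ Z, X u ∈ I) ∧ ∀ i j, r i j → minor K i j ∈ I := by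
  rw [edgeIdeal, sup_le_iff, Ideal.span_le, Ideal.span_le, Set.image_subset_iff]
  refine and_congr Iff.rfl ⟨fun h i j hij ↦ h ⟨i, j, hij, rfl⟩, ?_⟩
  rintro h f ⟨i, j, hij, rfl⟩
  exact h i j hij

lemma X_mem_edgeIdeal {u : V ⊕ V} (hu : u ∈ Z) : X u ∈ edgeIdeal K Z r :=
  (edgeIdeal_le_iff.mp le_rfl).1 u hu

lemma minor_mem_edgeIdeal {i j : V} (h : r i j) : minor K i j ∈ edgeIdeal K Z r :=
  (edgeIdeal_le_iff.mp le_rfl).2 i j h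

lemma minor_mem_of_left {I : Ideal (MvPolynomial (V ⊕ V) K)} {i j : V}
    (hx : X (Sum.inl i) ∈ I) (hy : X (Sum.inr i) ∈ I) : minor K i j ∈ I :=
  sub_mem (Ideal.mul_mem_right _ _ hx) (Ideal.mul_mem_left _ _ hy)

lemma minor_mem_of_right {I : Ideal (MvPolynomial (V ⊕ V) K)} {i j : V}
    (hx : X (Sum.inl j) ∈ I) (hy : X (Sum.inr j) ∈ I) : minor K i j ∈ I :=
  sub_mem (Ideal.mul_mem_left _ _ hy) (Ideal.mul_mem_right _ _ hx)

lemma edgeIdeal_mono (hZ : Z ⊆ Z') (h : ∀ i j, r i j → r' i j) :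
    edgeIdeal K Z r ≤ edgeIdeal K Z' r' :=
  edgeIdeal_le_iff.mpr ⟨fun _ hu ↦ X_mem_edgeIdeal (hZ hu),
    fun i j hij ↦ minor_mem_edgeIdeal (h i j hij)⟩

lemma edgeIdeal_mono_of_ne (h : ∀ i j, i ≠ j → r i j → r' i j) :
    edgeIdeal K Z r ≤ edgeIdeal K Z r' := by
  refine edgeIdeal_le_iff.mpr ⟨fun _ hu ↦ X_mem_edgeIdeal hu, fun i j hij ↦ ?_⟩
  by_cases hne : i = j
  · rw [hne, minor_self]
    exact zero_mem _
  · exact minor_mem_edgeIdeal (h i j hne hij)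

lemma edgeIdeal_congr (h : ∀ i j, i ≠ j → (r i j ↔ r' i j)) :
    edgeIdeal K Z r = edgeIdeal K Z r' :=
  le_antisymm (edgeIdeal_mono_of_ne fun i j hne ↦ (h i j hne).mp)
    (edgeIdeal_mono_of_ne fun i j hne ↦ (h i j hne).mpr)

lemma edgeIdeal_le_idealOfVars : edgeIdeal K Z r ≤ idealOfVars (V ⊕ V) K := by
  have hX : ∀ u, (X u : MvPolynomial (V ⊕ V) K) ∈ idealOfVars (V ⊕ V) K := fun u ↦
    Ideal.subset_span ⟨u, rfl⟩
  exact edgeIdeal_le_iff.mpr ⟨fun u _ ↦ hX u, fun i j _ ↦ minor_mem_of_left (hX _) (hX _)⟩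

lemma binomialEdgeIdeal_eq_edgeIdeal {n : ℕ} (G : SimpleGraph (Fin n)) :
    binomialEdgeIdeal K G = edgeIdeal K ∅ G.Adj := by
  apply le_antisymm
  · refine Ideal.span_le.mpr ?_
    rintro f ⟨i, j, -, hij, rfl⟩
    exact minor_mem_edgeIdeal hij
  · refine edgeIdeal_le_iff.mpr ⟨fun u hu ↦ hu.elim, fun i j hij ↦ ?_⟩
    rcases lt_trichotomy i j with h | h | h
    · exact Ideal.subset_span ⟨i, j, h, hij, rfl⟩
    · exact (hij.ne h).elim
    · rw [minor_swap]
      exact neg_mem (Ideal.subset_span ⟨j, i, h, hij.symm, rfl⟩)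

open Classical in
variable (K) in
/-- The substitution of `0` for the variables in `Z`. -/
noncomputable def killVars (Z : Set (V ⊕ V)) : MvPolynomial (V ⊕ V) K →ₐ[K] MvPolynomial (V ⊕ V) K :=
  aeval fun u ↦ if u ∈ Z then 0 else X u

lemma killVars_X_of_mem {u : V ⊕ V} (hu : u ∈ Z) : killVars K Z (X u) = 0 := by
  rw [killVars, aeval_X, if_pos hu]

lemma killVars_X_of_notMem {u : V ⊕ V} (hu : u ∉ Z) : killVars K Z (X u) = X u := by
  rw [killVars, aeval_X, if_neg hu]

lemma sub_killVars_mem (f : MvPolynomial (V ⊕ V) K) :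
    f - killVars K Z f ∈ Ideal.span (X '' Z) := by
  induction f using MvPolynomial.induction_on with
  | C a => rw [← algebraMap_eq, AlgHom.commutes, sub_self]; exact zero_mem _
  | add p q hp hq =>
    rw [map_add, add_sub_add_comm]
    exact add_mem hp hq
  | mul_X p u hp =>
    have : p * X u - killVars K Z (p * X u)
        = (p - killVars K Z p) * X u + killVars K Z p * (X u - killVars K Z (X u)) := by
      rw [map_mul]; ring
    rw [this]
    refine add_mem (Ideal.mul_mem_right _ _ hp) (Ideal.mul_mem_left _ _ ?_)
    by_cases hu : u ∈ Z
    · rw [killVars_X_of_mem hu, sub_zero]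
      exact Ideal.subset_span ⟨u, hu, rfl⟩
    · rw [killVars_X_of_notMem hu, sub_self]
      exact zero_mem _

lemma killVars_minor {i j : V} (hi : Sum.inl i ∉ Z) (hi' : Sum.inr i ∉ Z) (hj : Sum.inl j ∉ Z)
    (hj' : Sum.inr j ∉ Z) : killVars K Z (minor K i j) = minor K i j := by
  rw [minor, map_sub, map_mul, map_mul, killVars_X_of_notMem hi, killVars_X_of_notMem hi',
    killVars_X_of_notMem hj, killVars_X_of_notMem hj']

/-! ### Deleting a vertex and completing its neighbourhood -/

/-- The relation `r` with the vertices in `A` made isolated. -/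
def isolate (r : V → V → Prop) (A : Set V) (i j : V) : Prop := r i j ∧ i ∉ A ∧ j ∉ A

/-- The relation `r` with all the neighbours of `v` related to each other. -/
def completeAt (r : V → V → Prop) (v : V) (i j : V) : Prop := r i j ∨ (r v i ∧ r v j)

/-- The two variables that belong to the vertices in `T`. -/
def varsOf (T : Set V) : Set (V ⊕ V) := {u | u.elim id id ∈ T}

/-- Let `ρ` set both variables of `v` to 0. For `f` in the second ideal `ρ f ∈ J`, and for `f` in
the first `f - ρ f ∈ J`. Adding the two gives `f ∈ J`. -/
lemma edgeIdeal_completeAt_inf (hr : ∀ i j, r i j → r j i) (v : V) :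
    edgeIdeal K Z (completeAt r v) ⊓ edgeIdeal K (Z ∪ varsOf {v}) (isolate r {v}) =
      edgeIdeal K Z r := by
  apply le_antisymm
  · rintro f ⟨hf₁, hf₂⟩
    set ρ := killVars K (varsOf {v}) with hρ
    set J := edgeIdeal K Z r with hJ
    have hx : ρ (X (Sum.inl v)) = 0 := killVars_X_of_mem rfl
    have hy : ρ (X (Sum.inr v)) = 0 := killVars_X_of_mem rfl
    have hne : ∀ i, i ≠ v → ρ (X (Sum.inl i)) = X (Sum.inl i) ∧
        ρ (X (Sum.inr i)) = X (Sum.inr i) := fun i hi ↦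
      ⟨killVars_X_of_notMem hi, killVars_X_of_notMem hi⟩
    have hρm : ∀ i j, i ≠ v → j ≠ v → ρ (minor K i j) = minor K i j := fun i j hi hj ↦
      killVars_minor hi hi hj hj
    have hρX : ∀ u ∈ Z, ρ (X u) ∈ J := fun u hu ↦ by
      by_cases h : u ∈ varsOf {v}
      · rw [hρ, killVars_X_of_mem h]; exact zero_mem _
      · rw [hρ, killVars_X_of_notMem h]; exact X_mem_edgeIdeal hu
    have hρ₂ : edgeIdeal K (Z ∪ varsOf {v}) (isolate r {v}) ≤ J.comap ρ := by
      refine edgeIdeal_le_iff.mpr ⟨?_, ?_⟩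
      · rintro u (hu | hu)
        · exact hρX u hu
        · rw [Ideal.mem_comap, hρ, killVars_X_of_mem hu]; exact zero_mem _
      · rintro i j ⟨hij, hi, hj⟩
        rw [Ideal.mem_comap, hρm i j hi hj]
        exact minor_mem_edgeIdeal hij
    have hρJ : J ≤ J.comap ρ := by
      refine edgeIdeal_le_iff.mpr ⟨hρX, fun i j hij ↦ ?_⟩
      rw [Ideal.mem_comap]
      by_cases hi : i = v
      · rw [hi, minor, map_sub, map_mul, map_mul, hx, hy, zero_mul, mul_zero, sub_zero]
        exact zero_mem _
      by_cases hj : j = v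
      · rw [hj, minor, map_sub, map_mul, map_mul, hx, hy, zero_mul, mul_zero, sub_zero]
        exact zero_mem _
      rw [hρm i j hi hj]
      exact minor_mem_edgeIdeal hij
    have hspan : ∀ a g : MvPolynomial (V ⊕ V) K, X (Sum.inl v) * g ∈ J → X (Sum.inr v) * g ∈ J →
        (a - ρ a) * g ∈ J := by
      intro a g h₁ h₂
      have : Ideal.span (X '' varsOf {v}) ≤ J.colon {g} := by
        refine Ideal.span_le.mpr ?_
        rintro _ ⟨u | u, hu, rfl⟩ <;> obtain rfl : u = v := hu
        · exact Submodule.mem_colon_singleton.mpr h₁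
        · exact Submodule.mem_colon_singleton.mpr h₂
      exact Submodule.mem_colon_singleton.mp (this (sub_killVars_mem a))
    have key : ∀ f ∈ edgeIdeal K Z (completeAt r v),
        f - ρ f ∈ J ∧ X (Sum.inl v) * f ∈ J ∧ X (Sum.inr v) * f ∈ J := by
      have hmemJ : ∀ g ∈ J, g - ρ g ∈ J ∧ X (Sum.inl v) * g ∈ J ∧ X (Sum.inr v) * g ∈ J :=
        fun g hg ↦ ⟨sub_mem hg (hρJ hg), Ideal.mul_mem_left _ _ hg, Ideal.mul_mem_left _ _ hg⟩
      -- The condition `f - ρ f ∈ J` alone is not visibly stable under multiplication. Together with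
      -- `x_v f, y_v f ∈ J` it is, since `a - ρ a` lies in the ideal `(x_v, y_v)`.
      let I : Ideal (MvPolynomial (V ⊕ V) K) :=
        { carrier := {f | f - ρ f ∈ J ∧ X (Sum.inl v) * f ∈ J ∧ X (Sum.inr v) * f ∈ J}
          add_mem' := by
            rintro a b ⟨ha₁, ha₂, ha₃⟩ ⟨hb₁, hb₂, hb₃⟩
            refine ⟨?_, ?_, ?_⟩
            · rw [map_add, add_sub_add_comm]; exact add_mem ha₁ hb₁
            · rw [mul_add]; exact add_mem ha₂ hb₂
            · rw [mul_add]; exact add_mem ha₃ hb₃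
          zero_mem' := by
            refine ⟨?_, ?_, ?_⟩ <;> simp
          smul_mem' := by
            rintro a g ⟨h₁, h₂, h₃⟩
            refine ⟨?_, ?_, ?_⟩
            · have : a • g - ρ (a • g)
                  = a * (g - ρ g) + (a - ρ a) * g - (a - ρ a) * (g - ρ g) := by
                rw [smul_eq_mul, map_mul]; ring
              rw [this]
              exact sub_mem (add_mem (Ideal.mul_mem_left _ _ h₁) (hspan a g h₂ h₃))
                (Ideal.mul_mem_left _ _ h₁)
            · rw [smul_eq_mul, mul_left_comm]; exact Ideal.mul_mem_left _ _ h₂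
            · rw [smul_eq_mul, mul_left_comm]; exact Ideal.mul_mem_left _ _ h₃ }
      change edgeIdeal K Z (completeAt r v) ≤ I
      refine edgeIdeal_le_iff.mpr ⟨fun u hu ↦ hmemJ _ (X_mem_edgeIdeal hu), ?_⟩
      rintro i j (hij | ⟨hi, hj⟩)
      · exact hmemJ _ (minor_mem_edgeIdeal hij)
      by_cases hiv : i = v
      · exact hmemJ _ (minor_mem_edgeIdeal (hiv ▸ hj))
      by_cases hjv : j = v
      · exact hmemJ _ (minor_mem_edgeIdeal (hjv ▸ hr _ _ hi))
      have hvi : minor K v i ∈ J := minor_mem_edgeIdeal hi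
      have hvj : minor K v j ∈ J := minor_mem_edgeIdeal hj
      refine ⟨?_, ?_, ?_⟩
      · rw [hρm i j hiv hjv, sub_self]; exact zero_mem _
      -- A Plücker relation writes `x_v` times the added minor in terms of the minors of the edges
      -- at `v`. The next bullet does the same with `y_v`.
      · have : X (Sum.inl v) * minor K i j
            = X (Sum.inl i) * minor K v j - X (Sum.inl j) * minor K v i := by
          unfold minor; ring
        rw [this]
        exact sub_mem (Ideal.mul_mem_left _ _ hvj) (Ideal.mul_mem_left _ _ hvi)
      · have : X (Sum.inr v) * minor K i j
            = X (Sum.inr i) * minor K v j - X (Sum.inr j) * minor K v i := by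
          unfold minor; ring
        rw [this]
        exact sub_mem (Ideal.mul_mem_left _ _ hvj) (Ideal.mul_mem_left _ _ hvi)
    rw [← sub_add_cancel f (ρ f)]
    exact add_mem (key f hf₁).1 (hρ₂ hf₂)
  · refine le_inf (edgeIdeal_mono subset_rfl fun i j ↦ Or.inl) ?_
    refine edgeIdeal_le_iff.mpr ⟨fun u hu ↦ X_mem_edgeIdeal (Or.inl hu), fun i j hij ↦ ?_⟩
    by_cases hi : i = v
    · exact minor_mem_of_left (X_mem_edgeIdeal (Or.inr hi)) (X_mem_edgeIdeal (Or.inr hi))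
    by_cases hj : j = v
    · exact minor_mem_of_right (X_mem_edgeIdeal (Or.inr hj)) (X_mem_edgeIdeal (Or.inr hj))
    exact minor_mem_edgeIdeal ⟨hij, hi, hj⟩

lemma edgeIdeal_completeAt_sup (v : V) :
    edgeIdeal K Z (completeAt r v) ⊔ edgeIdeal K (Z ∪ varsOf {v}) (isolate r {v}) =
      edgeIdeal K (Z ∪ varsOf {v}) (isolate (completeAt r v) {v}) := by
  apply le_antisymm
  · refine sup_le ?_ (edgeIdeal_mono subset_rfl fun i j h ↦ ⟨Or.inl h.1, h.2⟩)
    refine edgeIdeal_le_iff.mpr ⟨fun u hu ↦ X_mem_edgeIdeal (Or.inl hu), fun i j hij ↦ ?_⟩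
    by_cases hi : i = v
    · exact minor_mem_of_left (X_mem_edgeIdeal (Or.inr hi)) (X_mem_edgeIdeal (Or.inr hi))
    by_cases hj : j = v
    · exact minor_mem_of_right (X_mem_edgeIdeal (Or.inr hj)) (X_mem_edgeIdeal (Or.inr hj))
    exact minor_mem_edgeIdeal ⟨hij, hi, hj⟩
  · refine edgeIdeal_le_iff.mpr ⟨?_, fun i j hij ↦
      Ideal.mem_sup_left (minor_mem_edgeIdeal hij.1)⟩
    exact fun u hu ↦ Ideal.mem_sup_right (X_mem_edgeIdeal hu)

/-- The depth lemma for the decomposition of a binomial edge ideal at a vertex. -/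
lemma DepthGE.edgeIdeal_of_completeAt {𝔪 : Ideal (MvPolynomial (V ⊕ V) K)}
    (hr : ∀ i j, r i j → r j i) (v : V) {d : ℕ}
    (h₁ : DepthGE 𝔪 (MvPolynomial (V ⊕ V) K ⧸ edgeIdeal K Z (completeAt r v)) d)
    (h₂ : DepthGE 𝔪 (MvPolynomial (V ⊕ V) K ⧸
      edgeIdeal K (Z ∪ varsOf {v}) (isolate r {v})) d)
    (h₃ : DepthGE 𝔪 (MvPolynomial (V ⊕ V) K ⧸
      edgeIdeal K (Z ∪ varsOf {v}) (isolate (completeAt r v) {v})) (d - 1)) :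
    DepthGE 𝔪 (MvPolynomial (V ⊕ V) K ⧸ edgeIdeal K Z r) d := by
  rw [← edgeIdeal_completeAt_sup] at h₃
  rw [← edgeIdeal_completeAt_inf hr v]
  exact h₁.quotient_inf h₂ h₃

end EdgeIdeals

/-! ### Toric parametrization and primality -/

section Toric

variable {K : Type*} [Field K]

/-- If the quotient by `I` identifies any two monomials with the same image under a monomial map,
then `I` contains the kernel of this map. -/
lemma mem_of_monomialMap_eq_zero {σ τ : Type*} (E : (σ →₀ ℕ) → (τ →₀ ℕ))
    (φ : MvPolynomial σ K →ₐ[K] MvPolynomial τ K)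
    (hφ : ∀ m, φ (monomial m 1) = monomial (E m) 1) {I : Ideal (MvPolynomial σ K)}
    (hI : ∀ m m', E m = E m' → monomial m 1 - monomial m' 1 ∈ I) {f : MvPolynomial σ K}
    (hf : φ f = 0) : f ∈ I := by
  let q : (σ →₀ ℕ) → MvPolynomial σ K ⧸ I := fun m ↦ Ideal.Quotient.mk I (monomial m 1)
  -- `L` is built so that `L ∘ φ` is the quotient map by `I`; its value 0 on monomials outside the
  -- image of `E` plays no role.
  let L : MvPolynomial τ K →ₗ[K] MvPolynomial σ K ⧸ I :=
    (basisMonomials τ K).constr K (Function.extend E q 0)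
  have hL : ∀ m, L (monomial (E m) 1) = q m := fun m ↦ by
    have h₁ : L (monomial (E m) 1) = Function.extend E q 0 (E m) := by
      rw [← Module.Basis.constr_basis (basisMonomials τ K) K (Function.extend E q 0) (E m),
        coe_basisMonomials]
    rw [h₁]
    have hfac : Function.FactorsThrough q E := fun m m' h ↦ Ideal.Quotient.eq.mpr (hI m m' h)
    exact hfac.extend_apply 0 m
  have hcomp : L ∘ₗ φ.toLinearMap = (Ideal.Quotient.mkₐ K I).toLinearMap := by
    refine (basisMonomials σ K).ext fun m ↦ ?_
    rw [coe_basisMonomials, LinearMap.comp_apply, AlgHom.toLinearMap_apply, hφ, hL]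
    rfl
  have := LinearMap.congr_fun hcomp f
  rw [LinearMap.comp_apply, AlgHom.toLinearMap_apply, hf, map_zero] at this
  exact Ideal.Quotient.eq_zero_iff_mem.mp this.symm

variable {V ι : Type*}

open Classical in
/-- The exponent of the image of a variable under the parametrization `xᵢ ↦ sᵢ`,
`yᵢ ↦ sᵢ t_{c(i)}`. -/
noncomputable def parExp (c : V → ι) : V ⊕ V → (V ⊕ ι →₀ ℕ) :=
  Sum.elim (fun i ↦ Finsupp.single (Sum.inl i) 1)
    (fun i ↦ Finsupp.single (Sum.inl i) 1 + Finsupp.single (Sum.inr (c i)) 1)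

variable (K) in
/-- The parametrization `xᵢ ↦ sᵢ`, `yᵢ ↦ sᵢ t_{c(i)}`. -/
noncomputable def par (c : V → ι) : MvPolynomial (V ⊕ V) K →ₐ[K] MvPolynomial (V ⊕ ι) K :=
  aeval fun u ↦ monomial (parExp c u) 1

lemma par_inl (c : V → ι) (i : V) : par K c (X (Sum.inl i)) = X (Sum.inl i) := by
  rw [par, aeval_X]; rfl

lemma par_inr (c : V → ι) (i : V) :
    par K c (X (Sum.inr i)) = X (Sum.inl i) * X (Sum.inr (c i)) := by
  rw [par, aeval_X, X, X, monomial_mul, one_mul]; rfl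

lemma par_minor (c : V → ι) (i j : V) :
    par K c (minor K i j) =
      X (Sum.inl i) * X (Sum.inl j) * (X (Sum.inr (c j)) - X (Sum.inr (c i))) := by
  rw [minor, map_sub, map_mul, map_mul, par_inl, par_inl, par_inr, par_inr]
  ring

lemma par_X_ne_zero (c : V → ι) (u : V ⊕ V) : par K c (X u) ≠ 0 := by
  rw [par, aeval_X, Ne, monomial_eq_zero]
  exact one_ne_zero

lemma par_monomial (c : V → ι) (m : V ⊕ V →₀ ℕ) :
    par K c (monomial m 1) = monomial (m.sum fun u k ↦ k • parExp c u) 1 := by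
  rw [par, aeval_monomial, map_one, one_mul, monomial_finsupp_sum_index]
  simp only [monomial_pow, one_pow, C_1, one_mul]

/-- The label of a vertex with respect to a partial equivalence relation: its class. -/
def classOf (r : V → V → Prop) (i : V) : Set V := {j | r i j ∨ i = j}

lemma classOf_eq_iff (hs : ∀ i j, r i j → r j i) (ht : ∀ i j k, r i j → r j k → r i k) {i j : V} :
    classOf r i = classOf r j ↔ r i j ∨ i = j := by
  constructor
  · intro h
    have : j ∈ classOf r j := Or.inr rfl
    rwa [← h] at this
  · rintro (h | rfl)
    · ext k
      constructor
      · rintro (hk | rfl)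
        · exact Or.inl (ht _ _ _ (hs _ _ h) hk)
        · exact Or.inl (hs _ _ h)
      · rintro (hk | rfl)
        · exact Or.inl (ht _ _ _ h hk)
        · exact Or.inl h
    · rfl

variable [Fintype V]

lemma parExp_sum_inl (c : V → ι) (m : V ⊕ V →₀ ℕ) (i : V) :
    (m.sum fun u k ↦ k • parExp c u) (Sum.inl i) = m (Sum.inl i) + m (Sum.inr i) := by
  classical
  rw [Finsupp.sum_fintype m (fun u k ↦ k • parExp c u) (fun _ ↦ zero_smul ℕ _),
    Finsupp.finsetSum_apply,
    Fintype.sum_sum_type]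
  simp [parExp, Finsupp.single_apply]

open Classical in
lemma parExp_sum_inr (c : V → ι) (m : V ⊕ V →₀ ℕ) (k : ι) :
    (m.sum fun u k ↦ k • parExp c u) (Sum.inr k) = ∑ i with c i = k, m (Sum.inr i) := by
  rw [Finsupp.sum_fintype m (fun u k ↦ k • parExp c u) (fun _ ↦ zero_smul ℕ _),
    Finsupp.finsetSum_apply,
    Fintype.sum_sum_type]
  simp [parExp, Finsupp.single_apply, Finset.sum_filter]

/-- Induction on the total excess of the `y`-exponents of `m` over those of `m'`. Exchanging `xⱼ yᵢ`
for `xᵢ yⱼ` within one class changes the monomial by a multiple of a minor and lowers the excess by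
one. -/
lemma monomial_sub_mem_edgeIdeal (c : V → ι) {m m' : V ⊕ V →₀ ℕ}
    (h : (m.sum fun u k ↦ k • parExp c u) = m'.sum fun u k ↦ k • parExp c u) :
    (monomial m 1 - monomial m' 1 : MvPolynomial (V ⊕ V) K) ∈
      edgeIdeal K ∅ (fun i j ↦ c i = c j) := by
  classical
  generalize hN : ∑ i, (m (Sum.inr i) - m' (Sum.inr i)) = N
  induction N generalizing m with
  | zero =>
    have hle : ∀ i, m (Sum.inr i) ≤ m' (Sum.inr i) := fun i ↦ by
      have := (Finset.sum_eq_zero_iff.mp hN) i (Finset.mem_univ i)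
      omega
    have hr : ∀ i, m (Sum.inr i) = m' (Sum.inr i) := fun i ↦ by
      have hk := DFunLike.congr_fun h (Sum.inr (c i))
      rw [parExp_sum_inr, parExp_sum_inr] at hk
      exact (Finset.sum_eq_sum_iff_of_le fun j _ ↦ hle j).mp hk i
        (Finset.mem_filter.mpr ⟨Finset.mem_univ i, rfl⟩)
    have : m = m' := by
      ext (i | i)
      · have hi := DFunLike.congr_fun h (Sum.inl i)
        rw [parExp_sum_inl, parExp_sum_inl, hr i] at hi
        exact Nat.add_right_cancel hi
      · exact hr i
    rw [this, sub_self]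
    exact zero_mem _
  | succ N ih =>
    obtain ⟨i, hi⟩ : ∃ i, m' (Sum.inr i) < m (Sum.inr i) := by
      by_contra! hcon
      rw [Finset.sum_eq_zero fun i _ ↦ Nat.sub_eq_zero_of_le (hcon i)] at hN
      omega
    -- The exponent of `t_{c(i)}` is the sum of the `y`-exponents over the class of `i`, so an
    -- excess at `i` is compensated inside that class.
    obtain ⟨j, hjc, hj⟩ : ∃ j, c j = c i ∧ m (Sum.inr j) < m' (Sum.inr j) := by
      by_contra! hcon
      have hk := DFunLike.congr_fun h (Sum.inr (c i))
      rw [parExp_sum_inr, parExp_sum_inr] at hk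
      refine (Finset.sum_lt_sum (s := Finset.univ.filter fun j ↦ c j = c i)
        (f := fun j ↦ m' (Sum.inr j)) (g := fun j ↦ m (Sum.inr j)) (fun j hj ↦ ?_)
        ⟨i, by simp, hi⟩).ne hk.symm
      exact hcon j (Finset.mem_filter.mp hj).2
    have hij : i ≠ j := fun hij ↦ by subst hij; omega
    -- The exponent of `sⱼ` fixes the sum of the exponents of `xⱼ` and `yⱼ`. The latter is smaller
    -- in `m`, so `xⱼ` divides `m`.
    have hjl : 1 ≤ m (Sum.inl j) := by
      have hk := DFunLike.congr_fun h (Sum.inl j)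
      rw [parExp_sum_inl, parExp_sum_inl] at hk
      omega
    -- move the factor `xⱼ yᵢ` of the monomial to `xᵢ yⱼ`
    let e : V ⊕ V → (V ⊕ V →₀ ℕ) := fun u ↦ Finsupp.single u 1
    obtain ⟨m₀, hm₀⟩ : ∃ m₀, m = m₀ + (e (Sum.inl j) + e (Sum.inr i)) := by
      refine ⟨m - (e (Sum.inl j) + e (Sum.inr i)), (tsub_add_cancel_of_le ?_).symm⟩
      rintro (k | k)
      · by_cases hk : j = k
        · subst hk; simpa [e] using hjl
        · simp [e, hk]
      · by_cases hk : i = k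
        · subst hk
          simp only [e, Finsupp.coe_add, Pi.add_apply, Finsupp.single_apply]
          simp
          omega
        · simp [e, hk]
    have hsum : ∀ u, (e u).sum (fun u k ↦ k • parExp c u) = parExp c u := fun u ↦ by
      rw [Finsupp.sum_single_index (h := fun u k ↦ k • parExp c u) (zero_smul ℕ _), one_smul]
    have hadd : ∀ a b : V ⊕ V →₀ ℕ, (a + b).sum (fun u k ↦ k • parExp c u)
        = a.sum (fun u k ↦ k • parExp c u) + b.sum (fun u k ↦ k • parExp c u) := fun a b ↦
      Finsupp.sum_add_index' (fun _ ↦ zero_smul _ _) (fun _ _ _ ↦ add_smul _ _ _)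
    have hE : (m₀ + (e (Sum.inl i) + e (Sum.inr j))).sum (fun u k ↦ k • parExp c u)
        = m'.sum fun u k ↦ k • parExp c u := by
      rw [← h, hm₀]
      simp only [hadd, hsum]
      simp only [parExp, Sum.elim_inl, Sum.elim_inr, hjc]
      abel
    have hstep := ih hE (by
      have hval : ∀ k, (m₀ + (e (Sum.inl i) + e (Sum.inr j))) (Sum.inr k) - m' (Sum.inr k)
          + (if k = i then 1 else 0) = m (Sum.inr k) - m' (Sum.inr k) := fun k ↦ by
        have hmk : m (Sum.inr k) = m₀ (Sum.inr k) + if i = k then 1 else 0 := by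
          rw [hm₀]; simp [e, Finsupp.single_apply]
        have hnk : (m₀ + (e (Sum.inl i) + e (Sum.inr j))) (Sum.inr k)
            = m₀ (Sum.inr k) + if j = k then 1 else 0 := by
          simp [e, Finsupp.single_apply]
        rw [hnk]
        by_cases hki : k = i
        · subst hki
          simp only [if_neg hij.symm, if_true] at hmk ⊢
          omega
        · by_cases hkj : k = j
          · subst hkj
            simp only [if_neg hij, if_neg hij.symm, if_true] at hmk ⊢
            omega
          · simp only [if_neg hki, if_neg (Ne.symm hki), if_neg (Ne.symm hkj)] at hmk ⊢
            omega
      have := Finset.sum_congr (rfl : (Finset.univ : Finset V) = _) fun k _ ↦ hval k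
      rw [Finset.sum_add_distrib, hN, Finset.sum_ite_eq' Finset.univ i,
        if_pos (Finset.mem_univ i)] at this
      omega)
    have hdiff : (monomial m 1 - monomial (m₀ + (e (Sum.inl i) + e (Sum.inr j))) 1 :
        MvPolynomial (V ⊕ V) K) = monomial m₀ 1 * minor K j i := by
      have hmon : ∀ a b, (monomial (m₀ + (e a + e b)) 1 : MvPolynomial (V ⊕ V) K)
          = monomial m₀ 1 * (X a * X b) := fun a b ↦ by
        rw [X, X, monomial_mul, monomial_mul, one_mul, one_mul]
      rw [hm₀, hmon, hmon, minor]
      ring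
    rw [← sub_add_sub_cancel _ (monomial (m₀ + (e (Sum.inl i) + e (Sum.inr j))) 1) _, hdiff]
    exact add_mem (Ideal.mul_mem_left _ _ (minor_mem_edgeIdeal hjc)) hstep

lemma ker_par (c : V → ι) : RingHom.ker (par K c) = edgeIdeal K ∅ (fun i j ↦ c i = c j) := by
  apply le_antisymm
  · intro f hf
    exact mem_of_monomialMap_eq_zero _ (par K c) (par_monomial c)
      (fun m m' ↦ monomial_sub_mem_edgeIdeal c) hf
  · refine edgeIdeal_le_iff.mpr ⟨fun u hu ↦ hu.elim, fun i j hij ↦ ?_⟩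
    rw [RingHom.mem_ker, par_minor, hij, sub_self, mul_zero]

/-- By `hZ` a killed variable belongs to a vertex that is alone in its class, so killing it affects
no nonzero generating minor. -/
lemma ker_par_comp_killVars {Z : Set (V ⊕ V)} (c : V → ι)
    (hZ : ∀ u ∈ Z, ∀ j, c (u.elim id id) = c j → u.elim id id = j) :
    RingHom.ker ((par K c).comp (killVars K Z)) = edgeIdeal K Z (fun i j ↦ c i = c j) := by
  apply le_antisymm
  · intro f hf
    have h : killVars K Z f ∈ RingHom.ker (par K c) := hf
    rw [ker_par] at h
    rw [← sub_add_cancel f (killVars K Z f)]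
    exact add_mem (Ideal.mem_sup_left (sub_killVars_mem f))
      (edgeIdeal_mono (Set.empty_subset Z) (fun _ _ ↦ id) h)
  · refine edgeIdeal_le_iff.mpr ⟨fun u hu ↦ ?_, fun i j hij ↦ ?_⟩
    · rw [RingHom.mem_ker, AlgHom.comp_apply, killVars_X_of_mem hu, map_zero]
    · by_cases hne : i = j
      · rw [hne, minor_self]; exact zero_mem _
      · have hi : ∀ u : V ⊕ V, u.elim id id = i → u ∉ Z := fun u hu huZ ↦
          hne (hu.symm.trans (hZ u huZ j (hu ▸ hij)))
        have hj : ∀ u : V ⊕ V, u.elim id id = j → u ∉ Z := fun u hu huZ ↦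
          hne (hu.symm.trans (hZ u huZ i (hu ▸ hij.symm))).symm
        rw [RingHom.mem_ker, AlgHom.comp_apply,
          killVars_minor (hi (.inl i) rfl) (hi (.inr i) rfl) (hj (.inl j) rfl) (hj (.inr j) rfl),
          par_minor, hij, sub_self, mul_zero]

variable {Z : Set (V ⊕ V)} {r : V → V → Prop}

lemma edgeIdeal_eq_ker (hs : ∀ i j, r i j → r j i) (ht : ∀ i j k, r i j → r j k → r i k)
    (hZ : ∀ u ∈ Z, ∀ j, r (u.elim id id) j → u.elim id id = j) :
    edgeIdeal K Z r = RingHom.ker ((par K (classOf r)).comp (killVars K Z)) := by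
  rw [ker_par_comp_killVars]
  · refine edgeIdeal_congr fun i j hij ↦ ?_
    rw [classOf_eq_iff hs ht]
    exact ⟨Or.inl, fun h ↦ h.resolve_right hij⟩
  · intro u hu j hj
    exact ((classOf_eq_iff hs ht).mp hj).elim (hZ u hu j) id

lemma isPrime_edgeIdeal (hs : ∀ i j, r i j → r j i) (ht : ∀ i j k, r i j → r j k → r i k)
    (hZ : ∀ u ∈ Z, ∀ j, r (u.elim id id) j → u.elim id id = j) : (edgeIdeal K Z r).IsPrime := by
  rw [edgeIdeal_eq_ker hs ht hZ]
  exact RingHom.ker_isPrime _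

lemma X_notMem_edgeIdeal (hs : ∀ i j, r i j → r j i) (ht : ∀ i j k, r i j → r j k → r i k)
    (hZ : ∀ u ∈ Z, ∀ j, r (u.elim id id) j → u.elim id id = j) {u : V ⊕ V} (hu : u ∉ Z) :
    X u ∉ edgeIdeal K Z r := by
  rw [edgeIdeal_eq_ker hs ht hZ, RingHom.mem_ker, AlgHom.comp_apply, killVars_X_of_notMem hu]
  exact par_X_ne_zero _ _

end Toric

/-! ### Splitting the ideal of disjoint cliques by one variable -/

section EquivalenceRelations

variable {K : Type*} [Field K] {V : Type*} {r : V → V → Prop}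

lemma isolate_symm (hs : ∀ i j, r i j → r j i) (A : Set V) (i j : V) (h : isolate r A i j) :
    isolate r A j i :=
  ⟨hs _ _ h.1, h.2.2, h.2.1⟩

lemma isolate_trans (ht : ∀ i j k, r i j → r j k → r i k) (A : Set V) (i j k : V)
    (h : isolate r A i j) (h' : isolate r A j k) : isolate r A i k :=
  ⟨ht _ _ _ h.1 h'.1, h.2.1, h'.2.2⟩

lemma edgeIdeal_sup_span {Z : Set (V ⊕ V)} (u : V ⊕ V) :
    edgeIdeal K Z r ⊔ Ideal.span {X u} = edgeIdeal K (insert u Z) r := by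
  rw [edgeIdeal, edgeIdeal, Set.image_insert_eq, Ideal.span_insert, sup_right_comm,
    sup_comm (Ideal.span {X u})]

variable [Finite V]

/-- Once `x_v = 0`, the minors at `v` say `xᵢ y_v = 0` for every `i` in the class of `v`. Either
`y_v` vanishes, or all these `xᵢ` do and the minors of the class become redundant. -/
lemma edgeIdeal_sup_span_X_eq_inf {Z : Set (V ⊕ V)} (hs : ∀ i j, r i j → r j i)
    (ht : ∀ i j k, r i j → r j k → r i k)
    (hZ : ∀ u ∈ Z, ∀ j, r (u.elim id id) j → u.elim id id = j) {v : V} (hv : Sum.inr v ∉ Z) :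
    edgeIdeal K Z r ⊔ Ideal.span {X (Sum.inl v)} =
      edgeIdeal K (insert (Sum.inl v) (insert (Sum.inr v) Z)) (isolate r {v}) ⊓
        edgeIdeal K (Z ∪ Sum.inl '' {i | r v i ∨ i = v}) (isolate r {i | r v i ∨ i = v}) := by
  have := Fintype.ofFinite V
  set A : Set V := {i | r v i ∨ i = v}
  set I₁ := edgeIdeal K Z r ⊔ Ideal.span {X (Sum.inl v)}
  set L := edgeIdeal K (insert (Sum.inl v) (insert (Sum.inr v) Z)) (isolate r {v})
  set M := edgeIdeal K (Z ∪ Sum.inl '' A) (isolate r A)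
  have hxv : (X (Sum.inl v) : MvPolynomial (V ⊕ V) K) ∈ I₁ :=
    Ideal.mem_sup_right (Ideal.mem_span_singleton_self _)
  have hvA : v ∈ A := Or.inr rfl
  have hI₁L : I₁ ≤ L := by
    refine sup_le (edgeIdeal_le_iff.mpr ⟨fun u hu ↦ X_mem_edgeIdeal (Or.inr (Or.inr hu)),
      fun i j hij ↦ ?_⟩)
      ((Ideal.span_singleton_le_iff_mem _).mpr (X_mem_edgeIdeal (Or.inl rfl)))
    have hx : X (Sum.inl v) ∈ L := X_mem_edgeIdeal (Or.inl rfl)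
    have hy : X (Sum.inr v) ∈ L := X_mem_edgeIdeal (Or.inr (Or.inl rfl))
    by_cases hi : i = v
    · rw [hi]; exact minor_mem_of_left hx hy
    by_cases hj : j = v
    · rw [hj]; exact minor_mem_of_right hx hy
    exact minor_mem_edgeIdeal ⟨hij, hi, hj⟩
  have hI₁M : I₁ ≤ M := by
    have hxA : ∀ i ∈ A, X (Sum.inl i) ∈ M := fun i hi ↦ X_mem_edgeIdeal (Or.inr ⟨i, hi, rfl⟩)
    have hA : ∀ i j, r i j → i ∈ A → j ∈ A := fun i j hij hi ↦
      hi.elim (fun h ↦ Or.inl (ht _ _ _ h hij)) fun h ↦ Or.inl (h ▸ hij)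
    refine sup_le (edgeIdeal_le_iff.mpr ⟨fun u hu ↦ X_mem_edgeIdeal (Or.inl hu),
      fun i j hij ↦ ?_⟩) ((Ideal.span_singleton_le_iff_mem _).mpr (hxA v hvA))
    by_cases hi : i ∈ A
    · exact sub_mem (Ideal.mul_mem_right _ _ (hxA i hi))
        (Ideal.mul_mem_right _ _ (hxA j (hA i j hij hi)))
    · exact minor_mem_edgeIdeal ⟨hij, hi, fun hj ↦ hi (hA j i (hs _ _ hij) hj)⟩
  refine le_antisymm (le_inf hI₁L hI₁M) ?_
  rintro f ⟨hfL, hfM⟩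
  have hL : L ≤ I₁ ⊔ Ideal.span {X (Sum.inr v)} := by
    refine edgeIdeal_le_iff.mpr ⟨?_, fun i j hij ↦ Ideal.mem_sup_left
      (Ideal.mem_sup_left (minor_mem_edgeIdeal hij.1))⟩
    rintro u (rfl | rfl | hu)
    · exact Ideal.mem_sup_left hxv
    · exact Ideal.mem_sup_right (Ideal.mem_span_singleton_self _)
    · exact Ideal.mem_sup_left (Ideal.mem_sup_left (X_mem_edgeIdeal hu))
  -- An element of `L` is `g + h y_v` with `g ∈ I₁`. If it also lies in the prime `M`, which does
  -- not contain `y_v`, then `h ∈ M`, and `M y_v ⊆ I₁`.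
  obtain ⟨g, hg, z, hz, rfl⟩ := Submodule.mem_sup.mp (hL hfL)
  obtain ⟨h, rfl⟩ := Ideal.mem_span_singleton'.mp hz
  refine add_mem hg ?_
  have hhM : h * X (Sum.inr v) ∈ M := (Submodule.add_mem_iff_right M (hI₁M hg)).mp hfM
  have hZM : ∀ u ∈ Z ∪ Sum.inl '' A, ∀ j, isolate r A (u.elim id id) j → u.elim id id = j := by
    rintro u (hu | ⟨i, hi, rfl⟩) j hj
    · exact hZ u hu j hj.1
    · exact (hj.2.1 hi).elim
  have hM : M.IsPrime := isPrime_edgeIdeal (isolate_symm hs A) (isolate_trans ht A) hZM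
  have hyM : X (Sum.inr v) ∉ M := by
    refine X_notMem_edgeIdeal (isolate_symm hs A) (isolate_trans ht A) hZM ?_
    rintro (h | ⟨_, -, h⟩)
    · exact hv h
    · exact Sum.inl_ne_inr h
  have hh : h ∈ M := (hM.mem_or_mem hhM).resolve_right hyM
  have hMI : M ≤ I₁.colon {X (Sum.inr v)} := by
    refine edgeIdeal_le_iff.mpr ⟨?_, fun i j hij ↦ Submodule.mem_colon_singleton.mpr
      (Ideal.mul_mem_right _ _ (Ideal.mem_sup_left (minor_mem_edgeIdeal hij.1)))⟩
    rintro u (hu | ⟨i, hi, rfl⟩)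
    · exact Submodule.mem_colon_singleton.mpr
        (Ideal.mul_mem_right _ _ (Ideal.mem_sup_left (X_mem_edgeIdeal hu)))
    · rw [Submodule.mem_colon_singleton, smul_eq_mul]
      rcases hi with hi | rfl
      · have hm : minor K v i ∈ I₁ := Ideal.mem_sup_left (minor_mem_edgeIdeal hi)
        have : X (Sum.inl i) * X (Sum.inr v) = X (Sum.inl v) * X (Sum.inr i) - minor K v i := by
          unfold minor; ring
        rw [this]
        exact sub_mem (Ideal.mul_mem_right _ _ hxv) hm
      · exact Ideal.mul_mem_right _ _ hxv
  exact Submodule.mem_colon_singleton.mp (hMI hh)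

end EquivalenceRelations

/-! ### Depth of disjoint cliques -/

section Depth

variable {K : Type*} [Field K] {V : Type*}

lemma idealOfVars_ne_top : idealOfVars V K ≠ ⊤ := by
  have hle : idealOfVars V K ≤ RingHom.ker (constantCoeff (R := K) (σ := V)) :=
    Ideal.span_le.mpr (by rintro _ ⟨u, rfl⟩; exact constantCoeff_X (R := K) u)
  intro h
  exact RingHom.ker_ne_top _ (top_le_iff.mp (h ▸ hle))

lemma X_mem_idealOfVars (u : V) : X u ∈ idealOfVars V K := Ideal.subset_span ⟨u, rfl⟩

variable [Fintype V]

lemma DepthGE.edgeIdeal_insert {Z : Set (V ⊕ V)} {r : V → V → Prop} (hs : ∀ i j, r i j → r j i)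
    (ht : ∀ i j k, r i j → r j k → r i k)
    (hZ : ∀ u ∈ Z, ∀ j, r (u.elim id id) j → u.elim id id = j) {u : V ⊕ V} (hu : u ∉ Z) {d : ℕ}
    (h : DepthGE (idealOfVars (V ⊕ V) K)
      (MvPolynomial (V ⊕ V) K ⧸ (edgeIdeal K Z r ⊔ Ideal.span {X u})) d) :
    DepthGE (idealOfVars (V ⊕ V) K) (MvPolynomial (V ⊕ V) K ⧸ edgeIdeal K Z r) (d + 1) := by
  refine h.of_quotient_sup_span idealOfVars_ne_top edgeIdeal_le_idealOfVars (X_mem_idealOfVars u)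
    fun f hf ↦ ?_
  exact ((isPrime_edgeIdeal hs ht hZ).mem_or_mem hf).resolve_left
    (X_notMem_edgeIdeal hs ht hZ hu)

/-- The minors in question are all zero, and the variables outside `Z` form a regular sequence. -/
lemma depthGE_edgeIdeal_of_forall_eq {r : V → V → Prop} (hr : ∀ i j, r i j → i = j)
    {Z : Finset (V ⊕ V)} {d : ℕ} (hd : d + Z.card ≤ 2 * Fintype.card V) :
    DepthGE (idealOfVars (V ⊕ V) K) (MvPolynomial (V ⊕ V) K ⧸ edgeIdeal K (Z : Set (V ⊕ V)) r) d := by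
  classical
  induction d generalizing Z with
  | zero => exact fun i hi ↦ (Nat.not_lt_zero i hi).elim
  | succ d ih =>
    obtain ⟨u, hu⟩ : ∃ u, u ∉ Z := by
      by_contra! hcon
      rw [Finset.eq_univ_of_forall hcon, Finset.card_univ, Fintype.card_sum] at hd
      omega
    refine DepthGE.edgeIdeal_insert (fun i j h ↦ hr i j h ▸ h) (fun i j k h h' ↦ hr i j h ▸ h')
      (fun _ _ j h ↦ hr _ j h) (u := u) (by simpa using hu) ?_
    rw [edgeIdeal_sup_span, ← Finset.coe_insert]
    exact ih (by rw [Finset.card_insert_of_notMem hu]; omega)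

/-- The depth of the ideal of the minors of disjoint cliques, together with variables at isolated
vertices: `R` is a set of vertices that meets each clique in at most one vertex. -/
lemma depthGE_edgeIdeal_of_equivalence {r : V → V → Prop} (hs : ∀ i j, r i j → r j i)
    (ht : ∀ i j k, r i j → r j k → r i k) {Z : Finset (V ⊕ V)}
    (hZ : ∀ u ∈ Z, ∀ j, r (u.elim id id) j → u.elim id id = j) {R : Finset V}
    (hR : ∀ a ∈ R, ∀ b ∈ R, r a b → a = b) {d : ℕ}
    (hd : d + Z.card ≤ Fintype.card V + R.card) :
    DepthGE (idealOfVars (V ⊕ V) K) (MvPolynomial (V ⊕ V) K ⧸ edgeIdeal K (Z : Set (V ⊕ V)) r) d := by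
  classical
  generalize hN : Fintype.card V - R.card = N
  induction N using Nat.strong_induction_on generalizing r Z R d with
  | _ N ih =>
  by_cases htriv : ∀ i j, r i j → i = j
  · exact depthGE_edgeIdeal_of_forall_eq htriv (by have := R.card_le_univ; omega)
  push Not at htriv
  -- A nontrivial related pair has at most one end in `R`; the other end serves as `v`.
  obtain ⟨v, w, hvw, hne, hvR⟩ : ∃ v w, r v w ∧ v ≠ w ∧ v ∉ R := by
    obtain ⟨v, w, hvw, hne⟩ := htriv
    by_cases hv : v ∈ R
    · exact ⟨w, v, hs _ _ hvw, hne.symm, fun hw ↦ hne (hR v hv w hw hvw)⟩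
    · exact ⟨v, w, hvw, hne, hv⟩
  obtain _ | d := d
  · exact fun i hi ↦ (Nat.not_lt_zero i hi).elim
  have hvl : Sum.inl v ∉ Z := fun h ↦ hne (hZ _ h w hvw)
  have hvr : Sum.inr v ∉ Z := fun h ↦ hne (hZ _ h w hvw)
  have hRlt : R.card < Fintype.card V := Finset.card_lt_univ_of_notMem hvR
  set A : Finset V := Finset.univ.filter fun i ↦ r v i ∨ i = v with hA
  have hvA : v ∈ A := by simp [hA]
  have hRA : R.card + A.card ≤ (R ∪ A).card + 1 := by
    rw [← Finset.card_union_add_card_inter]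
    refine Nat.add_le_add_left (Finset.card_le_one.mpr fun a ha b hb ↦ ?_) _
    obtain ⟨haR, haA⟩ := Finset.mem_inter.mp ha
    obtain ⟨hbR, hbA⟩ := Finset.mem_inter.mp hb
    have haA' := ((Finset.mem_filter.mp haA).2.resolve_right fun h ↦ hvR (h ▸ haR))
    have hbA' := ((Finset.mem_filter.mp hbA).2.resolve_right fun h ↦ hvR (h ▸ hbR))
    exact hR a haR b hbR (ht _ _ _ (hs _ _ haA') hbA')
  have hRlt' : R.card < (R ∪ A).card := Finset.card_lt_card
    ⟨Finset.subset_union_left, fun h ↦ hvR (h (Finset.mem_union_right _ hvA))⟩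
  have hmemA : {i | r v i ∨ i = v} = (A : Set V) := by ext; simp [hA]
  have hZA : ∀ u ∈ Z ∪ A.image Sum.inl, ∀ j, isolate r A (u.elim id id) j → u.elim id id = j := by
    intro u hu j hj
    rcases Finset.mem_union.mp hu with hu | hu
    · exact hZ u hu j hj.1
    · obtain ⟨i, hi, rfl⟩ := Finset.mem_image.mp hu
      exact (hj.2.1 hi).elim
  have hRR : ∀ a ∈ R ∪ A, ∀ b ∈ R ∪ A, isolate r A a b → a = b := by
    intro a ha b hb hab
    exact hR a ((Finset.mem_union.mp ha).resolve_right hab.2.1) b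
      ((Finset.mem_union.mp hb).resolve_right hab.2.2) hab.1
  have hcard : (Z ∪ A.image Sum.inl).card ≤ Z.card + A.card :=
    (Finset.card_union_le _ _).trans (Nat.add_le_add_left Finset.card_image_le _)
  refine DepthGE.edgeIdeal_insert hs ht (by simpa using hZ) (u := Sum.inl v) (by simpa using hvl) ?_
  rw [edgeIdeal_sup_span_X_eq_inf hs ht (by simpa using hZ) (by simpa using hvr), hmemA]
  -- The count survives in each term. The first kills two more variables while `R` gains `v`. The
  -- second kills at most `|A|` more and `R` gains at least `|A| - 1`. The sum kills `y_v` in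
  -- addition to the second, but needs one less depth.
  refine DepthGE.quotient_inf ?_ ?_ ?_
  · rw [← Finset.coe_insert, ← Finset.coe_insert]
    refine ih (Fintype.card V - (insert v R).card) ?_ (isolate_symm hs _) (isolate_trans ht _)
      ?_ (R := insert v R) ?_ ?_ rfl
    · rw [Finset.card_insert_of_notMem hvR]; omega
    · intro u hu j hj
      rcases Finset.mem_insert.mp hu with rfl | hu
      · exact (hj.2.1 rfl).elim
      rcases Finset.mem_insert.mp hu with rfl | hu
      · exact (hj.2.1 rfl).elim
      · exact hZ u hu j hj.1
    · intro a ha b hb hab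
      exact hR a ((Finset.mem_insert.mp ha).resolve_left hab.2.1) b
        ((Finset.mem_insert.mp hb).resolve_left hab.2.2) hab.1
    · rw [Finset.card_insert_of_notMem hvR]
      have h₁ := Finset.card_insert_le (Sum.inl v) (insert (Sum.inr v) Z)
      have h₂ := Finset.card_insert_le (Sum.inr v) Z
      omega
  · rw [← Finset.coe_image, ← Finset.coe_union]
    exact ih (Fintype.card V - (R ∪ A).card) (by omega) (isolate_symm hs _) (isolate_trans ht _)
      hZA hRR (by omega) rfl
  · have hsup : edgeIdeal K (insert (Sum.inl v) (insert (Sum.inr v) (Z : Set (V ⊕ V))))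
          (isolate r {v}) ⊔ edgeIdeal K ((Z : Set (V ⊕ V)) ∪ Sum.inl '' (A : Set V)) (isolate r A)
        = edgeIdeal K (insert (Sum.inr v) ((Z : Set (V ⊕ V)) ∪ Sum.inl '' (A : Set V)))
          (isolate r A) := by
      have hA' : ∀ i j, r i j → i ∈ A → j ∈ A := fun i j hij hi ↦ by
        simp only [hA, Finset.mem_filter, Finset.mem_univ, true_and] at hi ⊢
        exact Or.inl (hi.elim (fun h ↦ ht _ _ _ h hij) fun h ↦ h ▸ hij)
      have hxA : ∀ i ∈ A, X (Sum.inl i) ∈ edgeIdeal K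
          (insert (Sum.inr v) ((Z : Set (V ⊕ V)) ∪ Sum.inl '' (A : Set V))) (isolate r A) :=
        fun i hi ↦ X_mem_edgeIdeal (Or.inr (Or.inr ⟨i, hi, rfl⟩))
      apply le_antisymm
      · refine sup_le (edgeIdeal_le_iff.mpr ⟨?_, fun i j hij ↦ ?_⟩)
          (edgeIdeal_mono (Set.subset_insert _ _) fun _ _ ↦ id)
        · rintro u (rfl | rfl | hu)
          · exact hxA v hvA
          · exact X_mem_edgeIdeal (Or.inl rfl)
          · exact X_mem_edgeIdeal (Or.inr (Or.inl hu))
        · by_cases hi : i ∈ A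
          · exact sub_mem (Ideal.mul_mem_right _ _ (hxA i hi))
              (Ideal.mul_mem_right _ _ (hxA j (hA' i j hij.1 hi)))
          · exact minor_mem_edgeIdeal ⟨hij.1, hi, fun hj ↦ hi (hA' j i (hs _ _ hij.1) hj)⟩
      · refine edgeIdeal_le_iff.mpr ⟨?_, fun i j hij ↦
          Ideal.mem_sup_right (minor_mem_edgeIdeal hij)⟩
        rintro u (rfl | hu)
        · exact Ideal.mem_sup_left (X_mem_edgeIdeal (Or.inr (Or.inl rfl)))
        · exact Ideal.mem_sup_right (X_mem_edgeIdeal hu)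
    rw [hsup, ← Finset.coe_image, ← Finset.coe_union, ← Finset.coe_insert]
    have h₁ := Finset.card_insert_le (Sum.inr v) (Z ∪ A.image Sum.inl)
    by_cases hd0 : d = 0
    · subst hd0
      exact fun i hi ↦ (Nat.not_lt_zero i hi).elim
    refine ih (Fintype.card V - (R ∪ A).card) (by omega) (isolate_symm hs _) (isolate_trans ht _)
      ?_ hRR (by omega) rfl
    intro u hu j hj
    rcases Finset.mem_insert.mp hu with rfl | hu
    · exact (hj.2.1 hvA).elim
    · exact hZA u hu j hj

end Depth

/-! ### Depth of graphs glued from two cliques -/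

section Cliques

variable {K : Type*} [Field K] {V : Type*}

/-- The relation of lying in one of the two cliques `A` and `B`. -/
def inCliques (A B : Finset V) (i j : V) : Prop := (i ∈ A ∧ j ∈ A) ∨ (i ∈ B ∧ j ∈ B)

/-- The depth of the binomial edge ideal of `r` on the set `U` of vertices is at least `d`. -/
def EdgeDepthGE (K : Type*) [Field K] (U : Finset V) (r : V → V → Prop) (d : ℕ) : Prop :=
  DepthGE (idealOfVars (V ⊕ V) K)
    (MvPolynomial (V ⊕ V) K ⧸ edgeIdeal K (varsOf ((U : Set V)ᶜ)) r) d

lemma inCliques_symm (A B : Finset V) (i j : V) (h : inCliques A B i j) : inCliques A B j i :=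
  h.imp And.symm And.symm

variable [DecidableEq V]

lemma EdgeDepthGE.of_completeAt {U : Finset V} {r r₁ r₂ r₃ : V → V → Prop}
    (hr : ∀ i j, r i j → r j i) {v : V}
    (hr₁ : ∀ i j, i ≠ j → (completeAt r v i j ↔ r₁ i j))
    (hr₂ : ∀ i j, i ≠ j → (isolate r {v} i j ↔ r₂ i j))
    (hr₃ : ∀ i j, i ≠ j → (isolate r₁ {v} i j ↔ r₃ i j)) {d : ℕ}
    (h₁ : EdgeDepthGE K U r₁ d) (h₂ : EdgeDepthGE K (U.erase v) r₂ d)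
    (h₃ : EdgeDepthGE K (U.erase v) r₃ (d - 1)) : EdgeDepthGE K U r d := by
  have hU : varsOf (((U.erase v : Finset V) : Set V)ᶜ) = varsOf ((U : Set V)ᶜ) ∪ varsOf {v} := by
    ext u
    simp only [varsOf, Set.mem_ofPred_eq, Set.mem_union, Set.mem_compl_iff, Finset.mem_coe,
      Finset.mem_erase, Set.mem_singleton_iff]
    tauto
  unfold EdgeDepthGE at *
  rw [hU] at h₂ h₃
  refine DepthGE.edgeIdeal_of_completeAt hr v ?_ ?_ ?_
  · rwa [edgeIdeal_congr hr₁]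
  · rwa [edgeIdeal_congr hr₂]
  · rwa [edgeIdeal_congr fun i j hij ↦ ?_]
    rw [← hr₃ i j hij]
    exact and_congr_left fun _ ↦ hr₁ i j hij

variable [Fintype V]

/-- A vertex outside `U` costs two killed variables and, being isolated, contributes one element to
the transversal. The net effect is to replace `|V|` by `|U|` in the bound. -/
lemma edgeDepthGE_of_equivalence {U : Finset V} {r : V → V → Prop} (hs : ∀ i j, r i j → r j i)
    (ht : ∀ i j k, r i j → r j k → r i k) (hU : ∀ i j, r i j → i ∈ U) {R : Finset V} (hRU : R ⊆ U)
    (hR : ∀ a ∈ R, ∀ b ∈ R, r a b → a = b) {d : ℕ} (hd : d ≤ U.card + R.card) :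
    EdgeDepthGE K U r d := by
  have hZ : varsOf ((U : Set V)ᶜ) = ((Uᶜ.disjSum Uᶜ : Finset (V ⊕ V)) : Set (V ⊕ V)) := by
    ext (u | u) <;> simp [varsOf]
  unfold EdgeDepthGE
  rw [hZ]
  refine depthGE_edgeIdeal_of_equivalence hs ht (fun u hu j hj ↦ ?_) (R := R ∪ Uᶜ)
    (fun a ha b hb hab ↦ ?_) ?_
  · have := hU _ _ hj
    rw [← Finset.mem_coe, ← hZ] at hu
    exact (hu this).elim
  · exact hR a ((Finset.mem_union.mp ha).resolve_right fun h ↦ Finset.mem_compl.mp h (hU _ _ hab))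
      b ((Finset.mem_union.mp hb).resolve_right fun h ↦
        Finset.mem_compl.mp h (hU _ _ (hs _ _ hab))) hab
  · rw [Finset.card_disjSum, Finset.card_union_of_disjoint
      (Finset.disjoint_left.mpr fun a ha h ↦ Finset.mem_compl.mp h (hRU ha))]
    have := Finset.card_add_card_compl U
    omega

lemma edgeDepthGE_clique {U : Finset V} (hU : U.Nonempty) {d : ℕ} (hd : d ≤ U.card + 1) :
    EdgeDepthGE K U (inCliques U U) d := by
  obtain ⟨a, ha⟩ := hU
  refine edgeDepthGE_of_equivalence (inCliques_symm U U) ?_ ?_ (R := {a})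
    (Finset.singleton_subset_iff.mpr ha) ?_ (by simpa using hd)
  · unfold inCliques; tauto
  · unfold inCliques; tauto
  · simp

lemma edgeDepthGE_inCliques_of_disjoint {A B : Finset V} (hAB : Disjoint A B) (hA : A.Nonempty)
    (hB : B.Nonempty) {d : ℕ} (hd : d ≤ (A ∪ B).card + 2) :
    EdgeDepthGE K (A ∪ B) (inCliques A B) d := by
  obtain ⟨a, ha⟩ := hA
  obtain ⟨b, hb⟩ := hB
  have hdis : ∀ i, i ∈ A → i ∈ B → False := fun i h h' ↦ Finset.disjoint_left.mp hAB h h'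
  have hab : a ≠ b := fun h ↦ hdis a ha (h ▸ hb)
  refine edgeDepthGE_of_equivalence (inCliques_symm A B) ?_ ?_ (R := {a, b}) ?_ ?_
    (by rwa [Finset.card_pair hab])
  · rintro i j k (⟨h₁, h₂⟩ | ⟨h₁, h₂⟩) (⟨h₃, h₄⟩ | ⟨h₃, h₄⟩)
    · exact Or.inl ⟨h₁, h₄⟩
    · exact (hdis j h₂ h₃).elim
    · exact (hdis j h₃ h₂).elim
    · exact Or.inr ⟨h₁, h₄⟩
  · rintro i j (h | h)
    · exact Finset.mem_union_left _ h.1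
    · exact Finset.mem_union_right _ h.1
  · simp [Finset.insert_subset_iff, ha, hb]
  · simp only [Finset.mem_insert, Finset.mem_singleton]
    rintro x (rfl | rfl) y (rfl | rfl) (⟨h₁, h₂⟩ | ⟨h₁, h₂⟩)
    · rfl
    · rfl
    · exact (hdis _ h₂ hb).elim
    · exact (hdis _ ha h₁).elim
    · exact (hdis _ h₁ hb).elim
    · exact (hdis _ ha h₂).elim
    · rfl
    · rfl

/-- The depth of the binomial edge ideal of a graph that consists of two cliques. -/
lemma edgeDepthGE_inCliques {A B : Finset V} (hA : (A \ B).Nonempty) (hB : (B \ A).Nonempty)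
    {d : ℕ} (hd : d + (A ∩ B).card ≤ (A ∪ B).card + 2) :
    EdgeDepthGE K (A ∪ B) (inCliques A B) d := by
  generalize hN : (A ∩ B).card = N
  induction N generalizing A B d with
  | zero =>
    exact edgeDepthGE_inCliques_of_disjoint
      (Finset.disjoint_iff_inter_eq_empty.mpr (Finset.card_eq_zero.mp hN))
      (hA.mono Finset.sdiff_subset) (hB.mono Finset.sdiff_subset) (by omega)
  | succ N ih =>
    -- At a common vertex, completion yields a single clique and deletion shrinks the intersection
    -- by one.
    obtain ⟨v, hv⟩ : (A ∩ B).Nonempty := Finset.card_pos.mp (by omega)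
    obtain ⟨hvA, hvB⟩ := Finset.mem_inter.mp hv
    have hvU : v ∈ A ∪ B := Finset.mem_union_left _ hvA
    have hU : (A ∪ B).erase v = A.erase v ∪ B.erase v := Finset.erase_union_distrib _ _ _
    have hI : (A ∩ B).erase v = A.erase v ∩ B.erase v := by ext; simp; tauto
    have hcU := Finset.card_erase_of_mem hvU
    have hcI := Finset.card_erase_of_mem hv
    have hne : ((A ∪ B).erase v).Nonempty := by
      obtain ⟨a, ha⟩ := hA
      obtain ⟨haA, haB⟩ := Finset.mem_sdiff.mp ha
      exact ⟨a, Finset.mem_erase.mpr ⟨fun h ↦ haB (h ▸ hvB), Finset.mem_union_left _ haA⟩⟩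
    refine EdgeDepthGE.of_completeAt (r₁ := inCliques (A ∪ B) (A ∪ B))
      (r₂ := inCliques (A.erase v) (B.erase v))
      (r₃ := inCliques ((A ∪ B).erase v) ((A ∪ B).erase v)) (inCliques_symm A B) ?_ ?_ ?_
      (edgeDepthGE_clique ⟨v, hvU⟩ (by omega)) ?_ (edgeDepthGE_clique hne (by omega))
    · intro i j _
      simp only [completeAt, inCliques, Finset.mem_union]
      tauto
    · intro i j _
      simp only [isolate, inCliques, Finset.mem_erase, Set.mem_singleton_iff]
      tauto
    · intro i j _
      simp only [isolate, inCliques, Finset.mem_erase, Set.mem_singleton_iff]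
      tauto
    · rw [hU]
      rw [hU] at hcU
      rw [hI] at hcI
      refine ih ?_ ?_ (by omega) (by omega)
      · obtain ⟨a, ha⟩ := hA
        exact ⟨a, by grind⟩
      · obtain ⟨b, hb⟩ := hB
        exact ⟨b, by grind⟩

/-- The depth of the binomial edge ideal of two disjoint cliques joined by an edge. -/
lemma edgeDepthGE_inCliques_or_edge {A B : Finset V} (hAB : Disjoint A B) {u w : V} (hu : u ∈ A)
    (hw : w ∈ B) (hA : (A.erase u).Nonempty) (hB : (B.erase w).Nonempty) {d : ℕ}
    (hd : d ≤ (A ∪ B).card + 1) :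
    EdgeDepthGE K (A ∪ B)
      (fun i j ↦ inCliques A B i j ∨ (i = u ∧ j = w) ∨ (i = w ∧ j = u)) d := by
  have hdis : ∀ i, i ∈ A → i ∈ B → False := fun i h h' ↦ Finset.disjoint_left.mp hAB h h'
  have huB : u ∉ B := hdis u hu
  have hwA : w ∉ A := fun h ↦ hdis w h hw
  have huU : u ∈ A ∪ B := Finset.mem_union_left _ hu
  have hcU := Finset.card_erase_of_mem huU
  have hcU' := Finset.card_pos.mpr ⟨u, huU⟩
  have hU₁ : A ∪ B = insert w A ∪ B := by
    rw [Finset.insert_union, Finset.insert_eq_of_mem (Finset.mem_union_right _ hw)]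
  have hU₂ : (A ∪ B).erase u = A.erase u ∪ B := by
    rw [Finset.erase_union_distrib, Finset.erase_eq_of_notMem huB]
  have hU₃ : (A ∪ B).erase u = insert w (A.erase u) ∪ B := by
    rw [hU₂, Finset.insert_union, Finset.insert_eq_of_mem (Finset.mem_union_right _ hw)]
  obtain ⟨a, ha⟩ := hA
  obtain ⟨b, hb⟩ := hB
  obtain ⟨hau, haA⟩ := Finset.mem_erase.mp ha
  obtain ⟨hbw, hbB⟩ := Finset.mem_erase.mp hb
  have hI : ∀ C ⊆ A, insert w C ∩ B = {w} := fun C hC ↦ by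
    ext i
    simp only [Finset.mem_inter, Finset.mem_insert, Finset.mem_singleton]
    constructor
    · rintro ⟨rfl | h, h'⟩
      · rfl
      · exact (hdis i (hC h) h').elim
    · rintro rfl
      exact ⟨Or.inl rfl, hw⟩
  have hl : ∀ C ⊆ A, a ∈ C → (insert w C \ B).Nonempty := fun C hC haC ↦
    ⟨a, Finset.mem_sdiff.mpr ⟨Finset.mem_insert_of_mem haC, hdis a haA⟩⟩
  have hr : ∀ C ⊆ A, (B \ insert w C).Nonempty := fun C hC ↦
    ⟨b, Finset.mem_sdiff.mpr ⟨hbB, fun h ↦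
      (Finset.mem_insert.mp h).elim hbw fun h ↦ hdis b (hC h) hbB⟩⟩
  -- Completing at `u` draws `w` into the clique `A`, leaving two cliques that share only `w`.
  -- Deleting `u` removes the bridge.
  refine EdgeDepthGE.of_completeAt (v := u) (r₁ := inCliques (insert w A) B)
    (r₂ := inCliques (A.erase u) B) (r₃ := inCliques (insert w (A.erase u)) B) ?_ ?_ ?_ ?_
    ?_ ?_ ?_
  · rintro i j (h | ⟨h, h'⟩ | ⟨h, h'⟩)
    · exact Or.inl (inCliques_symm A B i j h)
    · exact Or.inr (Or.inr ⟨h', h⟩)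
    · exact Or.inr (Or.inl ⟨h', h⟩)
  · intro i j hij
    simp only [completeAt, inCliques]
    grind
  · intro i j _
    simp only [isolate, inCliques, Set.mem_singleton_iff]
    grind
  · intro i j _
    simp only [isolate, inCliques, Set.mem_singleton_iff]
    grind
  · rw [hU₁]
    rw [hU₁] at hd
    exact edgeDepthGE_inCliques (hl A subset_rfl haA) (hr A subset_rfl)
      (by rw [hI A subset_rfl, Finset.card_singleton]; omega)
  · rw [hU₂]
    rw [hU₂] at hcU
    exact edgeDepthGE_inCliques_of_disjoint (hAB.mono_left (Finset.erase_subset _ _)) ⟨a, ha⟩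
      ⟨w, hw⟩ (by omega)
  · rw [hU₃]
    rw [hU₃] at hcU
    exact edgeDepthGE_inCliques (hl _ (Finset.erase_subset _ _) ha)
      (hr _ (Finset.erase_subset _ _))
      (by rw [hI _ (Finset.erase_subset _ _), Finset.card_singleton]; omega)

end Cliques

/-! ### Upper bounds for the Krull dimension -/

section Dimension

lemma ringKrullDim_le_of_isIntegral {A B : Type*} [CommRing A] [CommRing B] [Algebra A B]
    [Algebra.IsIntegral A B] : ringKrullDim B ≤ ringKrullDim A :=
  Order.krullDim_le_of_strictMono (PrimeSpectrum.comap (algebraMap A B)) fun _ _ h ↦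
    Ideal.IsIntegral.comap_lt_comap h

/-- The dimension of a finitely generated domain over a field is at most the number of generators
of its field of fractions. -/
lemma ringKrullDim_le_of_adjoin_eq_top {K : Type*} [Field K] {D L : Type*} [CommRing D]
    [IsDomain D] [Algebra K D] [Algebra.FiniteType K D] [Field L] [Algebra K L] [Algebra D L]
    [IsScalarTower K D L] [FaithfulSMul D L] {s : Finset L}
    (hs : IntermediateField.adjoin K (s : Set L) = ⊤) : ringKrullDim D ≤ s.card := by
  -- By Noether normalization `D` is integral over a polynomial ring in `m` variables, so `dim D ≤
  -- m`. These variables are algebraically independent in `L`, so `m` is at most its transcendence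
  -- degree, hence at most `|s|`.
  obtain ⟨m, g, hg, hint⟩ := exists_integral_inj_algHom_of_fg K D
  algebraize [g.toRingHom]
  have : Algebra.IsIntegral (MvPolynomial (Fin m) K) D := ⟨hint⟩
  have h₁ : ringKrullDim D ≤ m := by
    refine (ringKrullDim_le_of_isIntegral (A := MvPolynomial (Fin m) K)).trans ?_
    simp
  have halg : Algebra.IsAlgebraic (Algebra.adjoin K (s : Set L)) L := by
    refine ⟨fun z ↦ ?_⟩
    have hz : z ∈ IntermediateField.adjoin K (s : Set L) := hs ▸ trivial
    obtain ⟨a, ha, b, hb, rfl⟩ := IntermediateField.mem_adjoin_iff_div.mp hz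
    rw [div_eq_mul_inv]
    exact (isAlgebraic_algebraMap (⟨a, ha⟩ : Algebra.adjoin K (s : Set L))).mul
      (isAlgebraic_algebraMap (⟨b, hb⟩ : Algebra.adjoin K (s : Set L))).inv
  have h₂ := Algebra.IsAlgebraic.trdeg_le_cardinalMk K (s : Set L)
  have h₃ := lift_trdeg_le_of_injective ((IsScalarTower.toAlgHom K D L).comp g)
    ((FaithfulSMul.algebraMap_injective D L).comp hg)
  rw [MvPolynomial.trdeg_of_isDomain] at h₃
  have h₄ : m ≤ s.card := by
    have h₅ := h₃.trans (Cardinal.lift_le.mpr h₂)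
    simpa using h₅
  exact h₁.trans (by exact_mod_cast h₄)

/-- A chain of primes survives in the quotient by its smallest member. -/
lemma ringKrullDim_le_of_forall_isPrime {R : Type*} [CommRing R] {N : WithBot ℕ∞}
    (h : ∀ P : Ideal R, P.IsPrime → ringKrullDim (R ⧸ P) ≤ N) : ringKrullDim R ≤ N := by
  refine iSup_le fun l ↦ ?_
  refine le_trans ?_ (h l.head.asIdeal l.head.isPrime)
  rw [ringKrullDim_quotient]
  let l' : LTSeries (PrimeSpectrum.zeroLocus (l.head.asIdeal : Set R)) :=
    { length := l.length
      toFun := fun i ↦ ⟨l i, LTSeries.head_le l i⟩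
      step := l.step }
  exact Order.LTSeries.length_le_krullDim l'

section Field

variable {K L : Type*} [Field K] [Field L] [Algebra K L]

/-- Consecutive proportional pairs in a field are generated by one element more than their
number. -/
lemma exists_finset_adjoin_of_chain (x y : ℕ → L) (p m : ℕ)
    (h : ∀ i, p ≤ i → i + 1 < p + m → x i * y (i + 1) = x (i + 1) * y i) :
    ∃ s : Finset L, s.card ≤ m + 1 ∧ ∀ i, p ≤ i → i < p + m →
      x i ∈ IntermediateField.adjoin K (s : Set L) ∧
        y i ∈ IntermediateField.adjoin K (s : Set L) := by
  classical
  obtain _ | m := m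
  · exact ⟨∅, by simp, fun i hi hi' ↦ by omega⟩
  -- After a zero pair the next pair is unconstrained and needs two generators. The strengthened
  -- claim records that a zero last pair saves one generator, which pays for this.
  suffices ∃ s : Finset L, s.card ≤ m + 2 ∧ (x (p + m) = 0 → y (p + m) = 0 → s.card ≤ m + 1) ∧
      ∀ i, p ≤ i → i < p + (m + 1) → x i ∈ IntermediateField.adjoin K (s : Set L) ∧
        y i ∈ IntermediateField.adjoin K (s : Set L) by
    obtain ⟨s, h₁, -, h₂⟩ := this
    exact ⟨s, h₁, h₂⟩
  have hsub : ∀ s : Set L, s ⊆ IntermediateField.adjoin K s := fun s ↦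
    IntermediateField.subset_adjoin K s
  induction m with
  | zero =>
    have hi : ∀ i, p ≤ i → i < p + (0 + 1) → i = p + 0 := fun i h h' ↦ by omega
    by_cases h0 : x p = 0 ∧ y p = 0
    · refine ⟨∅, by simp, fun _ _ ↦ by simp, fun i h h' ↦ ?_⟩
      rw [hi i h h', Nat.add_zero, h0.1, h0.2]
      exact ⟨zero_mem _, zero_mem _⟩
    · refine ⟨{x p, y p}, Finset.card_le_two, fun h h' ↦ (h0 ⟨h, h'⟩).elim, fun i h h' ↦ ?_⟩
      rw [hi i h h']
      exact ⟨hsub _ (by simp), hsub _ (by simp)⟩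
  | succ m ih =>
    obtain ⟨s, hs₁, hs₂, hs⟩ := ih fun i hi hi' ↦ h i hi (by omega)
    have hlast := hs (p + m) (by omega) (by omega)
    have hrel := h (p + m) (by omega) (by omega)
    have hmono : ∀ t : Finset L, s ⊆ t → IntermediateField.adjoin K (s : Set L) ≤
        IntermediateField.adjoin K (t : Set L) := fun t ht ↦
      IntermediateField.adjoin.mono K _ _ (Finset.coe_subset.mpr ht)
    have hext : ∀ t : Finset L, s ⊆ t →
        x (p + (m + 1)) ∈ IntermediateField.adjoin K (t : Set L) →
        y (p + (m + 1)) ∈ IntermediateField.adjoin K (t : Set L) →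
        ∀ i, p ≤ i → i < p + (m + 1 + 1) → x i ∈ IntermediateField.adjoin K (t : Set L) ∧
          y i ∈ IntermediateField.adjoin K (t : Set L) := by
      intro t ht hx hy i hi hi'
      by_cases him : i = p + (m + 1)
      · rw [him]; exact ⟨hx, hy⟩
      · obtain ⟨h₁, h₂⟩ := hs i hi (by omega)
        exact ⟨hmono t ht h₁, hmono t ht h₂⟩
    by_cases h0 : x (p + (m + 1)) = 0 ∧ y (p + (m + 1)) = 0
    · refine ⟨s, by omega, fun _ _ ↦ hs₁, hext s subset_rfl ?_ ?_⟩
      · rw [h0.1]; exact zero_mem _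
      · rw [h0.2]; exact zero_mem _
    by_cases hx0 : x (p + m) = 0
    · by_cases hy0 : y (p + m) = 0
      · refine ⟨insert (x (p + (m + 1))) (insert (y (p + (m + 1))) s), ?_,
          fun h h' ↦ (h0 ⟨h, h'⟩).elim, hext _ ?_ (hsub _ (by simp)) (hsub _ (by simp))⟩
        · refine (Finset.card_insert_le _ _).trans (Nat.succ_le_succ ?_)
          exact (Finset.card_insert_le _ _).trans (Nat.succ_le_succ (hs₂ hx0 hy0))
        · exact (Finset.subset_insert _ _).trans (Finset.subset_insert _ _)
      · refine ⟨insert (y (p + (m + 1))) s, (Finset.card_insert_le _ _).trans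
          (Nat.succ_le_succ hs₁), fun h h' ↦ (h0 ⟨h, h'⟩).elim,
          hext _ (Finset.subset_insert _ _) ?_ (hsub _ (by simp))⟩
        have : x (p + (m + 1)) = x (p + m) * y (p + (m + 1)) / y (p + m) := by
          rw [eq_div_iff hy0]; exact hrel.symm
        rw [this]
        exact div_mem (mul_mem (hmono _ (Finset.subset_insert _ _) hlast.1) (hsub _ (by simp)))
          (hmono _ (Finset.subset_insert _ _) hlast.2)
    · refine ⟨insert (x (p + (m + 1))) s, (Finset.card_insert_le _ _).trans
        (Nat.succ_le_succ hs₁), fun h h' ↦ (h0 ⟨h, h'⟩).elim,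
        hext _ (Finset.subset_insert _ _) (hsub _ (by simp)) ?_⟩
      have : y (p + (m + 1)) = x (p + (m + 1)) * y (p + m) / x (p + m) := by
        rw [eq_div_iff hx0, mul_comm]; exact hrel
      rw [this]
      exact div_mem (mul_mem (hsub _ (by simp)) (hmono _ (Finset.subset_insert _ _) hlast.2))
        (hmono _ (Finset.subset_insert _ _) hlast.1)

lemma exists_finset_adjoin_of_chains (x y : ℕ → L) (l : List (ℕ × ℕ))
    (h : ∀ b ∈ l, ∀ i, b.1 ≤ i → i + 1 < b.1 + b.2 → x i * y (i + 1) = x (i + 1) * y i) :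
    ∃ s : Finset L, s.card ≤ (l.map fun b ↦ b.2 + 1).sum ∧
      ∀ b ∈ l, ∀ i, b.1 ≤ i → i < b.1 + b.2 → x i ∈ IntermediateField.adjoin K (s : Set L) ∧
        y i ∈ IntermediateField.adjoin K (s : Set L) := by
  classical
  induction l with
  | nil => exact ⟨∅, by simp, by simp⟩
  | cons b l ih =>
    obtain ⟨s, hs, hs'⟩ := ih fun b hb ↦ h b (List.mem_cons_of_mem _ hb)
    obtain ⟨t, ht, ht'⟩ := exists_finset_adjoin_of_chain (K := K) x y b.1 b.2
      (h b List.mem_cons_self)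
    have hmono : ∀ u : Finset L, u ⊆ t ∪ s → IntermediateField.adjoin K (u : Set L) ≤
        IntermediateField.adjoin K ((t ∪ s : Finset L) : Set L) := fun u hu ↦
      IntermediateField.adjoin.mono K _ _ (Finset.coe_subset.mpr hu)
    refine ⟨t ∪ s, (Finset.card_union_le _ _).trans ?_, ?_⟩
    · rw [List.map_cons, List.sum_cons]
      exact Nat.add_le_add ht hs
    · intro c hc i hi hi'
      rcases List.mem_cons.mp hc with rfl | hc
      · exact (ht' i hi hi').imp (fun h ↦ hmono t Finset.subset_union_left h)
          fun h ↦ hmono t Finset.subset_union_left h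
      · exact (hs' c hc i hi hi').imp (fun h ↦ hmono s Finset.subset_union_right h)
          fun h ↦ hmono s Finset.subset_union_right h

end Field

/-- If `𝔞` contains the minors of consecutive vertices inside some blocks of consecutive vertices,
and the variables of the vertices outside the blocks, then the dimension of the quotient by `𝔞` is
at most the number of the vertices in the blocks plus the number of the blocks. -/
lemma ringKrullDim_quotient_le_of_blocks {K : Type*} [Field K] {n : ℕ}
    {𝔞 : Ideal (MvPolynomial (Fin n ⊕ Fin n) K)} (l : List (ℕ × ℕ))
    (hl : ∀ b ∈ l, ∀ i j : Fin n, b.1 ≤ (i : ℕ) → (j : ℕ) = i + 1 → (j : ℕ) < b.1 + b.2 →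
      minor K i j ∈ 𝔞)
    (hT : ∀ i : Fin n, (∃ b ∈ l, b.1 ≤ (i : ℕ) ∧ (i : ℕ) < b.1 + b.2) ∨
      (X (Sum.inl i) ∈ 𝔞 ∧ X (Sum.inr i) ∈ 𝔞)) :
    ringKrullDim (MvPolynomial (Fin n ⊕ Fin n) K ⧸ 𝔞) ≤ ((l.map fun b ↦ b.2 + 1).sum : ℕ) := by
  refine ringKrullDim_le_of_forall_isPrime fun P hP ↦ ?_
  let S := MvPolynomial (Fin n ⊕ Fin n) K
  let D := (S ⧸ 𝔞) ⧸ P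
  let L := FractionRing D
  let φ : S →ₐ[K] L := (IsScalarTower.toAlgHom K D L).comp
    ((Ideal.Quotient.mkₐ K P).comp (Ideal.Quotient.mkₐ K 𝔞))
  have hφ : ∀ f ∈ 𝔞, φ f = 0 := fun f hf ↦ by
    have : Ideal.Quotient.mk 𝔞 f = 0 := Ideal.Quotient.eq_zero_iff_mem.mpr hf
    change algebraMap D L (Ideal.Quotient.mk P (Ideal.Quotient.mk 𝔞 f)) = 0
    rw [this, map_zero, map_zero]
  -- Extension by 0 makes the relations beyond the last vertex trivially true.
  let x : ℕ → L := fun i ↦ if h : i < n then φ (X (Sum.inl ⟨i, h⟩)) else 0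
  let y : ℕ → L := fun i ↦ if h : i < n then φ (X (Sum.inr ⟨i, h⟩)) else 0
  have hx : ∀ i : Fin n, x i = φ (X (Sum.inl i)) := fun i ↦ dif_pos i.2
  have hy : ∀ i : Fin n, y i = φ (X (Sum.inr i)) := fun i ↦ dif_pos i.2
  obtain ⟨s, hs, hs'⟩ := exists_finset_adjoin_of_chains (K := K) x y l fun b hb i hi hi' ↦ by
    by_cases hn : i + 1 < n
    · have h₁ := hφ _ (hl b hb ⟨i, by omega⟩ ⟨i + 1, hn⟩ hi rfl hi')
      rw [minor, map_sub, map_mul, map_mul, sub_eq_zero, ← hx, ← hy, ← hx, ← hy] at h₁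
      exact h₁
    · have hx0 : x (i + 1) = 0 := dif_neg hn
      have hy0 : y (i + 1) = 0 := dif_neg hn
      rw [hx0, hy0, mul_zero, zero_mul]
  have hmem : ∀ u, φ (X u) ∈ IntermediateField.adjoin K (s : Set L) := by
    rintro (i | i) <;> rcases hT i with ⟨b, hb, hi, hi'⟩ | h
    · rw [← hx]; exact (hs' b hb i hi hi').1
    · rw [hφ _ h.1]; exact zero_mem _
    · rw [← hy]; exact (hs' b hb i hi hi').2
    · rw [hφ _ h.2]; exact zero_mem _
  have hmem' : ∀ f, φ f ∈ IntermediateField.adjoin K (s : Set L) := fun f ↦ by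
    induction f using MvPolynomial.induction_on with
    | C a =>
      rw [← algebraMap_eq, AlgHom.commutes]
      exact IntermediateField.algebraMap_mem _ a
    | add p q hp hq => rw [map_add]; exact add_mem hp hq
    | mul_X p u hp => rw [map_mul]; exact mul_mem hp (hmem u)
  have htop : IntermediateField.adjoin K (s : Set L) = ⊤ := by
    refine top_le_iff.mp fun z _ ↦ ?_
    obtain ⟨a, b, -, rfl⟩ := IsFractionRing.div_surjective (A := D) z
    obtain ⟨a, rfl⟩ := Ideal.Quotient.mk_surjective a
    obtain ⟨a, rfl⟩ := Ideal.Quotient.mk_surjective a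
    obtain ⟨b, rfl⟩ := Ideal.Quotient.mk_surjective b
    obtain ⟨b, rfl⟩ := Ideal.Quotient.mk_surjective b
    exact div_mem (hmem' a) (hmem' b)
  refine (ringKrullDim_le_of_adjoin_eq_top (K := K) (D := D) (L := L) htop).trans ?_
  exact_mod_cast hs

end Dimension

/-! ### Regularity of polynomials with nonzero constant term -/

section Homogeneous

attribute [local instance] MvPolynomial.gradedAlgebra

variable {K : Type*} [Field K] {σ : Type*}

lemma mem_idealOfVars_of_constantCoeff {a : MvPolynomial σ K} (ha : constantCoeff a = 0) :
    a ∈ idealOfVars σ K := by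
  rw [← pow_one (idealOfVars σ K), mem_pow_idealOfVars_iff']
  intro x hx
  rw [(Finsupp.degree_eq_zero_iff x).mp (by omega), ← constantCoeff_eq, ha]

/-- The polynomials with a nonzero constant term are regular modulo a homogeneous ideal. -/
lemma mem_of_mul_mem_of_notMem_idealOfVars {I : Ideal (MvPolynomial σ K)}
    (hI : I.IsHomogeneous (homogeneousSubmodule σ K)) {a w : MvPolynomial σ K}
    (ha : a ∉ idealOfVars σ K) (h : a * w ∈ I) : w ∈ I := by
  have hc : constantCoeff a ≠ 0 := fun h0 ↦ ha (mem_idealOfVars_of_constantCoeff h0)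
  set c := constantCoeff a with hcdef
  -- From `w = c⁻¹ (a w - (a - c) w)` with `a - c` in the maximal ideal, `w` lies in `I` plus every
  -- power of that ideal. Homogeneity of `I` then recovers `w` degree by degree.
  have hpow : ∀ k, w ∈ I ⊔ idealOfVars σ K ^ k := by
    intro k
    induction k with
    | zero => rw [pow_zero, Ideal.one_eq_top, sup_top_eq]; trivial
    | succ k ih =>
      have ha' : a - C c ∈ idealOfVars σ K :=
        mem_idealOfVars_of_constantCoeff (by rw [map_sub, constantCoeff_C, sub_self])
      have h₁ : (a - C c) * w ∈ I ⊔ idealOfVars σ K ^ (k + 1) := by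
        rw [pow_succ']
        have := Ideal.mul_mem_mul ha' ih
        rw [Ideal.mul_sup] at this
        exact (sup_le (Ideal.mul_le_right.trans le_sup_left) le_sup_right :
          idealOfVars σ K * I ⊔ idealOfVars σ K * idealOfVars σ K ^ k ≤ _) this
      have h₂ : w = C c⁻¹ * (a * w - (a - C c) * w) := by
        rw [← sub_mul, sub_sub_cancel, ← mul_assoc, ← C_mul, inv_mul_cancel₀ hc, C_1, one_mul]
      rw [h₂]
      exact Ideal.mul_mem_left _ _ (sub_mem (Ideal.mem_sup_left h) h₁)
  refine (mem_iff_homogeneousComponent_mem hI _).mpr fun i ↦ ?_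
  obtain ⟨j, hj, z, hz, rfl⟩ := Submodule.mem_sup.mp (hpow (i + 1))
  have hz0 : homogeneousComponent i z = 0 := by
    ext m
    rw [coeff_homogeneousComponent, coeff_zero]
    split_ifs with hm
    · exact (mem_pow_idealOfVars_iff' _ _).mp hz m (by omega)
    · rfl
  rw [map_add, hz0, add_zero]
  exact homogeneousComponent_mem_of_mem hI hj i

lemma isHomogeneous_edgeIdeal {V : Type*} {Z : Set (V ⊕ V)} {r : V → V → Prop} :
    (edgeIdeal K Z r).IsHomogeneous (homogeneousSubmodule (V ⊕ V) K) := by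
  rw [edgeIdeal, ← Ideal.span_union]
  refine Ideal.homogeneous_span _ _ ?_
  rintro f (⟨u, -, rfl⟩ | ⟨i, j, -, rfl⟩)
  · exact ⟨1, isHomogeneous_X K u⟩
  · exact ⟨2, ((isHomogeneous_X K _).mul (isHomogeneous_X K _)).sub
      ((isHomogeneous_X K _).mul (isHomogeneous_X K _))⟩

end Homogeneous

/-! ### Witnesses for upper bounds of the depth -/

section DepthBounds

variable {K : Type*} [Field K] {V : Type*} {Z : Set (V ⊕ V)} {r : V → V → Prop}

/-- The prime ideal of the configurations in which the vertices in `T` are mapped to `0` and the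
other vertices to multiples of a vector that depends on their label. -/
noncomputable def labelIdeal (K : Type*) [Field K] {V ι : Type*} (T : Set V) (c : V → ι) :
    Ideal (MvPolynomial (V ⊕ V) K) :=
  RingHom.ker ((par K c).comp (killVars K (varsOf T)))

instance {ι : Type*} (T : Set V) (c : V → ι) : (labelIdeal K T c).IsPrime :=
  RingHom.ker_isPrime _

lemma minor_mem_labelIdeal_iff {ι : Type*} {T : Set V} {c : V → ι} {i j : V} (hi : i ∉ T)
    (hj : j ∉ T) : minor K i j ∈ labelIdeal K T c ↔ c i = c j := by
  rw [labelIdeal, RingHom.mem_ker, AlgHom.comp_apply, killVars_minor hi hi hj hj, par_minor,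
    mul_eq_zero, sub_eq_zero, X_inj, Sum.inr_injective.eq_iff, mul_eq_zero]
  have hX : ∀ u : V ⊕ ι, (X u : MvPolynomial (V ⊕ ι) K) ≠ 0 := fun u ↦ X_ne_zero u
  simp only [hX, or_self, false_or]
  exact eq_comm

lemma edgeIdeal_le_labelIdeal {ι : Type*} {T : Set V} {c : V → ι} (hZ : Z ⊆ varsOf T)
    (hr : ∀ i j, r i j → i ∉ T → j ∉ T → c i = c j) : edgeIdeal K Z r ≤ labelIdeal K T c := by
  have hX : ∀ u ∈ varsOf T, X u ∈ labelIdeal K T c := fun u hu ↦ by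
    rw [labelIdeal, RingHom.mem_ker, AlgHom.comp_apply, killVars_X_of_mem hu, map_zero]
  refine edgeIdeal_le_iff.mpr ⟨fun u hu ↦ hX u (hZ hu), fun i j hij ↦ ?_⟩
  by_cases hi : i ∈ T
  · exact minor_mem_of_left (hX _ hi) (hX _ hi)
  by_cases hj : j ∈ T
  · exact minor_mem_of_right (hX _ hj) (hX _ hj)
  exact (minor_mem_labelIdeal_iff hi hj).mpr (hr i j hij hi hj)

/-- Plücker relation: with `[i j]` for the minor, `x_t [l r] = x_r [l t] + x_l [t r]`, and likewise
with `y`. A common neighbour of `l` and `r` therefore kills their minor. -/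
lemma X_mul_minor_mem {I : Ideal (MvPolynomial (V ⊕ V) K)} {l t r : V} (hl : minor K l t ∈ I)
    (hr : minor K t r ∈ I) {u : V ⊕ V} (hu : u ∈ varsOf {t}) : X u * minor K l r ∈ I := by
  obtain ⟨a, b, h⟩ : ∃ a b, X u * minor K l r = a * minor K l t + b * minor K t r := by
    obtain u | u := u <;> obtain rfl : u = t := hu
    · exact ⟨X (Sum.inl r), X (Sum.inl l), by unfold minor; ring⟩
    · exact ⟨X (Sum.inr r), X (Sum.inr l), by unfold minor; ring⟩
  rw [h]
  exact add_mem (Ideal.mul_mem_left _ _ hl) (Ideal.mul_mem_left _ _ hr)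

lemma X_mul_X_mul_minor_mem {I : Ideal (MvPolynomial (V ⊕ V) K)} {l t t' r : V}
    (hl : minor K l t ∈ I) (ht : minor K t t' ∈ I) (hr : minor K t' r ∈ I) {u u' : V ⊕ V}
    (hu : u ∈ varsOf {t}) (hu' : u' ∈ varsOf {t'}) : X u * X u' * minor K l r ∈ I := by
  obtain ⟨a, b, c, h⟩ : ∃ a b c, X u * X u' * minor K l r
      = a * minor K l t + b * minor K t t' + c * minor K t' r := by
    obtain u | u := u <;> obtain u' | u' := u' <;> obtain rfl : u = t := hu <;>
      obtain rfl : u' = t' := hu'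
    · exact ⟨X (Sum.inl r) * X (Sum.inl u'), X (Sum.inl r) * X (Sum.inl l),
        X (Sum.inl u) * X (Sum.inl l), by unfold minor; ring⟩
    · exact ⟨X (Sum.inr r) * X (Sum.inl u'), X (Sum.inr r) * X (Sum.inl l),
        X (Sum.inl u) * X (Sum.inr l), by unfold minor; ring⟩
    · exact ⟨X (Sum.inl r) * X (Sum.inr u'), X (Sum.inl r) * X (Sum.inr l),
        X (Sum.inr u) * X (Sum.inl l), by unfold minor; ring⟩
    · exact ⟨X (Sum.inr r) * X (Sum.inr u'), X (Sum.inr r) * X (Sum.inr l),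
        X (Sum.inr u) * X (Sum.inr l), by unfold minor; ring⟩
  rw [h]
  exact add_mem (add_mem (Ideal.mul_mem_left _ _ hl) (Ideal.mul_mem_left _ _ ht))
    (Ideal.mul_mem_left _ _ hr)

variable [Finite V]

instance isPrime_idealOfVars {σ : Type*} : (idealOfVars σ K).IsPrime := by
  have h : idealOfVars σ K = RingHom.ker (constantCoeff (R := K) (σ := σ)) :=
    le_antisymm (Ideal.span_le.mpr (by rintro _ ⟨u, rfl⟩; exact constantCoeff_X (R := K) u))
      fun a ha ↦ mem_idealOfVars_of_constantCoeff ha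
  rw [h]
  exact RingHom.ker_isPrime _

/-- Homogeneity of the edge ideal places the annihilator of any nonzero class inside the maximal
ideal, so `w ∉ J` is all that has to be checked. -/
lemma DepthGE.le_ringKrullDim_of_edgeIdeal {𝔞 : Ideal (MvPolynomial (V ⊕ V) K)}
    {w : MvPolynomial (V ⊕ V) K} (hw : w ∉ edgeIdeal K Z r)
    (h𝔞 : ∀ a ∈ 𝔞, a * w ∈ edgeIdeal K Z r) {d : ℕ}
    (hd : DepthGE (idealOfVars (V ⊕ V) K) (MvPolynomial (V ⊕ V) K ⧸ edgeIdeal K Z r) d) :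
    (d : WithBot ℕ∞) ≤ ringKrullDim (MvPolynomial (V ⊕ V) K ⧸ 𝔞) :=
  hd.le_ringKrullDim edgeIdeal_le_idealOfVars h𝔞 fun _ ha ↦ by
    by_contra h
    exact hw (mem_of_mul_mem_of_notMem_idealOfVars isHomogeneous_edgeIdeal h ha)

lemma DepthGE.le_ringKrullDim_self
    {d : ℕ} (hd : DepthGE (idealOfVars (V ⊕ V) K) (MvPolynomial (V ⊕ V) K ⧸ edgeIdeal K Z r) d) :
    (d : WithBot ℕ∞) ≤ ringKrullDim (MvPolynomial (V ⊕ V) K ⧸ edgeIdeal K Z r) :=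
  hd.le_ringKrullDim_of_edgeIdeal (w := 1)
    (fun h ↦ idealOfVars_ne_top ((Ideal.eq_top_iff_one _).mpr (edgeIdeal_le_idealOfVars h)))
    fun a ha ↦ by rwa [mul_one]

lemma DepthGE.le_gradedDepth {J : Ideal (MvPolynomial V K)} (hJ : J ≤ idealOfVars V K) {d : ℕ}
    (hd : DepthGE (idealOfVars V K) (MvPolynomial V K ⧸ J) d) :
    (d : ℕ∞) ≤ gradedDepth V K (MvPolynomial V K ⧸ J) := by
  have hM := smul_top_quotient_lt_top hJ idealOfVars_ne_top
  obtain ⟨rs, rfl, hmem, hreg⟩ := hd.exists_isRegular hM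
  exact le_iSup_of_le ⟨rs, hmem, hreg⟩ le_rfl

lemma gradedDepth_le {J : Ideal (MvPolynomial V K)} (hJ : J ≤ idealOfVars V K) {N : ℕ∞}
    (h : ∀ d : ℕ, DepthGE (idealOfVars V K) (MvPolynomial V K ⧸ J) d → (d : ℕ∞) ≤ N) :
    gradedDepth V K (MvPolynomial V K ⧸ J) ≤ N := by
  have hM := smul_top_quotient_lt_top hJ idealOfVars_ne_top
  exact iSup_le fun rs ↦ h _ (DepthGE.of_isRegular hM rs.2.1 rs.2.2)

end DepthBounds

/-! ### Depth bounds from separating sets of vertices -/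

section BreakBounds

variable {K : Type*} [Field K]

lemma mul_mem_of_mem_edgeIdeal {V : Type*} {Z : Set (V ⊕ V)} {r : V → V → Prop}
    {I : Ideal (MvPolynomial (V ⊕ V) K)} {w a : MvPolynomial (V ⊕ V) K}
    (hZ : ∀ u ∈ Z, X u * w ∈ I) (hr : ∀ i j, r i j → minor K i j * w ∈ I)
    (ha : a ∈ edgeIdeal K Z r) : a * w ∈ I := by
  have h : edgeIdeal K Z r ≤ I.colon {w} :=
    edgeIdeal_le_iff.mpr ⟨fun u hu ↦ Submodule.mem_colon_singleton.mpr (hZ u hu),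
      fun i j hij ↦ Submodule.mem_colon_singleton.mpr (hr i j hij)⟩
  exact Submodule.mem_colon_singleton.mp (h ha)

variable {n : ℕ} {G : SimpleGraph (Fin n)}

/-- The vertices strictly between `l` and `r` separate the vertices up to `l` from those from `r`
on, and are all adjacent to `l` and to `r`. -/
structure IsBreak (G : SimpleGraph (Fin n)) (l r : Fin n) : Prop where
  lt : l < r
  adj_left : ∀ t, l < t → t < r → G.Adj l t
  adj_right : ∀ t, l < t → t < r → G.Adj t r
  not_adj : ∀ i j, i ≤ l → r ≤ j → ¬ G.Adj i j

lemma IsBreak.X_mul_minor_mem {l r : Fin n} (h : IsBreak G l r) {Z : Set (Fin n ⊕ Fin n)}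
    {u : Fin n ⊕ Fin n} (hu : u ∈ varsOf (Set.Ioo l r)) :
    X u * minor K l r ∈ edgeIdeal K Z G.Adj :=
  _root_.X_mul_minor_mem (t := u.elim id id) (minor_mem_edgeIdeal (h.adj_left _ hu.1 hu.2))
    (minor_mem_edgeIdeal (h.adj_right _ hu.1 hu.2)) rfl

/-- The minor of `l` and `r` is nonzero modulo `J`, since `l` and `r` lie on different sides once
the separator is deleted, and it is killed by the variables of the separator. What remains are two
blocks of consecutive vertices, each adding one to the number of its vertices. -/
lemma depthGE_le_of_isBreak (hpath : ∀ i j : Fin n, (j : ℕ) = i + 1 → G.Adj i j) {l r : Fin n}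
    (h : IsBreak G l r) {d : ℕ}
    (hd : DepthGE (idealOfVars (Fin n ⊕ Fin n) K)
      (MvPolynomial (Fin n ⊕ Fin n) K ⧸ edgeIdeal K ∅ G.Adj) d) :
    d + r ≤ n + l + 3 := by
  have hlr : (l : ℕ) < r := h.lt
  have hr := r.isLt
  have hle : edgeIdeal K ∅ G.Adj ≤ labelIdeal K (Set.Ioo l r) (fun i ↦ i ≤ l) := by
    refine edgeIdeal_le_labelIdeal (Set.empty_subset _) fun i j hij hi hj ↦ ?_
    rw [Set.mem_Ioo, not_and, not_lt] at hi hj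
    refine propext ⟨fun h₁ ↦ ?_, fun h₁ ↦ ?_⟩ <;> by_contra h₂
    · exact h.not_adj i j h₁ (hj (not_le.mp h₂)) hij
    · exact h.not_adj j i h₁ (hi (not_le.mp h₂)) hij.symm
  have hw : minor K l r ∉ edgeIdeal K ∅ G.Adj := fun hw ↦ by
    have := (minor_mem_labelIdeal_iff (by simp) (by simp)).mp (hle hw)
    exact absurd (this.mp le_rfl) (not_le.mpr h.lt)
  have h₁ := hd.le_ringKrullDim_of_edgeIdeal hw
    (𝔞 := edgeIdeal K (varsOf (Set.Ioo l r)) G.Adj) fun a ha ↦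
      mul_mem_of_mem_edgeIdeal (fun u hu ↦ h.X_mul_minor_mem hu)
        (fun i j hij ↦ Ideal.mul_mem_right _ _ (minor_mem_edgeIdeal hij)) ha
  have h₂ := ringKrullDim_quotient_le_of_blocks (K := K)
    (𝔞 := edgeIdeal K (varsOf (Set.Ioo l r)) G.Adj) [(0, (l : ℕ) + 1), ((r : ℕ), n - r)]
    (fun _ _ i j _ hij _ ↦ minor_mem_edgeIdeal (hpath i j hij)) fun i ↦ by
      by_cases hi : i ∈ Set.Ioo l r
      · exact Or.inr ⟨X_mem_edgeIdeal hi, X_mem_edgeIdeal hi⟩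
      · rw [Set.mem_Ioo, Fin.lt_def, Fin.lt_def] at hi
        have := i.isLt
        refine Or.inl ?_
        simp only [List.mem_cons, List.not_mem_nil, or_false, exists_eq_or_imp, exists_eq_left]
        omega
  have h₃ := h₁.trans h₂
  simp only [List.map_cons, List.map_nil, List.sum_cons, List.sum_nil] at h₃
  have h₄ : d ≤ l + 1 + 1 + (n - r + 1 + 0) := by exact_mod_cast h₃
  omega

/-- Here the product of the two minors is the witness. It avoids a prime containing `J` whose labels
record the side of each break, and three blocks remain after both separators are killed. -/
lemma depthGE_le_of_isBreak_of_isBreak (hpath : ∀ i j : Fin n, (j : ℕ) = i + 1 → G.Adj i j)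
    {l r l' r' : Fin n} (h : IsBreak G l r) (h' : IsBreak G l' r') (hrl : r ≤ l') {d : ℕ}
    (hd : DepthGE (idealOfVars (Fin n ⊕ Fin n) K)
      (MvPolynomial (Fin n ⊕ Fin n) K ⧸ edgeIdeal K ∅ G.Adj) d) :
    d + r + r' ≤ n + l + l' + 5 := by
  have hlr : (l : ℕ) < r := h.lt
  have hlr' : (l' : ℕ) < r' := h'.lt
  have hrl' : (r : ℕ) ≤ l' := hrl
  have hr := r'.isLt
  set T := Set.Ioo l r ∪ Set.Ioo l' r' with hT
  have hle : edgeIdeal K ∅ G.Adj ≤ labelIdeal K T (fun i ↦ (i ≤ l, i ≤ l')) := by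
    refine edgeIdeal_le_labelIdeal (Set.empty_subset _) fun i j hij hi hj ↦ ?_
    rw [hT, Set.mem_union, not_or, Set.mem_Ioo, Set.mem_Ioo, not_and, not_and, not_lt, not_lt]
      at hi hj
    refine Prod.ext (propext ⟨fun h₁ ↦ ?_, fun h₁ ↦ ?_⟩) (propext ⟨fun h₁ ↦ ?_, fun h₁ ↦ ?_⟩) <;>
      by_contra h₂
    · exact h.not_adj i j h₁ (hj.1 (not_le.mp h₂)) hij
    · exact h.not_adj j i h₁ (hi.1 (not_le.mp h₂)) hij.symm
    · exact h'.not_adj i j h₁ (hj.2 (not_le.mp h₂)) hij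
    · exact h'.not_adj j i h₁ (hi.2 (not_le.mp h₂)) hij.symm
  have hmem : ∀ i : Fin n, i ∉ T ↔ ¬ ((l : ℕ) < i ∧ (i : ℕ) < r) ∧ ¬ ((l' : ℕ) < i ∧ (i : ℕ) < r') :=
    fun i ↦ by rw [hT, Set.mem_union, not_or]; rfl
  have hw : minor K l r * minor K l' r' ∉ edgeIdeal K ∅ G.Adj := fun hw ↦ by
    rcases Ideal.IsPrime.mem_or_mem inferInstance (hle hw) with hw | hw
    · have := (minor_mem_labelIdeal_iff ((hmem _).mpr (by omega)) ((hmem _).mpr (by omega))).mp hw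
      exact absurd ((Prod.ext_iff.mp this).1.mp le_rfl) (not_le.mpr h.lt)
    · have := (minor_mem_labelIdeal_iff ((hmem _).mpr (by omega)) ((hmem _).mpr (by omega))).mp hw
      exact absurd ((Prod.ext_iff.mp this).2.mp le_rfl) (not_le.mpr h'.lt)
  have h₁ := hd.le_ringKrullDim_of_edgeIdeal hw (𝔞 := edgeIdeal K (varsOf T) G.Adj) fun a ha ↦
      mul_mem_of_mem_edgeIdeal (fun u hu ↦ by
          rcases hu with hu | hu
          · rw [← mul_assoc]
            exact Ideal.mul_mem_right _ _ (h.X_mul_minor_mem hu)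
          · rw [mul_left_comm]
            exact Ideal.mul_mem_left _ _ (h'.X_mul_minor_mem hu))
        (fun i j hij ↦ Ideal.mul_mem_right _ _ (minor_mem_edgeIdeal hij)) ha
  have h₂ := ringKrullDim_quotient_le_of_blocks (K := K) (𝔞 := edgeIdeal K (varsOf T) G.Adj)
    [(0, (l : ℕ) + 1), ((r : ℕ), (l' : ℕ) + 1 - r), ((r' : ℕ), n - r')]
    (fun _ _ i j _ hij _ ↦ minor_mem_edgeIdeal (hpath i j hij)) fun i ↦ by
      by_cases hi : i ∈ T
      · exact Or.inr ⟨X_mem_edgeIdeal hi, X_mem_edgeIdeal hi⟩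
      · rw [hmem] at hi
        have := i.isLt
        refine Or.inl ?_
        simp only [List.mem_cons, List.not_mem_nil, or_false, exists_eq_or_imp, exists_eq_left]
        omega
  have h₃ := h₁.trans h₂
  simp only [List.map_cons, List.map_nil, List.sum_cons, List.sum_nil] at h₃
  have h₄ : d ≤ l + 1 + 1 + (l' + 1 - r + 1 + (n - r' + 1 + 0)) := by exact_mod_cast h₃
  omega

/-- The depth bound for three overlapping cliques `[0, l + 2]`, `[l + 1, l + 4]`, `[l + 3, n)`. -/
lemma depthGE_le_of_three_cliques {l : ℕ} (hl : l + 5 < n)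
    (hG : ∀ i j : Fin n, i ≠ j → (G.Adj i j ↔ ((i : ℕ) ≤ l + 2 ∧ (j : ℕ) ≤ l + 2) ∨
      ((l + 1 ≤ (i : ℕ) ∧ (i : ℕ) ≤ l + 4) ∧ (l + 1 ≤ (j : ℕ) ∧ (j : ℕ) ≤ l + 4)) ∨
      (l + 3 ≤ (i : ℕ) ∧ l + 3 ≤ (j : ℕ)))) {d : ℕ}
    (hd : DepthGE (idealOfVars (Fin n ⊕ Fin n) K)
      (MvPolynomial (Fin n ⊕ Fin n) K ⧸ edgeIdeal K ∅ G.Adj) (d + 1)) : d + 2 ≤ n := by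
  set J := edgeIdeal K ∅ G.Adj with hJ
  obtain ⟨v₀, hv₀⟩ : ∃ v : Fin n, (v : ℕ) = l := ⟨⟨l, by omega⟩, rfl⟩
  obtain ⟨v₂, hv₂⟩ : ∃ v : Fin n, (v : ℕ) = l + 2 := ⟨⟨l + 2, by omega⟩, rfl⟩
  obtain ⟨v₃, hv₃⟩ : ∃ v : Fin n, (v : ℕ) = l + 3 := ⟨⟨l + 3, by omega⟩, rfl⟩
  obtain ⟨v₅, hv₅⟩ : ∃ v : Fin n, (v : ℕ) = l + 5 := ⟨⟨l + 5, by omega⟩, rfl⟩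
  -- `A` is the prime of the graph with `l + 1, l + 2` deleted, `B` the one with `l + 3, l + 4`
  -- deleted. Their sum deletes all four vertices and leaves two cliques, of dimension at most `(n -
  -- 4) + 2`, so the depth is at most `n - 1`.
  let rA : Fin n → Fin n → Prop := fun i j ↦
    ((i : ℕ) ≤ l ∧ (j : ℕ) ≤ l) ∨ (l + 3 ≤ (i : ℕ) ∧ l + 3 ≤ (j : ℕ))
  let rB : Fin n → Fin n → Prop := fun i j ↦
    ((i : ℕ) ≤ l + 2 ∧ (j : ℕ) ≤ l + 2) ∨ (l + 5 ≤ (i : ℕ) ∧ l + 5 ≤ (j : ℕ))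
  let rP : Fin n → Fin n → Prop := fun i j ↦
    ((i : ℕ) ≤ l ∧ (j : ℕ) ≤ l) ∨ (l + 5 ≤ (i : ℕ) ∧ l + 5 ≤ (j : ℕ))
  let TA : Set (Fin n) := {i | l + 1 ≤ (i : ℕ) ∧ (i : ℕ) ≤ l + 2}
  let TB : Set (Fin n) := {i | l + 3 ≤ (i : ℕ) ∧ (i : ℕ) ≤ l + 4}
  let TP : Set (Fin n) := {i | l + 1 ≤ (i : ℕ) ∧ (i : ℕ) ≤ l + 4}
  set A := edgeIdeal K (varsOf TA) rA with hA
  set B := edgeIdeal K (varsOf TB) rB with hB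
  have hAp : A.IsPrime := by
    refine isPrime_edgeIdeal (fun i j ↦ ?_) (fun i j k ↦ ?_) fun u hu j ↦ ?_
    · simp only [rA]; omega
    · simp only [rA]; omega
    · have hu' : l + 1 ≤ (u.elim id id : Fin n).val ∧ (u.elim id id : Fin n).val ≤ l + 2 := hu
      simp only [rA]; omega
  have hBp : B.IsPrime := by
    refine isPrime_edgeIdeal (fun i j ↦ ?_) (fun i j k ↦ ?_) fun u hu j ↦ ?_
    · simp only [rB]; omega
    · simp only [rB]; omega
    · have hu' : l + 3 ≤ (u.elim id id : Fin n).val ∧ (u.elim id id : Fin n).val ≤ l + 4 := hu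
      simp only [rB]; omega
  have hAB : A ⊔ B = edgeIdeal K (varsOf TP) rP := by
    refine le_antisymm (sup_le (edgeIdeal_le_iff.mpr ⟨fun u hu ↦ X_mem_edgeIdeal ?_, ?_⟩)
      (edgeIdeal_le_iff.mpr ⟨fun u hu ↦ X_mem_edgeIdeal ?_, ?_⟩)) (edgeIdeal_le_iff.mpr ⟨?_, ?_⟩)
    · exact ⟨hu.1, hu.2.trans (by omega)⟩
    · intro i j hij
      by_cases hi : i ∈ TP
      · exact minor_mem_of_left (X_mem_edgeIdeal hi) (X_mem_edgeIdeal hi)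
      by_cases hj : j ∈ TP
      · exact minor_mem_of_right (X_mem_edgeIdeal hj) (X_mem_edgeIdeal hj)
      simp only [TP, Set.mem_ofPred_eq] at hi hj
      simp only [rA] at hij
      exact minor_mem_edgeIdeal (by simp only [rP]; omega)
    · exact ⟨le_trans (by omega) hu.1, hu.2⟩
    · intro i j hij
      by_cases hi : i ∈ TP
      · exact minor_mem_of_left (X_mem_edgeIdeal hi) (X_mem_edgeIdeal hi)
      by_cases hj : j ∈ TP
      · exact minor_mem_of_right (X_mem_edgeIdeal hj) (X_mem_edgeIdeal hj)
      simp only [TP, Set.mem_ofPred_eq] at hi hj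
      simp only [rB] at hij
      exact minor_mem_edgeIdeal (by simp only [rP]; omega)
    · intro u hu
      rcases le_or_gt (u.elim id id : Fin n).val (l + 2) with h | h
      · exact Ideal.mem_sup_left (X_mem_edgeIdeal ⟨hu.1, h⟩)
      · exact Ideal.mem_sup_right (X_mem_edgeIdeal ⟨h, hu.2⟩)
    · rintro i j (hij | hij)
      · exact Ideal.mem_sup_left (minor_mem_edgeIdeal (Or.inl hij))
      · exact Ideal.mem_sup_right (minor_mem_edgeIdeal (Or.inr hij))
  have hPp : (A ⊔ B).IsPrime := by
    rw [hAB]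
    refine isPrime_edgeIdeal (fun i j ↦ ?_) (fun i j k ↦ ?_) fun u hu j ↦ ?_
    · simp only [rP]; omega
    · simp only [rP]; omega
    · have hu' : l + 1 ≤ (u.elim id id : Fin n).val ∧ (u.elim id id : Fin n).val ≤ l + 4 := hu
      simp only [rP]; omega
  have hGA : ∀ i j, rA i j → minor K i j ∈ J := fun i j hij ↦ by
    by_cases h : i = j
    · rw [h, minor_self]; exact zero_mem _
    · exact minor_mem_edgeIdeal ((hG i j h).mpr (by simp only [rA] at hij; omega))
  have hGB : ∀ i j, rB i j → minor K i j ∈ J := fun i j hij ↦ by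
    by_cases h : i = j
    · rw [h, minor_self]; exact zero_mem _
    · exact minor_mem_edgeIdeal ((hG i j h).mpr (by simp only [rB] at hij; omega))
  have hne : ∀ {i j : Fin n}, (i : ℕ) ≠ j → i ≠ j := fun h e ↦ h (congrArg Fin.val e)
  have hJA : J ≤ A := edgeIdeal_le_iff.mpr ⟨fun u hu ↦ hu.elim, fun i j hij ↦ by
    by_cases hi : i ∈ TA
    · exact minor_mem_of_left (X_mem_edgeIdeal hi) (X_mem_edgeIdeal hi)
    by_cases hj : j ∈ TA
    · exact minor_mem_of_right (X_mem_edgeIdeal hj) (X_mem_edgeIdeal hj)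
    rw [hG i j hij.ne] at hij
    simp only [TA, Set.mem_ofPred_eq] at hi hj
    exact minor_mem_edgeIdeal (by simp only [rA]; omega)⟩
  have hJB : J ≤ B := edgeIdeal_le_iff.mpr ⟨fun u hu ↦ hu.elim, fun i j hij ↦ by
    by_cases hi : i ∈ TB
    · exact minor_mem_of_left (X_mem_edgeIdeal hi) (X_mem_edgeIdeal hi)
    by_cases hj : j ∈ TB
    · exact minor_mem_of_right (X_mem_edgeIdeal hj) (X_mem_edgeIdeal hj)
    rw [hG i j hij.ne] at hij
    simp only [TB, Set.mem_ofPred_eq] at hi hj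
    exact minor_mem_edgeIdeal (by simp only [rB]; omega)⟩
  -- The ends of this minor are separated by the four deleted vertices. In the next two claims one
  -- of the two pairs already separates the ends.
  have hs : minor K v₀ v₅ ∉ A ⊔ B := fun h ↦ by
    have hle : A ⊔ B ≤ labelIdeal K TP (fun i : Fin n ↦ (i : ℕ) ≤ l) := by
      rw [hAB]
      exact edgeIdeal_le_labelIdeal le_rfl fun i j hij _ _ ↦
        propext (by simp only [rP] at hij; omega)
    have := (minor_mem_labelIdeal_iff (by simp only [TP, Set.mem_ofPred_eq]; omega)
      (by simp only [TP, Set.mem_ofPred_eq]; omega)).mp (hle h)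
    have := Eq.to_iff this
    omega
  have hwA : minor K v₀ v₃ ∉ J := fun h ↦ by
    have hle : A ≤ labelIdeal K TA (fun i : Fin n ↦ (i : ℕ) ≤ l) :=
      edgeIdeal_le_labelIdeal le_rfl fun i j hij _ _ ↦
        propext (by simp only [rA] at hij; omega)
    have := (minor_mem_labelIdeal_iff (by simp only [TA, Set.mem_ofPred_eq]; omega)
      (by simp only [TA, Set.mem_ofPred_eq]; omega)).mp (hle (hJA h))
    have := Eq.to_iff this
    omega
  have hwB : minor K v₂ v₅ ∉ J := fun h ↦ by
    have hle : B ≤ labelIdeal K TB (fun i : Fin n ↦ (i : ℕ) ≤ l + 2) :=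
      edgeIdeal_le_labelIdeal le_rfl fun i j hij _ _ ↦
        propext (by simp only [rB] at hij; omega)
    have := (minor_mem_labelIdeal_iff (by simp only [TB, Set.mem_ofPred_eq]; omega)
      (by simp only [TB, Set.mem_ofPred_eq]; omega)).mp (hle (hJB h))
    have := Eq.to_iff this
    omega
  have hadj : ∀ i j : Fin n, (i : ℕ) < j → (((j : ℕ) ≤ l + 2) ∨
      (l + 1 ≤ (i : ℕ) ∧ (j : ℕ) ≤ l + 4) ∨ l + 3 ≤ (i : ℕ)) → minor K i j ∈ J :=
    fun i j hij h ↦ minor_mem_edgeIdeal ((hG i j (hne hij.ne)).mpr (by omega))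
  have hwA' : ∀ a ∈ A, a * minor K v₀ v₃ ∈ J := fun a ha ↦
    mul_mem_of_mem_edgeIdeal (fun u hu ↦
      have hu' : l + 1 ≤ (u.elim id id : Fin n).val ∧ (u.elim id id : Fin n).val ≤ l + 2 := hu
      X_mul_minor_mem (t := u.elim id id) (hadj _ _ (by omega) (by omega))
        (hadj _ _ (by omega) (by omega)) rfl)
      (fun i j hij ↦ Ideal.mul_mem_right _ _ (hGA i j hij)) ha
  have hwB' : ∀ b ∈ B, b * minor K v₂ v₅ ∈ J := fun b hb ↦
    mul_mem_of_mem_edgeIdeal (fun u hu ↦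
      have hu' : l + 3 ≤ (u.elim id id : Fin n).val ∧ (u.elim id id : Fin n).val ≤ l + 4 := hu
      X_mul_minor_mem (t := u.elim id id) (hadj _ _ (by omega) (by omega))
        (hadj _ _ (by omega) (by omega)) rfl)
      (fun i j hij ↦ Ideal.mul_mem_right _ _ (hGB i j hij)) hb
  -- For variables this is the double Plücker relation along a path from `v₀` to `v₅` through one
  -- deleted vertex of each pair. The generating minors of `A` and `B` already lie in `J`.
  have hsAB : ∀ a ∈ A, ∀ b ∈ B, minor K v₀ v₅ * (a * b) ∈ J := by
    intro a ha b hb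
    rw [mul_left_comm]
    refine mul_mem_of_mem_edgeIdeal (fun u hu ↦ ?_)
      (fun i j hij ↦ Ideal.mul_mem_right _ _ (hGA i j hij)) ha
    rw [← mul_assoc, mul_comm]
    refine mul_mem_of_mem_edgeIdeal (fun u' hu' ↦ ?_)
      (fun i j hij ↦ Ideal.mul_mem_right _ _ (hGB i j hij)) hb
    have h : l + 1 ≤ (u.elim id id : Fin n).val ∧ (u.elim id id : Fin n).val ≤ l + 2 := hu
    have h' : l + 3 ≤ (u'.elim id id : Fin n).val ∧ (u'.elim id id : Fin n).val ≤ l + 4 := hu'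
    rw [← mul_assoc, mul_comm (X u')]
    exact X_mul_X_mul_minor_mem (t := u.elim id id) (t' := u'.elim id id)
      (hadj _ _ (by omega) (by omega)) (hadj _ _ (by omega) (by omega))
      (hadj _ _ (by omega) (by omega)) rfl rfl
  have h₁ := DepthGE.le_ringKrullDim_add_one hPp (by rw [hAB]; exact edgeIdeal_le_idealOfVars)
    hJA hJB hs hsAB hwA hwA' hwB hwB'
    (fun a ha w h ↦ mem_of_mul_mem_of_notMem_idealOfVars isHomogeneous_edgeIdeal ha h) hd
  have h₂ := ringKrullDim_quotient_le_of_blocks (K := K) (𝔞 := A ⊔ B)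
    [(0, l + 1), (l + 5, n - (l + 5))] (fun b hb i j hi hij hj ↦ by
      rw [hAB]
      refine minor_mem_edgeIdeal ?_
      simp only [List.mem_cons, List.not_mem_nil, or_false] at hb
      simp only [rP]
      rcases hb with rfl | rfl <;> dsimp only at hi hj <;> omega) fun i ↦ by
      by_cases hi : i ∈ TP
      · rw [hAB]
        exact Or.inr ⟨X_mem_edgeIdeal hi, X_mem_edgeIdeal hi⟩
      · simp only [TP, Set.mem_ofPred_eq] at hi
        have := i.isLt
        refine Or.inl ?_
        simp only [List.mem_cons, List.not_mem_nil, or_false, exists_eq_or_imp, exists_eq_left]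
        omega
  have h₃ := h₁.trans h₂
  simp only [List.map_cons, List.map_nil, List.sum_cons, List.sum_nil] at h₃
  have h₄ : d ≤ l + 1 + 1 + (n - (l + 5) + 1 + 0) := by exact_mod_cast h₃
  omega

lemma ringKrullDim_edgeIdeal_le (hpath : ∀ i j : Fin n, (j : ℕ) = i + 1 → G.Adj i j) :
    ringKrullDim (MvPolynomial (Fin n ⊕ Fin n) K ⧸ edgeIdeal K ∅ G.Adj) ≤ (n + 1 : ℕ) := by
  have h := ringKrullDim_quotient_le_of_blocks (K := K) (𝔞 := edgeIdeal K ∅ G.Adj) [(0, n)]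
    (fun _ _ i j _ hij _ ↦ minor_mem_edgeIdeal (hpath i j hij))
    fun i ↦ Or.inl ⟨_, List.mem_singleton_self _, Nat.zero_le _, by simp⟩
  simpa using h

/-- The ideal of the complete graph contains that of `G`, and its quotient has depth, hence
dimension, at least `n + 1`. -/
lemma le_ringKrullDim_edgeIdeal (hn : 0 < n) :
    ((n + 1 : ℕ) : WithBot ℕ∞) ≤
      ringKrullDim (MvPolynomial (Fin n ⊕ Fin n) K ⧸ edgeIdeal K ∅ G.Adj) := by
  have h : EdgeDepthGE K (Finset.univ : Finset (Fin n)) (inCliques Finset.univ Finset.univ)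
      (n + 1) := edgeDepthGE_clique ⟨⟨0, hn⟩, Finset.mem_univ _⟩ (by simp)
  refine (DepthGE.le_ringKrullDim_self h).trans (ringKrullDim_le_of_surjective
    (Ideal.Quotient.factor (edgeIdeal_mono (Set.empty_subset _) fun i j _ ↦ ?_))
    (Ideal.Quotient.factor_surjective _))
  exact Or.inl ⟨Finset.mem_univ i, Finset.mem_univ j⟩

end BreakBounds

/-! ### Maximal cliques -/

section Facets

variable {V : Type*} {G : SimpleGraph V}

lemma exists_mem_cliqueComplexFacets [Finite V] {s : Set V} (hs : G.IsClique s) :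
    ∃ F ∈ cliqueComplexFacets G, s ⊆ F := by
  obtain ⟨F, hF, hF'⟩ := (Set.toFinite {t : Set V | G.IsClique t}).exists_le_maximal hs
  exact ⟨F, hF', hF⟩

lemma adj_iff_exists_mem_cliqueComplexFacets [Finite V] {i j : V} :
    G.Adj i j ↔ i ≠ j ∧ ∃ F ∈ cliqueComplexFacets G, i ∈ F ∧ j ∈ F := by
  refine ⟨fun h ↦ ⟨h.ne, ?_⟩, fun ⟨h, F, hF, hi, hj⟩ ↦ hF.1 hi hj h⟩
  obtain ⟨F, hF, hs⟩ := exists_mem_cliqueComplexFacets (G := G) (s := {i, j})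
    (SimpleGraph.isClique_pair.mpr fun _ ↦ h)
  exact ⟨F, hF, hs (by simp), hs (by simp)⟩

lemma exists_mem_cliqueComplexFacets_mem [Finite V] (i : V) :
    ∃ F ∈ cliqueComplexFacets G, i ∈ F := by
  obtain ⟨F, hF, hs⟩ := exists_mem_cliqueComplexFacets (G := G) (s := {i})
    (SimpleGraph.isClique_singleton i)
  exact ⟨F, hF, hs rfl⟩

/-- An antichain of cliques that contains every clique in one of its members consists of the
maximal cliques. -/
lemma cliqueComplexFacets_eq {S : Set (Set V)} (hS : ∀ F ∈ S, G.IsClique F)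
    (hcov : ∀ s, G.IsClique s → ∃ F ∈ S, s ⊆ F) (hanti : ∀ F ∈ S, ∀ F' ∈ S, F ⊆ F' → F = F') :
    cliqueComplexFacets G = S := by
  ext F
  refine ⟨fun hF ↦ ?_, fun hF ↦ ⟨hS F hF, fun F' hF' hle ↦ ?_⟩⟩
  · obtain ⟨F', hF', hle⟩ := hcov F hF.1
    rwa [hle.antisymm (hF.2 (hS F' hF') hle)]
  · obtain ⟨F'', hF'', hle'⟩ := hcov F' hF'
    have := hanti F hF F'' hF'' (hle.trans hle')
    rwa [this]

end Facets

/-! ### Lower bounds for the depth in the three families -/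

section DepthOfFacets

variable {K : Type*} [Field K] {n : ℕ} {G : SimpleGraph (Fin n)}

lemma EdgeDepthGE.congr {V : Type*} {U : Finset V} {r r' : V → V → Prop} {d : ℕ}
    (h : EdgeDepthGE K U r d) (hr : ∀ i j, i ≠ j → (r i j ↔ r' i j)) : EdgeDepthGE K U r' d := by
  rwa [EdgeDepthGE, ← edgeIdeal_congr hr]

lemma edgeDepthGE_adj_of_two_facets {F₁ F₂ : Set (Fin n)} (hne : F₁ ≠ F₂)
    (hF : cliqueComplexFacets G = {F₁, F₂}) (hcard : (F₁ ∩ F₂).ncard = 2) :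
    EdgeDepthGE K Finset.univ G.Adj n := by
  classical
  have h₁ : Maximal G.IsClique F₁ := hF.ge (by simp)
  have h₂ : Maximal G.IsClique F₂ := hF.ge (by simp)
  have hadj : ∀ i j, i ≠ j → (inCliques F₁.toFinset F₂.toFinset i j ↔ G.Adj i j) := by
    intro i j hij
    rw [adj_iff_exists_mem_cliqueComplexFacets, hF]
    simp [inCliques, hij]
  have hU : F₁.toFinset ∪ F₂.toFinset = Finset.univ := by
    ext i
    obtain ⟨F, hF', hi⟩ := exists_mem_cliqueComplexFacets_mem (G := G) i
    rw [hF] at hF'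
    rcases hF' with rfl | rfl <;> simp [hi]
  have hI : (F₁.toFinset ∩ F₂.toFinset).card = 2 := by
    rw [← hcard, ← Set.toFinset_inter, Set.ncard_eq_toFinset_card']
  have key : EdgeDepthGE K (F₁.toFinset ∪ F₂.toFinset) (inCliques F₁.toFinset F₂.toFinset) n := by
    refine edgeDepthGE_inCliques ?_ ?_ ?_
    · rw [Finset.sdiff_nonempty, Set.toFinset_subset_toFinset]
      exact fun h ↦ hne (h.antisymm (h₁.2 h₂.1 h))
    · rw [Finset.sdiff_nonempty, Set.toFinset_subset_toFinset]
      exact fun h ↦ hne ((h₂.2 h₁.1 h).antisymm h)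
    · rw [hI, hU, Finset.card_univ, Fintype.card_fin]
  rw [hU] at key
  exact key.congr hadj

/-- The vertex numbered `b` lies in all three facets. Completing there gives the complete graph.
Deleting it leaves `[1, b-1]` and `[b+1, n]`, joined by the edge `{b-1, b+1}` alone. -/
lemma edgeDepthGE_adj_of_three_intervals {b : ℕ} (hb : 3 ≤ b) (hbn : b + 2 ≤ n)
    (hG : ∀ i j : Fin n, G.Adj i j ↔ (i : ℕ) ≠ j ∧ (((i : ℕ) < b ∧ (j : ℕ) < b) ∨
      (b ≤ (i : ℕ) + 2 ∧ (i : ℕ) ≤ b ∧ b ≤ (j : ℕ) + 2 ∧ (j : ℕ) ≤ b) ∨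
      (b ≤ (i : ℕ) + 1 ∧ b ≤ (j : ℕ) + 1))) :
    EdgeDepthGE K Finset.univ G.Adj n := by
  obtain ⟨v, hv⟩ : ∃ v : Fin n, (v : ℕ) + 1 = b := ⟨⟨b - 1, by omega⟩, by dsimp only; omega⟩
  obtain ⟨u, hu⟩ : ∃ v : Fin n, (v : ℕ) + 2 = b := ⟨⟨b - 2, by omega⟩, by dsimp only; omega⟩
  obtain ⟨w, hw⟩ : ∃ v : Fin n, (v : ℕ) = b := ⟨⟨b, by omega⟩, rfl⟩
  have hcard : (Finset.univ.erase v).card = n - 1 := by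
    rw [Finset.card_erase_of_mem (Finset.mem_univ v), Finset.card_univ, Fintype.card_fin]
  set A : Finset (Fin n) := Finset.univ.filter fun i ↦ (i : ℕ) + 2 ≤ b with hA
  set B : Finset (Fin n) := Finset.univ.filter fun i ↦ b ≤ (i : ℕ) with hB
  have hAB : A ∪ B = Finset.univ.erase v := by
    ext i
    simp only [hA, hB, Finset.mem_union, Finset.mem_filter, Finset.mem_univ, true_and,
      Finset.mem_erase, and_true, ne_eq, Fin.ext_iff]
    omega
  refine EdgeDepthGE.of_completeAt (v := v) (fun i j h ↦ h.symm)
    (r₁ := inCliques Finset.univ Finset.univ)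
    (r₂ := fun i j ↦ inCliques A B i j ∨ (i = u ∧ j = w) ∨ (i = w ∧ j = u))
    (r₃ := inCliques (Finset.univ.erase v) (Finset.univ.erase v)) (fun i j hij ↦ ?_)
    (fun i j hij ↦ ?_) (fun i j hij ↦ ?_) (edgeDepthGE_clique ⟨v, Finset.mem_univ v⟩ (by simp)) ?_
    (edgeDepthGE_clique ⟨u, ?_⟩ (by omega))
  · rw [ne_eq, Fin.ext_iff] at hij
    have := i.isLt
    have := j.isLt
    simp only [completeAt, hG, inCliques, Finset.mem_univ, and_self, or_self, iff_true]
    omega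
  · rw [ne_eq, Fin.ext_iff] at hij
    simp only [isolate, hG, inCliques, hA, hB, Finset.mem_filter, Finset.mem_univ, true_and,
      Set.mem_singleton_iff, Fin.ext_iff]
    omega
  · simp only [isolate, inCliques, Finset.mem_erase, Finset.mem_univ, Set.mem_singleton_iff]
    tauto
  · rw [← hAB]
    refine edgeDepthGE_inCliques_or_edge ?_ ?_ ?_ ⟨⟨0, by omega⟩, ?_⟩ ⟨⟨b + 1, by omega⟩, ?_⟩ ?_
    · rw [Finset.disjoint_left]
      simp only [hA, hB, Finset.mem_filter, Finset.mem_univ, true_and]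
      omega
    · simp only [hA, Finset.mem_filter, Finset.mem_univ, true_and]; omega
    · simp only [hB, Finset.mem_filter, Finset.mem_univ, true_and]; omega
    · simp only [hA, Finset.mem_erase, ne_eq, Fin.ext_iff, Finset.mem_filter, Finset.mem_univ,
        true_and]
      omega
    · simp only [hB, Finset.mem_erase, ne_eq, Fin.ext_iff, Finset.mem_filter, Finset.mem_univ,
        true_and]
      omega
    · rw [hAB]; omega
  · simp only [Finset.mem_erase, ne_eq, Fin.ext_iff, Finset.mem_univ, and_true]; omega

/-- The vertex numbered `b` lies in the first three facets. Completing there merges them into `[1,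
b+2]`, which meets `[b+1, n]` in two vertices. Deleting it again leaves two cliques joined by one
edge. -/
lemma edgeDepthGE_adj_of_four_intervals {b : ℕ} (hb : 3 ≤ b) (hbn : b + 3 ≤ n)
    (hG : ∀ i j : Fin n, G.Adj i j ↔ (i : ℕ) ≠ j ∧ (((i : ℕ) < b ∧ (j : ℕ) < b) ∨
      (b ≤ (i : ℕ) + 2 ∧ (i : ℕ) ≤ b ∧ b ≤ (j : ℕ) + 2 ∧ (j : ℕ) ≤ b) ∨
      (b ≤ (i : ℕ) + 1 ∧ (i : ℕ) ≤ b + 1 ∧ b ≤ (j : ℕ) + 1 ∧ (j : ℕ) ≤ b + 1) ∨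
      (b ≤ (i : ℕ) ∧ b ≤ (j : ℕ)))) :
    EdgeDepthGE K Finset.univ G.Adj n := by
  obtain ⟨v, hv⟩ : ∃ v : Fin n, (v : ℕ) + 1 = b := ⟨⟨b - 1, by omega⟩, by dsimp only; omega⟩
  obtain ⟨u, hu⟩ : ∃ v : Fin n, (v : ℕ) + 2 = b := ⟨⟨b - 2, by omega⟩, by dsimp only; omega⟩
  obtain ⟨w, hw⟩ : ∃ v : Fin n, (v : ℕ) = b := ⟨⟨b, by omega⟩, rfl⟩
  obtain ⟨w', hw'⟩ : ∃ v : Fin n, (v : ℕ) = b + 1 := ⟨⟨b + 1, by omega⟩, rfl⟩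
  have hcard : (Finset.univ.erase v).card = n - 1 := by
    rw [Finset.card_erase_of_mem (Finset.mem_univ v), Finset.card_univ, Fintype.card_fin]
  set A : Finset (Fin n) := Finset.univ.filter fun i ↦ (i : ℕ) + 2 ≤ b with hA
  set A₁ : Finset (Fin n) := Finset.univ.filter fun i ↦ (i : ℕ) ≤ b + 1 with hA₁
  set A₃ : Finset (Fin n) := A₁.erase v with hA₃
  set B : Finset (Fin n) := Finset.univ.filter fun i ↦ b ≤ (i : ℕ) with hB
  have hAB : A ∪ B = Finset.univ.erase v := by
    ext i
    simp only [hA, hB, Finset.mem_union, Finset.mem_filter, Finset.mem_univ, true_and,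
      Finset.mem_erase, and_true, ne_eq, Fin.ext_iff]
    omega
  have hAB₁ : A₁ ∪ B = Finset.univ := by
    ext i
    simp only [hA₁, hB, Finset.mem_union, Finset.mem_filter, Finset.mem_univ, true_and, iff_true]
    omega
  have hAB₃ : A₃ ∪ B = Finset.univ.erase v := by
    ext i
    simp only [hA₃, hA₁, hB, Finset.mem_union, Finset.mem_filter, Finset.mem_univ, true_and,
      Finset.mem_erase, and_true, ne_eq, Fin.ext_iff]
    omega
  have hww' : w ≠ w' := fun h ↦ by rw [Fin.ext_iff] at h; omega
  have hI₁ : (A₁ ∩ B).card = 2 := by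
    rw [← Finset.card_pair hww']
    congr 1
    ext i
    simp only [hA₁, hB, Finset.mem_inter, Finset.mem_filter, Finset.mem_univ, true_and,
      Finset.mem_insert, Finset.mem_singleton, Fin.ext_iff]
    omega
  have hI₃ : (A₃ ∩ B).card = 2 := by
    rw [← hI₁]
    congr 1
    ext i
    simp only [hA₃, hA₁, hB, Finset.mem_inter, Finset.mem_filter, Finset.mem_univ, true_and,
      Finset.mem_erase, ne_eq, Fin.ext_iff]
    omega
  have h₁ : EdgeDepthGE K Finset.univ (inCliques A₁ B) n := by
    rw [← hAB₁]
    refine edgeDepthGE_inCliques ⟨u, ?_⟩ ⟨⟨b + 2, by omega⟩, ?_⟩ ?_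
    · simp only [hA₁, hB, Finset.mem_sdiff, Finset.mem_filter, Finset.mem_univ, true_and]; omega
    · simp only [hA₁, hB, Finset.mem_sdiff, Finset.mem_filter, Finset.mem_univ, true_and]; omega
    · rw [hI₁, hAB₁, Finset.card_univ, Fintype.card_fin]
  have h₃ : EdgeDepthGE K (Finset.univ.erase v) (inCliques A₃ B) (n - 1) := by
    rw [← hAB₃]
    refine edgeDepthGE_inCliques ⟨u, ?_⟩ ⟨⟨b + 2, by omega⟩, ?_⟩ ?_
    · simp only [hA₃, hA₁, hB, Finset.mem_sdiff, Finset.mem_filter, Finset.mem_univ, true_and,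
        Finset.mem_erase, ne_eq, Fin.ext_iff]
      omega
    · simp only [hA₃, hA₁, hB, Finset.mem_sdiff, Finset.mem_filter, Finset.mem_univ, true_and,
        Finset.mem_erase, ne_eq, Fin.ext_iff]
      omega
    · rw [hI₃, hAB₃, hcard]
  refine EdgeDepthGE.of_completeAt (v := v) (fun i j h ↦ h.symm) (r₁ := inCliques A₁ B)
    (r₂ := fun i j ↦ inCliques A B i j ∨ (i = u ∧ j = w) ∨ (i = w ∧ j = u))
    (r₃ := inCliques A₃ B) (fun i j hij ↦ ?_) (fun i j hij ↦ ?_) (fun i j hij ↦ ?_) h₁ ?_ h₃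
  · rw [ne_eq, Fin.ext_iff] at hij
    simp only [completeAt, hG, inCliques, hA₁, hB, Finset.mem_filter, Finset.mem_univ, true_and]
    omega
  · rw [ne_eq, Fin.ext_iff] at hij
    simp only [isolate, hG, inCliques, hA, hB, Finset.mem_filter, Finset.mem_univ, true_and,
      Set.mem_singleton_iff, Fin.ext_iff]
    omega
  · simp only [isolate, inCliques, hA₃, hA₁, hB, Finset.mem_erase, Finset.mem_filter,
      Finset.mem_univ, true_and, Set.mem_singleton_iff, ne_eq, Fin.ext_iff]
    omega
  · rw [← hAB]
    refine edgeDepthGE_inCliques_or_edge ?_ ?_ ?_ ⟨⟨0, by omega⟩, ?_⟩ ⟨w', ?_⟩ ?_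
    · rw [Finset.disjoint_left]
      simp only [hA, hB, Finset.mem_filter, Finset.mem_univ, true_and]
      omega
    · simp only [hA, Finset.mem_filter, Finset.mem_univ, true_and]; omega
    · simp only [hB, Finset.mem_filter, Finset.mem_univ, true_and]; omega
    · simp only [hA, Finset.mem_erase, ne_eq, Fin.ext_iff, Finset.mem_filter, Finset.mem_univ,
        true_and]
      omega
    · simp only [hB, Finset.mem_erase, ne_eq, Fin.ext_iff, Finset.mem_filter, Finset.mem_univ,
        true_and]
      omega
    · rw [hAB]; omega

/-- The interval cases give the adjacency relation from the list of the facets. -/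
lemma adj_iff_of_three_facets {b : ℕ} (hb : 3 ≤ b)
    (hF : cliqueComplexFacets G =
      {vertexInterval n 1 b, vertexInterval n (b - 1) (b + 1), vertexInterval n b n})
    (i j : Fin n) : G.Adj i j ↔ (i : ℕ) ≠ j ∧ (((i : ℕ) < b ∧ (j : ℕ) < b) ∨
      (b ≤ (i : ℕ) + 2 ∧ (i : ℕ) ≤ b ∧ b ≤ (j : ℕ) + 2 ∧ (j : ℕ) ≤ b) ∨
      (b ≤ (i : ℕ) + 1 ∧ b ≤ (j : ℕ) + 1)) := by
  rw [adj_iff_exists_mem_cliqueComplexFacets, hF]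
  simp only [Set.mem_insert_iff, Set.mem_singleton_iff, exists_eq_or_imp, exists_eq_left,
    vertexInterval, Set.mem_ofPred_eq, ne_eq, Fin.ext_iff]
  omega

lemma adj_iff_of_four_facets {b : ℕ} (hb : 3 ≤ b)
    (hF : cliqueComplexFacets G =
      {vertexInterval n 1 b, vertexInterval n (b - 1) (b + 1), vertexInterval n b (b + 2),
        vertexInterval n (b + 1) n})
    (i j : Fin n) : G.Adj i j ↔ (i : ℕ) ≠ j ∧ (((i : ℕ) < b ∧ (j : ℕ) < b) ∨
      (b ≤ (i : ℕ) + 2 ∧ (i : ℕ) ≤ b ∧ b ≤ (j : ℕ) + 2 ∧ (j : ℕ) ≤ b) ∨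
      (b ≤ (i : ℕ) + 1 ∧ (i : ℕ) ≤ b + 1 ∧ b ≤ (j : ℕ) + 1 ∧ (j : ℕ) ≤ b + 1) ∨
      (b ≤ (i : ℕ) ∧ b ≤ (j : ℕ))) := by
  rw [adj_iff_exists_mem_cliqueComplexFacets, hF]
  simp only [Set.mem_insert_iff, Set.mem_singleton_iff, exists_eq_or_imp, exists_eq_left,
    vertexInterval, Set.mem_ofPred_eq, ne_eq, Fin.ext_iff]
  omega

end DepthOfFacets

/-! ### The structure of connected closed graphs -/

section ClosedGraphs

variable {n : ℕ} {G : SimpleGraph (Fin n)}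

/-- Reachability along increasing edges. -/
abbrev UpReachable (G : SimpleGraph (Fin n)) : Fin n → Fin n → Prop :=
  Relation.ReflTransGen fun a b ↦ a < b ∧ G.Adj a b

lemma UpReachable.le {a b : Fin n} (h : UpReachable G a b) : a ≤ b := by
  induction h with
  | refl => exact le_rfl
  | tail _ h ih => exact ih.trans h.1.le

/-- The last step `x → b` of the increasing path and the edge from `c` up to `b` share their upper
end, so `x` and `c` are equal or adjacent. If `c < x` the argument repeats from `x`. -/
lemma IsClosedGraph.upReachable_or_of_gt (hG : IsClosedGraph G) {a b : Fin n}
    (h : UpReachable G a b) : ∀ c, G.Adj b c → c < b → UpReachable G a c ∨ UpReachable G c a := by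
  induction h with
  | refl => exact fun c hc hlt ↦ Or.inr (.single ⟨hlt, hc.symm⟩)
  | @tail x b hx hxb ih =>
    intro c hc hlt
    rcases lt_trichotomy x c with h | h | h
    · exact Or.inl (hx.tail ⟨h, hG.2 x c b hxb.1 hlt h.ne hxb.2 hc.symm⟩)
    · exact Or.inl (h ▸ hx)
    · exact ih c (hG.2 x c b hxb.1 hlt h.ne' hxb.2 hc.symm) h

lemma IsClosedGraph.upReachable_or_of_lt (hG : IsClosedGraph G) {a b : Fin n}
    (h : UpReachable G b a) : ∀ c, G.Adj b c → b < c → UpReachable G a c ∨ UpReachable G c a := by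
  induction h using Relation.ReflTransGen.head_induction_on with
  | refl => exact fun c hc hlt ↦ Or.inl (.single ⟨hlt, hc⟩)
  | @head b x hbx hx ih =>
    intro c hc hlt
    rcases lt_trichotomy x c with h | h | h
    · exact ih c (hG.1 b x c hbx.1 hlt h.ne hbx.2 hc) h
    · exact Or.inr (h ▸ hx)
    · exact Or.inr (hx.head ⟨h, hG.1 b c x hlt hbx.1 h.ne hc hbx.2⟩)

/-- Every walk can be straightened to a monotone one. Between consecutive numbers such a walk has no
room for another vertex, so they are adjacent. -/
lemma IsClosedGraph.upReachable_or (hG : IsClosedGraph G) (hc : G.Connected) (a b : Fin n) :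
    UpReachable G a b ∨ UpReachable G b a := by
  have h := (SimpleGraph.reachable_iff_reflTransGen a b).mp (hc.preconnected a b)
  induction h with
  | refl => exact Or.inl .refl
  | @tail b c _ hbc ih =>
    rcases ih with h | h <;> rcases hbc.ne.lt_or_gt with hlt | hlt
    · exact Or.inl (h.tail ⟨hlt, hbc⟩)
    · exact hG.upReachable_or_of_gt h c hbc hlt
    · exact hG.upReachable_or_of_lt h c hbc hlt
    · exact Or.inr (h.head ⟨hlt, hbc.symm⟩)

lemma IsClosedGraph.adj_of_eq_add_one (hG : IsClosedGraph G) (hc : G.Connected) (i j : Fin n)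
    (hij : (j : ℕ) = i + 1) : G.Adj i j := by
  rcases hG.upReachable_or hc i j with h | h
  · rcases Relation.ReflTransGen.cases_head h with h | ⟨x, hx, h⟩
    · rw [h] at hij; omega
    · have h₁ : (i : ℕ) < x := hx.1
      have h₂ : (x : ℕ) ≤ j := UpReachable.le h
      obtain rfl : x = j := Fin.ext (by omega)
      exact hx.2
  · have : (j : ℕ) ≤ i := h.le
    omega

lemma IsClosedGraph.adj_of_lt_left (hG : IsClosedGraph G)
    (hpath : ∀ i j : Fin n, (j : ℕ) = i + 1 → G.Adj i j) {i k : Fin n} (h : G.Adj i k) (m : ℕ) :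
    ∀ j : Fin n, (j : ℕ) = i + m → j < k → G.Adj j k := by
  induction m with
  | zero => intro j hj _; rwa [Fin.ext hj]
  | succ m ih =>
    intro j hj hjk
    have hjk' : (j : ℕ) < k := hjk
    obtain ⟨t, ht⟩ : ∃ t : Fin n, (t : ℕ) = i + m := ⟨⟨i + m, by omega⟩, rfl⟩
    have htk : t < k := Fin.lt_def.mpr (by omega)
    exact hG.1 t j k (Fin.lt_def.mpr (by omega)) htk hjk.ne (hpath t j (by omega)) (ih t ht htk)

lemma IsClosedGraph.adj_of_lt_right (hG : IsClosedGraph G)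
    (hpath : ∀ i j : Fin n, (j : ℕ) = i + 1 → G.Adj i j) {i k : Fin n} (h : G.Adj i k) (m : ℕ) :
    ∀ j : Fin n, (k : ℕ) = j + m → i < j → G.Adj i j := by
  induction m with
  | zero => intro j hj _; rwa [← Fin.ext hj]
  | succ m ih =>
    intro j hj hij
    have hij' : (i : ℕ) < j := hij
    have hk := k.isLt
    obtain ⟨t, ht⟩ : ∃ t : Fin n, (t : ℕ) = j + 1 := ⟨⟨j + 1, by omega⟩, rfl⟩
    have hit : i < t := Fin.lt_def.mpr (by omega)
    exact hG.2 i j t hit (Fin.lt_def.mpr (by omega)) hij.ne (ih t (by omega) hit)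
      (hpath j t ht)

/-- In a connected closed graph the neighbours above the vertex `i` are the vertices up to `c i`,
where `c` is monotone. -/
lemma IsClosedGraph.exists_reach (hG : IsClosedGraph G) (hc : G.Connected) :
    ∃ c : ℕ → ℕ, (∀ i j : Fin n, i < j → (G.Adj i j ↔ (j : ℕ) ≤ c i)) ∧
      (∀ i, i < n → i ≤ c i ∧ c i < n) ∧ (∀ i, i + 1 < n → i + 1 ≤ c i) ∧
      ∀ i j, i ≤ j → j < n → c i ≤ c j := by
  classical
  have hpath := hG.adj_of_eq_add_one hc
  -- The alternative `j ≤ i` gives `c i = i` when there is no neighbour above `i`.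
  let P : ℕ → ℕ → Prop := fun i j ↦
    j ≤ i ∨ ∃ (hi : i < n) (hj : j < n), G.Adj ⟨i, hi⟩ ⟨j, hj⟩
  let c : ℕ → ℕ := fun i ↦ Nat.findGreatest (P i) (n - 1)
  have hle : ∀ i j, j < n → P i j → j ≤ c i := fun i j hj hP ↦
    Nat.le_findGreatest (by omega) hP
  have hcn : ∀ i, i < n → c i < n := fun i hi ↦ by
    have : c i ≤ n - 1 := Nat.findGreatest_le _
    omega
  have hP : ∀ i, i < n → P i (c i) := fun i hi ↦
    Nat.findGreatest_spec (P := P i) (Nat.zero_le _) (Or.inl (Nat.zero_le _))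
  have hic : ∀ i, i < n → i ≤ c i := fun i hi ↦ hle i i hi (Or.inl le_rfl)
  have hadj : ∀ i : Fin n, (i : ℕ) < c i → G.Adj i ⟨c i, hcn i i.isLt⟩ := fun i hi ↦ by
    rcases hP i i.isLt with h | ⟨_, _, h⟩
    · omega
    · exact h
  refine ⟨c, fun i j hij ↦ ⟨fun h ↦ hle i j j.isLt (Or.inr ⟨i.isLt, j.isLt, h⟩), fun h ↦ ?_⟩,
    fun i hi ↦ ⟨hic i hi, hcn i hi⟩, fun i hi ↦ ?_, fun i j hij hj ↦ ?_⟩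
  · have hij' : (i : ℕ) < j := hij
    exact hG.adj_of_lt_right hpath (hadj i (by omega)) (c i - j) j (by dsimp only; omega) hij
  · exact hle i (i + 1) hi (Or.inr ⟨by omega, hi, hpath _ _ rfl⟩)
  · have hi : i < n := by omega
    rcases le_or_gt (c i) j with h | h
    · exact h.trans (hic j hj)
    · refine hle j (c i) (hcn i hi) (Or.inr ⟨hj, hcn i hi, ?_⟩)
      exact hG.adj_of_lt_left hpath (hadj ⟨i, hi⟩ (by dsimp only; omega)) (j - i) ⟨j, hj⟩
        (by dsimp only; omega) (Fin.lt_def.mpr h)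

lemma isFreeVertex_of_neighbors {V : Type*} {H : SimpleGraph V} {v : V}
    (h : ∀ i j, H.Adj v i → H.Adj v j → i ≠ j → H.Adj i j) : IsFreeVertex H v := by
  have hmem : ∀ F : Set V, H.IsClique F → v ∈ F → F ⊆ insert v (H.neighborSet v) :=
    fun F hF hv x hx ↦ by
      by_cases hxv : x = v
      · exact Or.inl hxv
      · exact Or.inr (hF hv hx (Ne.symm hxv))
  have hcl : H.IsClique (insert v (H.neighborSet v)) := by
    rw [SimpleGraph.isClique_insert]
    exact ⟨fun i hi j hj hij ↦ h i j hi hj hij, fun b hb _ ↦ hb⟩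
  refine ⟨insert v (H.neighborSet v), ⟨⟨hcl, fun F hF hle ↦ ?_⟩, Set.mem_insert _ _⟩, ?_⟩
  · exact hmem F hF (hle (Set.mem_insert _ _))
  · rintro F ⟨hF, hv⟩
    exact (hmem F hF.1 hv).antisymm (hF.2 hcl (hmem F hF.1 hv))

/-- A closed graph decomposes at a cut vertex whose removal separates the smaller vertices from
the larger ones. -/
lemma IsClosedGraph.isDecomposable (hG : IsClosedGraph G) {u v w : Fin n} (hu : u < v) (hw : v < w)
    (hsep : ∀ i j, i < v → v < j → ¬ G.Adj i j) : IsDecomposable G := by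
  -- Closedness makes the lower neighbours of `v` pairwise adjacent, and also the upper ones, so `v`
  -- is free on both sides.
  refine ⟨(⊤ : G.Subgraph).induce {i | i ≤ v}, (⊤ : G.Subgraph).induce {i | v ≤ i}, v, le_refl v,
    le_refl v, ?_, ?_, ?_, ?_, isFreeVertex_of_neighbors ?_, isFreeVertex_of_neighbors ?_⟩
  · refine SimpleGraph.Subgraph.ext ?_ ?_
    · ext i
      simp [le_total]
    · ext i j
      simp only [SimpleGraph.Subgraph.sup_adj, SimpleGraph.Subgraph.induce_adj,
        SimpleGraph.Subgraph.top_adj, Set.mem_ofPred_eq]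
      refine ⟨fun h ↦ h.elim (fun h ↦ h.2.2) (fun h ↦ h.2.2), fun h ↦ ?_⟩
      rcases le_or_gt i v with hi | hi <;> rcases le_or_gt j v with hj | hj
      · exact Or.inl ⟨hi, hj, h⟩
      · rcases hi.lt_or_eq with hi | rfl
        · exact (hsep i j hi hj h).elim
        · exact Or.inr ⟨le_rfl, hj.le, h⟩
      · rcases hj.lt_or_eq with hj | rfl
        · exact (hsep j i hj hi h.symm).elim
        · exact Or.inr ⟨hi.le, le_rfl, h⟩
      · exact Or.inr ⟨hi.le, hj.le, h⟩
  · ext i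
    exact ⟨fun h ↦ le_antisymm h.1 h.2, fun h ↦ ⟨le_of_eq h, ge_of_eq h⟩⟩
  · exact fun h ↦ hu.ne (h.le (show u ∈ {i | i ≤ v} from hu.le))
  · exact fun h ↦ hw.ne' (h.le (show w ∈ {i | v ≤ i} from hw.le))
  · rintro ⟨i, hi⟩ ⟨j, hj⟩ hvi hvj hij
    refine ⟨hi, hj, ?_⟩
    have h₁ : G.Adj v i := hvi.2.2
    have h₂ : G.Adj v j := hvj.2.2
    exact hG.2 i j v (lt_of_le_of_ne hi h₁.ne') (lt_of_le_of_ne hj h₂.ne')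
      (fun h ↦ hij (Subtype.ext h)) h₁.symm h₂.symm
  · rintro ⟨i, hi⟩ ⟨j, hj⟩ hvi hvj hij
    refine ⟨hi, hj, ?_⟩
    have h₁ : G.Adj v i := hvi.2.2
    have h₂ : G.Adj v j := hvj.2.2
    exact hG.1 v i j (lt_of_le_of_ne hi h₁.ne) (lt_of_le_of_ne hj h₂.ne)
      (fun h ↦ hij (Subtype.ext h)) h₁ h₂

lemma le_and_le_of_vertexInterval_subset {a b a' b' : ℕ} (ha : 1 ≤ a) (hab : a ≤ b) (hb : b ≤ n)
    (h : vertexInterval n a b ⊆ vertexInterval n a' b') : a' ≤ a ∧ b ≤ b' := by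
  have h₁ : (⟨a - 1, by omega⟩ : Fin n) ∈ vertexInterval n a' b' :=
    h (show a ≤ a - 1 + 1 ∧ a - 1 + 1 ≤ b by omega)
  have h₂ : (⟨b - 1, by omega⟩ : Fin n) ∈ vertexInterval n a' b' :=
    h (show a ≤ b - 1 + 1 ∧ b - 1 + 1 ≤ b by omega)
  have h₁' : a' ≤ a - 1 + 1 ∧ a - 1 + 1 ≤ b' := h₁
  have h₂' : a' ≤ b - 1 + 1 ∧ b - 1 + 1 ≤ b' := h₂
  omega

/-- A family of intervals gives the facets of the clique complex of a graph with the reach `c`. -/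
lemma cliqueComplexFacets_eq_of_reach {c : ℕ → ℕ}
    (hc : ∀ i j : Fin n, i < j → (G.Adj i j ↔ (j : ℕ) ≤ c i)) {ι : Type*} {p q : ι → ℕ}
    (hp : ∀ t, 1 ≤ p t ∧ p t ≤ q t ∧ q t ≤ n)
    (hclique : ∀ t i, p t ≤ i + 1 → i + 1 ≤ q t → q t ≤ c i + 1)
    (hcov : ∀ i, i < n → ∃ t, p t ≤ i + 1 ∧ c i + 1 ≤ q t ∧ i + 1 ≤ q t)
    (hanti : ∀ t t', p t' ≤ p t → q t ≤ q t' → t = t') (h0 : Nonempty ι) :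
    cliqueComplexFacets G = Set.range fun t ↦ vertexInterval n (p t) (q t) := by
  refine cliqueComplexFacets_eq ?_ (fun s hs ↦ ?_) ?_
  · rintro _ ⟨t, rfl⟩ i hi j hj hij
    have hi' : p t ≤ (i : ℕ) + 1 ∧ (i : ℕ) + 1 ≤ q t := hi
    have hj' : p t ≤ (j : ℕ) + 1 ∧ (j : ℕ) + 1 ≤ q t := hj
    have h₁ := hclique t i hi'.1 hi'.2
    have h₂ := hclique t j hj'.1 hj'.2
    rcases hij.lt_or_gt with h | h
    · exact (hc i j h).mpr (by omega)
    · exact ((hc j i h).mpr (by omega)).symm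
  · rcases s.eq_empty_or_nonempty with rfl | hne
    · exact ⟨_, ⟨h0.some, rfl⟩, Set.empty_subset _⟩
    · obtain ⟨m, hm, hmin⟩ := s.toFinite.exists_minimal hne
      obtain ⟨t, ht₁, ht₂, ht₃⟩ := hcov m m.isLt
      refine ⟨_, ⟨t, rfl⟩, fun j hj ↦ ?_⟩
      rcases lt_trichotomy m j with h | h | h
      · have h₁ := (hc m j h).mp (hs hm hj h.ne)
        have h₂ : (m : ℕ) < j := h
        exact ⟨by omega, by omega⟩
      · exact h ▸ ⟨ht₁, ht₃⟩
      · exact absurd (hmin hj h.le) (not_le.mpr h)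
  · rintro _ ⟨t, rfl⟩ _ ⟨t', rfl⟩ h
    obtain ⟨h₁, h₂⟩ := le_and_le_of_vertexInterval_subset (hp t).1 (hp t).2.1 (hp t).2.2 h
    rw [hanti t t' h₁ h₂]

end ClosedGraphs

/-! ### Depth at least `n` and the classification -/

section AlmostCohenMacaulay

variable {K : Type*} [Field K] {n : ℕ} {G : SimpleGraph (Fin n)}

lemma edgeDepthGE_univ {V : Type*} [Fintype V] {r : V → V → Prop} {d : ℕ} :
    EdgeDepthGE K Finset.univ r d ↔ DepthGE (idealOfVars (V ⊕ V) K)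
      (MvPolynomial (V ⊕ V) K ⧸ edgeIdeal K ∅ r) d := by
  have h : varsOf (((Finset.univ : Finset V) : Set V)ᶜ) = ∅ := by
    rw [Finset.coe_univ, Set.compl_univ]
    rfl
  rw [EdgeDepthGE, h]

lemma supportDim_quotient_binomialEdgeIdeal (hn : 0 < n)
    (hpath : ∀ i j : Fin n, (j : ℕ) = i + 1 → G.Adj i j) :
    Module.supportDim (MvPolynomial (Fin n ⊕ Fin n) K)
      (MvPolynomial (Fin n ⊕ Fin n) K ⧸ binomialEdgeIdeal K G) = (n + 1 : ℕ) := by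
  rw [Module.supportDim_quotient_eq_ringKrullDim, binomialEdgeIdeal_eq_edgeIdeal]
  exact le_antisymm (ringKrullDim_edgeIdeal_le hpath) (le_ringKrullDim_edgeIdeal hn)

lemma isGradedCohenMacaulay_of_complete (hn : 0 < n) (hG : ∀ i j : Fin n, i ≠ j → G.Adj i j) :
    IsGradedCohenMacaulay (Fin n ⊕ Fin n) K
      (MvPolynomial (Fin n ⊕ Fin n) K ⧸ binomialEdgeIdeal K G) := by
  have hpath : ∀ i j : Fin n, (j : ℕ) = i + 1 → G.Adj i j :=
    fun i j hij ↦ hG i j fun h ↦ by rw [h] at hij; omega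
  rw [IsGradedCohenMacaulay, supportDim_quotient_binomialEdgeIdeal hn hpath,
    binomialEdgeIdeal_eq_edgeIdeal]
  have hle : gradedDepth (Fin n ⊕ Fin n) K (MvPolynomial (Fin n ⊕ Fin n) K ⧸ edgeIdeal K ∅ G.Adj)
      ≤ (n + 1 : ℕ) := gradedDepth_le edgeIdeal_le_idealOfVars fun d hd ↦ by
    have h := (DepthGE.le_ringKrullDim_self hd).trans (ringKrullDim_edgeIdeal_le hpath)
    exact_mod_cast h
  have hge : ((n + 1 : ℕ) : ℕ∞) ≤
      gradedDepth (Fin n ⊕ Fin n) K (MvPolynomial (Fin n ⊕ Fin n) K ⧸ edgeIdeal K ∅ G.Adj) := by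
    refine DepthGE.le_gradedDepth edgeIdeal_le_idealOfVars (edgeDepthGE_univ.mp
      ((edgeDepthGE_clique (U := Finset.univ) ⟨⟨0, hn⟩, Finset.mem_univ _⟩ (by simp)).congr
        fun i j hij ↦ ?_))
    simp [inCliques, hG i j hij]
  rw [hle.antisymm hge]
  rfl

lemma isGradedAlmostCohenMacaulay_iff (hn : 0 < n)
    (hpath : ∀ i j : Fin n, (j : ℕ) = i + 1 → G.Adj i j) :
    IsGradedAlmostCohenMacaulay (Fin n ⊕ Fin n) K
      (MvPolynomial (Fin n ⊕ Fin n) K ⧸ binomialEdgeIdeal K G) ↔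
      EdgeDepthGE K Finset.univ G.Adj n := by
  rw [IsGradedAlmostCohenMacaulay, supportDim_quotient_binomialEdgeIdeal hn hpath,
    binomialEdgeIdeal_eq_edgeIdeal, edgeDepthGE_univ]
  refine ⟨fun h ↦ ?_, fun h ↦ ?_⟩
  · by_contra hd
    have hle : gradedDepth (Fin n ⊕ Fin n) K
        (MvPolynomial (Fin n ⊕ Fin n) K ⧸ edgeIdeal K ∅ G.Adj) ≤ (n - 1 : ℕ) :=
      gradedDepth_le edgeIdeal_le_idealOfVars fun d hd' ↦ by
        have : d ≤ n - 1 := by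
          by_contra hlt
          exact hd (hd'.mono (by omega))
        exact_mod_cast this
    generalize gradedDepth (Fin n ⊕ Fin n) K
      (MvPolynomial (Fin n ⊕ Fin n) K ⧸ edgeIdeal K ∅ G.Adj) = D at h hle
    lift D to ℕ using ne_top_of_le_ne_top (ENat.natCast_ne_top _) hle
    have h₁ : n + 1 ≤ D + 1 := by exact_mod_cast h
    have h₂ : D ≤ n - 1 := by exact_mod_cast hle
    omega
  · have hle := DepthGE.le_gradedDepth edgeIdeal_le_idealOfVars h
    have hle' : ((n : ℕ∞) : WithBot ℕ∞) ≤ (gradedDepth (Fin n ⊕ Fin n) K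
        (MvPolynomial (Fin n ⊕ Fin n) K ⧸ edgeIdeal K ∅ G.Adj) : WithBot ℕ∞) :=
      WithBot.coe_le_coe.mpr hle
    rw [Nat.cast_add, Nat.cast_one]
    exact add_le_add_left hle' 1

/-- The vertices from `l + 1` to `c l` are adjacent to `l`. The jump makes `l + 1`, and by
monotonicity all of them, reach `c l + 1`, which no vertex up to `l` does. -/
lemma isBreak_of_reach {c : ℕ → ℕ} (hc : ∀ i j : Fin n, i < j → (G.Adj i j ↔ (j : ℕ) ≤ c i))
    (hc₁ : ∀ i, i < n → i ≤ c i ∧ c i < n) (hc₃ : ∀ i j, i ≤ j → j < n → c i ≤ c j) {l r : Fin n}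
    (hlt : c l < c (l + 1)) (hr : (r : ℕ) = c l + 1) : IsBreak G l r := by
  have hlc := hc₁ l l.isLt
  refine ⟨Fin.lt_def.mpr (by omega), fun t h₁ h₂ ↦ ?_, fun t h₁ h₂ ↦ ?_, fun i j hi hj h ↦ ?_⟩
  · rw [hc l t h₁]
    rw [Fin.lt_def] at h₂
    omega
  · rw [hc t r h₂]
    have := hc₃ (l + 1) t h₁ t.isLt
    omega
  · have hi' := hc₃ i l hi l.isLt
    rw [Fin.le_def] at hi hj
    rw [hc i j (Fin.lt_def.mpr (by omega))] at h
    omega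

lemma eq_of_forall_not_lt {c : ℕ → ℕ} (hc₃ : ∀ i j, i ≤ j → j < n → c i ≤ c j) {i j : ℕ}
    (hij : i ≤ j) (hj : j < n) (h : ∀ t, i ≤ t → t < j → ¬ c t < c (t + 1)) : c i = c j := by
  induction j, hij using Nat.le_induction with
  | base => rfl
  | succ j hij ih =>
    rw [ih (by omega) fun t ht₁ ht₂ ↦ h t ht₁ (by omega)]
    exact (hc₃ j (j + 1) (by omega) hj).antisymm (not_lt.mp (h j hij (by omega)))

/-- The facets of an indecomposable closed graph whose depth is at least the number of
vertices. -/
lemma facets_of_edgeDepthGE (hclosed : IsClosedGraph G) (hindec : IsIndecomposable G)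
    (hncomplete : ¬ ∀ i j : Fin n, i ≠ j → G.Adj i j)
    (hd : EdgeDepthGE K Finset.univ G.Adj n) :
    (∃ F₁ F₂ : Set (Fin n), F₁ ≠ F₂ ∧ cliqueComplexFacets G = {F₁, F₂} ∧ (F₁ ∩ F₂).ncard = 2) ∨
      (∃ b : ℕ, 3 ≤ b ∧ b + 2 ≤ n ∧ cliqueComplexFacets G =
        {vertexInterval n 1 b, vertexInterval n (b - 1) (b + 1), vertexInterval n b n}) ∨
      (∃ b : ℕ, 3 ≤ b ∧ b + 3 ≤ n ∧ cliqueComplexFacets G =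
        {vertexInterval n 1 b, vertexInterval n (b - 1) (b + 1), vertexInterval n b (b + 2),
          vertexInterval n (b + 1) n}) := by
  obtain ⟨hconn, hindec⟩ := hindec
  have hpath := hclosed.adj_of_eq_add_one hconn
  rw [edgeDepthGE_univ] at hd
  obtain ⟨c, hc, hc₁, hc₂, hc₃⟩ := hclosed.exists_reach hconn
  -- every jump of the reach has overlap exactly two
  have hjump : ∀ l, l + 1 < n → c l < c (l + 1) → c l = l + 2 := by
    intro l hl hlt
    have h₁ := hc₁ (l + 1) hl
    have h₂ := hc₂ l hl
    have hb := isBreak_of_reach (l := ⟨l, by omega⟩) (r := ⟨c l + 1, by omega⟩) hc hc₁ hc₃ hlt rfl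
    have h₃ := depthGE_le_of_isBreak hpath hb hd
    dsimp only at h₃
    by_contra hne
    -- The depth bound leaves only `c l = l + 1`, and then the single separating vertex `l + 1`
    -- decomposes `G`.
    refine hindec (hclosed.isDecomposable (u := ⟨l, by omega⟩) (v := ⟨l + 1, hl⟩)
      (w := ⟨c l + 1, by omega⟩) (Fin.lt_def.mpr (by dsimp only; omega))
      (Fin.lt_def.mpr (by dsimp only; omega)) fun i j hi hj h ↦ hb.not_adj i j ?_ ?_ h)
    · rw [Fin.lt_def] at hi
      rw [Fin.le_def]
      dsimp only at hi ⊢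
      omega
    · rw [Fin.lt_def] at hj
      rw [Fin.le_def]
      dsimp only at hj ⊢
      omega
  -- Two disjoint separators of two vertices each, with a vertex between them, bound the depth by
  -- `(n - 4) + 3 = n - 1`.
  have hclose : ∀ l l', l' + 1 < n → c l < c (l + 1) → c l' < c (l' + 1) → l + 3 ≤ l' → False := by
    intro l l' hl' hlt hlt' hll'
    have h₁ := hc₁ (l + 1) (by omega)
    have h₁' := hc₁ (l' + 1) hl'
    have h₂ := hjump l (by omega) hlt
    have h₂' := hjump l' hl' hlt'
    have hb := isBreak_of_reach (l := ⟨l, by omega⟩) (r := ⟨c l + 1, by omega⟩) hc hc₁ hc₃ hlt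
      rfl
    have hb' := isBreak_of_reach (l := ⟨l', by omega⟩) (r := ⟨c l' + 1, by omega⟩) hc hc₁ hc₃ hlt'
      rfl
    have h₃ := depthGE_le_of_isBreak_of_isBreak hpath hb hb'
      (Fin.le_def.mpr (by dsimp only; omega)) hd
    dsimp only at h₃
    omega
  have hn : 0 < n := by
    have := hconn.nonempty
    exact Fin.pos_iff_nonempty.mpr this
  have hlast : c (n - 1) = n - 1 := by
    have := hc₁ (n - 1) (by omega)
    omega
  obtain ⟨l, ⟨hln, hl⟩, hmin⟩ : ∃ l, (l + 1 < n ∧ c l < c (l + 1)) ∧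
      ∀ t < l, ¬ (t + 1 < n ∧ c t < c (t + 1)) := by
    have hex : ∃ l, l + 1 < n ∧ c l < c (l + 1) := by
      by_contra! hno
      refine hncomplete fun i j hij ↦ ?_
      have hall : ∀ i : Fin n, c i = n - 1 := fun i ↦ by
        rw [← hlast]
        have := i.isLt
        exact eq_of_forall_not_lt hc₃ (by omega) (by omega)
          fun t _ ht ↦ not_lt.mpr (hno t (by omega))
      have := i.isLt
      have := j.isLt
      rcases hij.lt_or_gt with h | h
      · exact (hc i j h).mpr (by rw [hall]; omega)
      · exact ((hc j i h).mpr (by rw [hall]; omega)).symm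
    classical
    exact ⟨Nat.find hex, Nat.find_spec hex, fun t ht ↦ Nat.find_min hex ht⟩
  have hcl := hjump l hln hl
  have hlow : ∀ i ≤ l, c i = l + 2 := fun i hi ↦ by
    rw [← hcl]
    exact eq_of_forall_not_lt hc₃ hi (by omega) fun t _ ht h ↦ hmin t ht ⟨by omega, h⟩
  have hcl₁ := hc₁ (l + 1) hln
  have hhigh : ∀ i, l + 3 ≤ i → i < n → c i = n - 1 := fun i hi hin ↦ by
    rw [← hlast]
    exact eq_of_forall_not_lt hc₃ (by omega) (by omega)
      fun t ht₁ ht₂ h ↦ hclose l t (by omega) hl h (by omega)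
  have h₃ := hhigh (l + 3) le_rfl (by omega)
  have h₁₂ := hc₃ (l + 1) (l + 2) (by omega) (by omega)
  have h₂₃ := hc₃ (l + 2) (l + 3) (by omega) (by omega)
  have hval : ∀ i, (i ≤ l → c i = l + 2) ∧ (i = l + 1 → c i = c (l + 1)) ∧
      (i = l + 2 → c i = c (l + 2)) ∧ (l + 3 ≤ i → i < n → c i = n - 1) :=
    fun i ↦ ⟨hlow i, fun h ↦ by rw [h], fun h ↦ by rw [h], hhigh i⟩
  -- With the first jump at `l`, further jumps occur at most at `l + 1` and `l + 2`. Both give (c),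
  -- only `l + 1` gives (b), only `l + 2` is impossible, and neither gives (a).
  rcases h₁₂.lt_or_eq with hlt₁ | heq₁ <;> rcases h₂₃.lt_or_eq with hlt₂ | heq₂
  · have h₁ := hjump (l + 1) (by omega) hlt₁
    have h₂ := hjump (l + 2) (by omega) hlt₂
    -- The first clique consists of the indices `0, …, l + 2`, hence ends at the vertex numbered `l
    -- + 3`.
    refine Or.inr (Or.inr ⟨l + 3, by omega, by omega, ?_⟩)
    have h := cliqueComplexFacets_eq_of_reach hc (ι := Fin 4) (p := ![1, l + 2, l + 3, l + 4])
      (q := ![l + 3, l + 4, l + 5, n]) ?_ ?_ ?_ ?_ inferInstance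
    · rw [h]
      ext F
      simp [Fin.exists_fin_succ, eq_comm]
    · simp [Fin.forall_fin_succ]; omega
    · intro t i
      have := hval i
      fin_cases t <;> simp <;> omega
    · intro i hi
      have := hval i
      simp [Fin.exists_fin_succ]
      omega
    · simp [Fin.forall_fin_succ]; omega
  · have h₁ := hjump (l + 1) (by omega) hlt₁
    refine Or.inr (Or.inl ⟨l + 3, by omega, by omega, ?_⟩)
    have h := cliqueComplexFacets_eq_of_reach hc (ι := Fin 3) (p := ![1, l + 2, l + 3])
      (q := ![l + 3, l + 4, n]) ?_ ?_ ?_ ?_ inferInstance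
    · rw [h]
      ext F
      simp [Fin.exists_fin_succ, eq_comm]
    · simp [Fin.forall_fin_succ]; omega
    · intro t i
      have := hval i
      fin_cases t <;> simp <;> omega
    · intro i hi
      have := hval i
      simp [Fin.exists_fin_succ]
      omega
    · simp [Fin.forall_fin_succ]; omega
  · have h₂ := hjump (l + 2) (by omega) hlt₂
    -- Without a jump at `l + 1` there are three cliques, consecutive ones sharing two vertices and
    -- the outer ones disjoint. Their depth is at most `n - 1`.
    have hd' : DepthGE (idealOfVars (Fin n ⊕ Fin n) K)
        (MvPolynomial (Fin n ⊕ Fin n) K ⧸ edgeIdeal K ∅ G.Adj) (n - 1 + 1) := hd.mono (by omega)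
    have := depthGE_le_of_three_cliques (l := l) (by omega) (fun i j hij ↦ ?_) hd'
    · omega
    have hi := hval i
    have hj := hval j
    have hin := i.isLt
    have hjn := j.isLt
    rcases hij.lt_or_gt with h | h
    · rw [hc i j h]
      rw [Fin.lt_def] at h
      omega
    · rw [G.adj_comm, hc j i h]
      rw [Fin.lt_def] at h
      omega
  · refine Or.inl ⟨vertexInterval n 1 (l + 3), vertexInterval n (l + 2) n, fun h ↦ ?_, ?_, ?_⟩
    · have := (le_and_le_of_vertexInterval_subset le_rfl (by omega) (by omega) h.le).1
      omega
    · have h := cliqueComplexFacets_eq_of_reach hc (ι := Fin 2) (p := ![1, l + 2])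
        (q := ![l + 3, n]) ?_ ?_ ?_ ?_ inferInstance
      · rw [h]
        ext F
        simp [Fin.exists_fin_succ, eq_comm]
      · simp [Fin.forall_fin_succ]; omega
      · intro t i
        have := hval i
        fin_cases t <;> simp <;> omega
      · intro i hi
        have := hval i
        simp [Fin.exists_fin_succ]
        omega
      · simp [Fin.forall_fin_succ]; omega
    · rw [Set.ncard_eq_two]
      refine ⟨⟨l + 1, hln⟩, ⟨l + 2, by omega⟩, by simp, ?_⟩
      ext i
      have := i.isLt
      simp only [vertexInterval, Set.mem_inter_iff, Set.mem_ofPred_eq, Set.mem_insert_iff,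
        Set.mem_singleton_iff, Fin.ext_iff]
      omega

end AlmostCohenMacaulay

end

theorem theorem3p3 (K : Type*) [Field K] (n : ℕ) (G : SimpleGraph (Fin n))
    (hclosed : IsClosedGraph G) (hindec : IsIndecomposable G)
    (hCM : ¬ IsGradedCohenMacaulay (Fin n ⊕ Fin n) K
      (MvPolynomial (Fin n ⊕ Fin n) K ⧸ binomialEdgeIdeal K G)) :
    IsGradedAlmostCohenMacaulay (Fin n ⊕ Fin n) K
        (MvPolynomial (Fin n ⊕ Fin n) K ⧸ binomialEdgeIdeal K G) ↔
      (∃ F₁ F₂ : Set (Fin n), F₁ ≠ F₂ ∧ cliqueComplexFacets G = {F₁, F₂} ∧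
        (F₁ ∩ F₂).ncard = 2) ∨
      (∃ b : ℕ, 3 ≤ b ∧ b + 2 ≤ n ∧
        cliqueComplexFacets G =
          {vertexInterval n 1 b, vertexInterval n (b - 1) (b + 1), vertexInterval n b n}) ∨
      (∃ b : ℕ, 3 ≤ b ∧ b + 3 ≤ n ∧
        cliqueComplexFacets G =
          {vertexInterval n 1 b, vertexInterval n (b - 1) (b + 1), vertexInterval n b (b + 2),
            vertexInterval n (b + 1) n}) := by
  have hn : 0 < n := Fin.pos_iff_nonempty.mpr hindec.1.nonempty
  rw [isGradedAlmostCohenMacaulay_iff hn (hclosed.adj_of_eq_add_one hindec.1)]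
  refine ⟨fun hd ↦ facets_of_edgeDepthGE hclosed hindec
    (fun h ↦ hCM (isGradedCohenMacaulay_of_complete hn h)) hd, ?_⟩
  rintro (⟨F₁, F₂, hne, hF, hcard⟩ | ⟨b, hb, hbn, hF⟩ | ⟨b, hb, hbn, hF⟩)
  · exact edgeDepthGE_adj_of_two_facets hne hF hcard
  · exact edgeDepthGE_adj_of_three_intervals hb hbn (adj_iff_of_three_facets hb hF)
  · exact edgeDepthGE_adj_of_four_intervals hb hbn (adj_iff_of_four_facets hb hF)
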